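/- Let $(\omega_{\mathbf z})_{\mathbf z\in\mathbb Z^2}$ be i.i.d. non-negative random variables such that $\mathbb E[e^{\alpha\omega_{\mathbf z}}]<\infty$ for some $\alpha>0$, the distribution function of $\omega_{\mathbf z}$ is continuous, and $\mathbb P(\omega_{\mathbf z}>\beta)>0$ for every $\beta<\infty$. For $\mathbf u,\mathbf v\in\mathbb Z^2$ let $G_{\mathbf u,\mathbf v}$ be the maximum of $\sum_{\mathbf z\in\gamma\setminus\{\mathbf u\}}\omega_{\mathbf z}$ over all nearest-neighbour lattice paths $\gamma$ from $\mathbf u$ to $\mathbf v$ with steps in $\{(1,0),(0,1)\}$ ($G_{\mathbf u,\mathbf v}=-\infty$ if there is none). For $n\in\mathbb N$, the point-to-line geodesic from $\mathbf 0$ to the line $x+y=n$ is the (almost surely unique) such path from $\mathbf 0$ to a lattice point of this line whose weight attains $\max_{v_1+v_2=n}G_{\mathbf 0,\mathbf v}$; let $\mathrm{End}_{0,n}$ be its endpoint. Then for every $s\in[-\tfrac12,\tfrac12]$ and $r>0$ the limits $$\mu_s=\lim_{n\to\infty}\frac1n\,G_{\mathbf 0,(\lfloor n/2+sn\rfloor,\lfloor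 n/2-sn\rfloor)}\quad\text{(almost surely)},\qquad \mathcal J_s(r)=-\lim_{n\to\infty}\frac1n\log\mathbb P\big(G_{\mathbf 0,(\lfloor n/2+sn\rfloor,\lfloor n/2-sn\rfloor)}\ge rn\big)$$ exist and are finite and deterministic, and the following holds. Fix $0<t\le\tfrac12$ with $\mu_0>\mu_t$. For each $\epsilon>0$ there is an $n_0$ such that for all $n\ge n_0$, $$e^{-n(\mathcal J_t(\mu_0)+\epsilon)}\le\mathbb P\big(\mathrm{End}_{0,n}\cdot\mathbf e_1=\lfloor n/2+tn\rfloor\big)\le\mathbb P\big(\mathrm{End}_{0,n}\cdot\mathbf e_1\ge\lfloor n/2+tn\rfloor\big)\le e^{-n(\mathcal J_t(\mu_0)-\epsilon)}.$$ Consequently $$\mathcal J_t(\mu_0)=-\lim_{n\to\infty}\frac1n\log\mathbb P\big(\mathrm{End}_{0,n}\cdot\mathbf e_1=\lfloor n/2+tn\rfloor\big)=-\lim_{n\to\infty}\frac1n\log\mathbb P\big(\mathrm{End}_{0,n}\cdot\mathbf e_1\ge\lfloor n/2+tn\rfloor\big).$$ -/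

import Mathlib

open Filter Topology MeasureTheory ProbabilityTheory

/-- The values `γ 0, …, γ N` form an up-right nearest-neighbour lattice path from `u` to `v`.
The number of steps `N` is then necessarily the `ℓ¹`-distance of `u` and `v`;
the values of `γ` beyond `N` play no role. -/
structure IsUpRightPath (u v : ℤ × ℤ) (N : ℕ) (γ : ℕ → ℤ × ℤ) : Prop where
  start : γ 0 = u
  finish : γ N = v
  step : ∀ i < N, γ (i + 1) = γ i + (1, 0) ∨ γ (i + 1) = γ i + (0, 1)

/-- The weight of the path `γ 0, …, γ N`, excluding its starting point. -/
def pathWeight (w : ℤ × ℤ → ℝ) (N : ℕ) (γ : ℕ → ℤ × ℤ) : ℝ :=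
  ∑ i ∈ Finset.range N, w (γ (i + 1))

/-- The last-passage value `G_{u,v}`: the maximal weight of an up-right path from `u` to `v`,
and `-∞` if there is no such path. -/
noncomputable def lastPassage (w : ℤ × ℤ → ℝ) (u v : ℤ × ℤ) : EReal :=
  ⨆ (N : ℕ) (γ : ℕ → ℤ × ℤ) (_ : IsUpRightPath u v N γ), ((pathWeight w N γ : ℝ) : EReal)

/-- The point-to-line last-passage value from the origin to the line `x + y = n`. -/
noncomputable def pointToLine (w : ℤ × ℤ → ℝ) (n : ℕ) : EReal :=
  ⨆ (v : ℤ × ℤ) (_ : v.1 + v.2 = (n : ℤ)), lastPassage w 0 v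

/-- `γ 0, …, γ n` is a point-to-line geodesic: an up-right path from the origin to a point of the
line `x + y = n` whose weight is the point-to-line last-passage value. -/
def IsPointToLineGeodesic (w : ℤ × ℤ → ℝ) (n : ℕ) (γ : ℕ → ℤ × ℤ) : Prop :=
  ∃ v : ℤ × ℤ, v.1 + v.2 = (n : ℤ) ∧ IsUpRightPath 0 v n γ ∧
    ((pathWeight w n γ : ℝ) : EReal) = pointToLine w n

/-- The endpoint of the point-to-line geodesic from the origin to the line `x + y = n`. Under a
continuous weight distribution the geodesic is almost surely unique; on the null event where it is
not, the rightmost endpoint of a geodesic is taken (the set below is finite and nonempty). -/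
noncomputable def pointToLineEnd (w : ℤ × ℤ → ℝ) (n : ℕ) : ℤ × ℤ :=
  let x : ℤ := sSup {x : ℤ | ∃ γ, IsPointToLineGeodesic w n γ ∧ (γ n).1 = x}
  (x, (n : ℤ) - x)

/-- The lattice point `(⌊n/2 + tn⌋, ⌊n/2 - tn⌋)`. -/
noncomputable def dirPoint (t : ℝ) (n : ℕ) : ℤ × ℤ :=
  (⌊(n : ℝ) / 2 + t * n⌋, ⌊(n : ℝ) / 2 - t * n⌋)

section Model

variable {Ω : Type*} [MeasurableSpace Ω]

/-- The standing assumptions on the weights: i.i.d., non-negative, with some finite exponential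
moment, a continuous distribution function, and support unbounded above. -/
structure IsLPPWeights (P : Measure Ω) (w : ℤ × ℤ → Ω → ℝ) : Prop where
  measurable : ∀ z, Measurable (w z)
  indep : iIndepFun w P
  identDistrib : ∀ z, IdentDistrib (w z) (w 0) P P
  nonneg : ∀ z, ∀ᵐ ω ∂P, 0 ≤ w z ω
  expMoment : ∃ α : ℝ, 0 < α ∧ Integrable (fun ω => Real.exp (α * w 0 ω)) P
  continuous_cdf : Continuous (fun x : ℝ => P.real {ω | w 0 ω ≤ x})
  unbounded : ∀ β : ℝ, 0 < P {ω | β < w 0 ω}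

/-- The real number `m` is the value `μ_t` of the shape function in direction `t`: almost surely,
`G_{0, (⌊n/2 + tn⌋, ⌊n/2 - tn⌋)} / n → m`. -/
def IsShapeValue (P : Measure Ω) (w : ℤ × ℤ → Ω → ℝ) (t m : ℝ) : Prop :=
  ∀ᵐ ω ∂P, Tendsto
    (fun n : ℕ => (lastPassage (fun z => w z ω) 0 (dirPoint t n)).toReal / (n : ℝ))
    atTop (𝓝 m)

/-- The real number `j` is the value `𝒥_t(r)` of the right tail rate function:
`-(1/n) log P(G_{0, (⌊n/2 + tn⌋, ⌊n/2 - tn⌋)} ≥ r n) → j`. -/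
def IsRateValue (P : Measure Ω) (w : ℤ × ℤ → Ω → ℝ) (t r j : ℝ) : Prop :=
  Tendsto
    (fun n : ℕ => -(1 / (n : ℝ)) * Real.log
      (P.real {ω | ((r * n : ℝ) : EReal) ≤ lastPassage (fun z => w z ω) 0 (dirPoint t n)}))
    atTop (𝓝 j)

/-- The probability that the endpoint of the point-to-line geodesic to the line `x + y = n`
has first coordinate `⌊n/2 + tn⌋`. -/
noncomputable def probEndEq (P : Measure Ω) (w : ℤ × ℤ → Ω → ℝ) (t : ℝ) (n : ℕ) : ℝ :=
  P.real {ω | (pointToLineEnd (fun z => w z ω) n).1 = ⌊(n : ℝ) / 2 + t * n⌋}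

/-- The probability that the endpoint of the point-to-line geodesic to the line `x + y = n`
has first coordinate at least `⌊n/2 + tn⌋`. -/
noncomputable def probEndGe (P : Measure Ω) (w : ℤ × ℤ → Ω → ℝ) (t : ℝ) (n : ℕ) : ℝ :=
  P.real {ω | ⌊(n : ℝ) / 2 + t * n⌋ ≤ (pointToLineEnd (fun z => w z ω) n).1}

end Model

/-! ### Up-right paths -/

namespace IsUpRightPath

variable {u v x : ℤ × ℤ} {N M : ℕ} {γ γ' : ℕ → ℤ × ℤ}

/-! Right tails of passage values are supermultiplicative under concatenation of rectangles
(`tail_mul_le`). Fekete's lemma then gives the rate 𝒥_s(r), with an exponential bound valid at each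
fixed n and a convexity inequality in r. Mean passage values are superadditive, which defines μ_s.
Almost sure convergence follows from exponential lower-tail bounds for i.i.d. blocks, and from above
by a zero-one law combined with a greedy covering argument. Reflection symmetry makes μ_s maximal at
s = 0.

Upper bound. If the endpoint lies to the right of direction t, some point v there has a passage
value at least that of the diagonal point. For r < μ_0 the diagonal value falls below rn only with
superexponentially small probability, since many disjoint parallel columns would all have to be slow
(`exists_lower_tail_superexponential`). Otherwise one of at most n + 1 points v has value at least
rn. Gluing copies of v and of its mirror image leads to a point close to direction t on a larger
scale, so each such event has probability at most e^{-n𝒥_t(r')} with r' < r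
(`exists_tail_le_exp_rate`). Left continuity of the rate lets r' approach μ_0.

Lower bound. The path to the prescribed endpoint has to beat all others. It is built from N blocks
in direction t, each of value at least μ_0 M, at total cost about e^{-n𝒥_t(μ_0)}, followed by about
κn sites of weight above a large constant K, at a cost e^{-O(κn)}. A competitor leaves this path for
the last time at some site and from then on uses only weights off it. In a typical environment it
gains at most slope slightly above μ_0 from there (`tendsto_measureReal_pointToLine_ge`), which is
less than what the rest of the heavy path collects. Heaviness must not spoil typicality: with the
weights on the path frozen, the event that no previously listed path is heavy and the event that the
remaining environment is light are both decreasing in the other weights, so the Harris inequality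
keeps a factor 1/2 (`mul_measureReal_biUnion_le`). -/

theorem level (h : IsUpRightPath u v N γ) {i : ℕ} (hi : i ≤ N) :
    (γ i).1 + (γ i).2 = u.1 + u.2 + i := by
  induction i with
  | zero => simp [h.start]
  | succ k ih =>
    have := ih (by omega)
    rcases h.step k (by omega) with h' | h' <;> simp [h'] <;> omega

theorem monotone (h : IsUpRightPath u v N γ) {i j : ℕ} (hij : i ≤ j) (hj : j ≤ N) :
    γ i ≤ γ j := by
  induction j, hij using Nat.le_induction with
  | base => exact le_rfl
  | succ k hk ih =>
    refine (ih (by omega)).trans ?_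
    rcases h.step k (by omega) with h' | h' <;> rw [h', Prod.le_def] <;> simp

theorem start_le (h : IsUpRightPath u v N γ) {i : ℕ} (hi : i ≤ N) : u ≤ γ i := by
  simpa [h.start] using h.monotone (Nat.zero_le i) hi

theorem le_finish (h : IsUpRightPath u v N γ) {i : ℕ} (hi : i ≤ N) : γ i ≤ v := by
  simpa [h.finish] using h.monotone hi le_rfl

theorem le (h : IsUpRightPath u v N γ) : u ≤ v := by
  simpa [h.start] using h.le_finish (Nat.zero_le N)

theorem length_eq (h : IsUpRightPath u v N γ) : (N : ℤ) = v.1 + v.2 - u.1 - u.2 := by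
  have := h.level le_rfl
  rw [h.finish] at this
  omega

theorem take (h : IsUpRightPath u v N γ) {k : ℕ} (hk : k ≤ N) : IsUpRightPath u (γ k) k γ :=
  ⟨h.start, rfl, fun i hi => h.step i (by omega)⟩

theorem drop (h : IsUpRightPath u v N γ) {k : ℕ} (hk : k ≤ N) :
    IsUpRightPath (γ k) v (N - k) (fun i => γ (k + i)) :=
  ⟨rfl, by simpa [Nat.add_sub_cancel' hk] using h.finish, fun i hi => h.step (k + i) (by omega)⟩

theorem congr (h : IsUpRightPath u v N γ) (e : ∀ i ≤ N, γ i = γ' i) : IsUpRightPath u v N γ' :=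
  ⟨by rw [← e 0 (Nat.zero_le _), h.start], by rw [← e N le_rfl, h.finish], fun i hi => by
    rw [← e i hi.le, ← e (i + 1) hi]; exact h.step i hi⟩

theorem translate (h : IsUpRightPath u v N γ) (z : ℤ × ℤ) :
    IsUpRightPath (u + z) (v + z) N (fun i => γ i + z) :=
  ⟨by simp [h.start], by simp [h.finish], fun i hi => by
    rcases h.step i hi with h' | h'
    · left; simp only [h']; abel
    · right; simp only [h']; abel⟩

theorem swap (h : IsUpRightPath u v N γ) :
    IsUpRightPath u.swap v.swap N (fun i => (γ i).swap) :=
  ⟨by simp [h.start], by simp [h.finish], fun i hi => by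
    rcases h.step i hi with h' | h'
    · right; simp [h']
    · left; simp [h']⟩

end IsUpRightPath

/-- Follow `γ` for `N` steps, then `γ'`. -/
def pathAppend (N : ℕ) (γ γ' : ℕ → ℤ × ℤ) (i : ℕ) : ℤ × ℤ :=
  if i ≤ N then γ i else γ' (i - N)

theorem pathAppend_add {N : ℕ} {γ γ' : ℕ → ℤ × ℤ} (h : γ N = γ' 0) (i : ℕ) :
    pathAppend N γ γ' (N + i) = γ' i := by
  unfold pathAppend
  rcases Nat.eq_zero_or_pos i with rfl | hi
  · simpa using h
  · rw [if_neg (by omega)]; simp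

theorem pathAppend_of_le {N : ℕ} {γ γ' : ℕ → ℤ × ℤ} {i : ℕ} (hi : i ≤ N) :
    pathAppend N γ γ' i = γ i := if_pos hi

theorem pathWeight_add (W : ℤ × ℤ → ℝ) (k m : ℕ) (γ : ℕ → ℤ × ℤ) :
    pathWeight W (k + m) γ = pathWeight W k γ + pathWeight W m (fun i => γ (k + i)) := by
  simp only [pathWeight, Finset.sum_range_add, add_assoc]

theorem pathWeight_congr_path {W : ℤ × ℤ → ℝ} {N : ℕ} {γ γ' : ℕ → ℤ × ℤ}
    (h : ∀ i ≤ N, γ i = γ' i) : pathWeight W N γ = pathWeight W N γ' :=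
  Finset.sum_congr rfl fun i hi => by rw [h (i + 1) (Finset.mem_range.1 hi)]

theorem pathWeight_append (W : ℤ × ℤ → ℝ) {N M : ℕ} {γ γ' : ℕ → ℤ × ℤ} (h : γ N = γ' 0) :
    pathWeight W (N + M) (pathAppend N γ γ') = pathWeight W N γ + pathWeight W M γ' := by
  rw [pathWeight_add]
  congr 1
  · exact pathWeight_congr_path fun i hi => pathAppend_of_le hi
  · exact pathWeight_congr_path fun i _ => pathAppend_add h i

theorem IsUpRightPath.append {u v x : ℤ × ℤ} {N M : ℕ} {γ γ' : ℕ → ℤ × ℤ}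
    (h : IsUpRightPath u v N γ) (h' : IsUpRightPath v x M γ') :
    IsUpRightPath u x (N + M) (pathAppend N γ γ') := by
  have e : γ N = γ' 0 := by rw [h.finish, h'.start]
  refine ⟨by simp [pathAppend, h.start], by rw [pathAppend_add e, h'.finish], fun i hi => ?_⟩
  rcases lt_or_ge i N with hiN | hiN
  · rw [pathAppend_of_le hiN, pathAppend_of_le hiN.le]; exact h.step i hiN
  · obtain ⟨j, rfl⟩ := Nat.exists_eq_add_of_le hiN
    rw [add_assoc, pathAppend_add e, pathAppend_add e]; exact h'.step j (by omega)

theorem pathWeight_nonneg {W : ℤ × ℤ → ℝ} (hW : ∀ z, 0 ≤ W z) (N : ℕ) (γ : ℕ → ℤ × ℤ) :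
    0 ≤ pathWeight W N γ := Finset.sum_nonneg fun _ _ => hW _

theorem pathWeight_mono {W W' : ℤ × ℤ → ℝ} (hW : ∀ z, W z ≤ W' z) (N : ℕ) (γ : ℕ → ℤ × ℤ) :
    pathWeight W N γ ≤ pathWeight W' N γ := Finset.sum_le_sum fun _ _ => hW _

theorem exists_isUpRightPath {u v : ℤ × ℤ} (h : u ≤ v) : ∃ N γ, IsUpRightPath u v N γ := by
  obtain ⟨u1, u2⟩ := u
  obtain ⟨v1, v2⟩ := v
  obtain ⟨h1, h2⟩ := Prod.mk_le_mk.1 h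
  refine ⟨((v1 - u1) + (v2 - u2)).toNat,
    fun i => (min (u1 + i) v1, u2 + max 0 (i - (v1 - u1))), ?_, ?_, fun i hi => ?_⟩
  · ext <;> simp <;> omega
  · ext <;> simp <;> omega
  · rcases lt_or_ge (u1 + i) v1 with h | h
    · left; ext <;> simp <;> omega
    · right; ext <;> simp <;> omega

/-- The up-right path from `u` whose steps to the right are those with index in `S`. -/
def stepPath (u : ℤ × ℤ) (S : Finset ℕ) (i : ℕ) : ℤ × ℤ :=
  (u.1 + (S.filter (· < i)).card, u.2 + i - (S.filter (· < i)).card)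

theorem stepPath_zero (u : ℤ × ℤ) (S : Finset ℕ) : stepPath u S 0 = u := by
  simp [stepPath]

theorem stepPath_succ (u : ℤ × ℤ) (S : Finset ℕ) (i : ℕ) :
    stepPath u S (i + 1) = stepPath u S i + if i ∈ S then (1, 0) else (0, 1) := by
  have : ((S.filter (· < i + 1)).card : ℤ) =
      (S.filter (· < i)).card + if i ∈ S then 1 else 0 := by
    split_ifs with h
    · have this : S.filter (· < i + 1) = insert i (S.filter (· < i)) := by
        ext j; simp only [Finset.mem_filter, Finset.mem_insert]
        constructor
        · rintro ⟨h1, h2⟩; rcases Nat.lt_succ_iff_lt_or_eq.1 h2 with h | h <;> simp_all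
        · rintro (rfl | ⟨h1, h2⟩)
          · exact ⟨h, by omega⟩
          · exact ⟨h1, by omega⟩
      rw [this, Finset.card_insert_of_notMem (by simp)]; simp
    · have : S.filter (· < i + 1) = S.filter (· < i) := by
        ext j; simp only [Finset.mem_filter, and_congr_right_iff]
        intro hj
        have : j ≠ i := fun e => h (e ▸ hj)
        omega
      rw [this]; simp
  unfold stepPath
  rw [this]
  split_ifs <;> ext <;> simp <;> ring

theorem stepPath_isUpRightPath (u : ℤ × ℤ) (S : Finset ℕ) (N : ℕ) :
    IsUpRightPath u (stepPath u S N) N (stepPath u S) :=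
  ⟨stepPath_zero u S, rfl, fun i _ => by rw [stepPath_succ]; split_ifs <;> simp⟩

/-- Coding a path by the set of its right steps leaves 2^N candidates: suprema are attained, passage
values are measurable, and union bounds are available. -/
theorem IsUpRightPath.exists_stepPath {u v : ℤ × ℤ} {N : ℕ} {γ : ℕ → ℤ × ℤ}
    (h : IsUpRightPath u v N γ) :
    ∃ S ∈ (Finset.range N).powerset, ∀ i ≤ N, γ i = stepPath u S i := by
  classical
  refine ⟨(Finset.range N).filter fun i => γ (i + 1) = γ i + (1, 0),
    Finset.mem_powerset.2 (Finset.filter_subset _ _), fun i => ?_⟩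
  induction i with
  | zero => intro _; rw [stepPath_zero, h.start]
  | succ k ih =>
    intro hk
    rw [stepPath_succ, ← ih (by omega)]
    by_cases h' : γ (k + 1) = γ k + (1, 0)
    · rw [if_pos (by simp [h']; omega), h']
    · rw [if_neg (by simp [h']), (h.step k hk).resolve_left h']

/-! ### Last-passage values -/

/-- The real last-passage value. -/
noncomputable def lpp (W : ℤ × ℤ → ℝ) (u v : ℤ × ℤ) : ℝ := (lastPassage W u v).toReal

theorem exists_maximal_path (W : ℤ × ℤ → ℝ) {u v : ℤ × ℤ} (huv : u ≤ v) :
    ∃ N γ, IsUpRightPath u v N γ ∧ lastPassage W u v = (pathWeight W N γ : ℝ) ∧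
      ∀ N' γ', IsUpRightPath u v N' γ' → pathWeight W N' γ' ≤ pathWeight W N γ := by
  obtain ⟨N, γ₀, h₀⟩ := exists_isUpRightPath huv
  set F := (Finset.range N).powerset.filter fun S => stepPath u S N = v with hF
  have hne : F.Nonempty := by
    obtain ⟨S, hS, hS'⟩ := h₀.exists_stepPath
    exact ⟨S, by simp only [hF, Finset.mem_filter, hS, true_and]; rw [← hS' N le_rfl, h₀.finish]⟩
  obtain ⟨S, hS, hmax⟩ := F.exists_max_image (fun S => pathWeight W N (stepPath u S)) hne
  have hp : IsUpRightPath u v N (stepPath u S) := by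
    have := stepPath_isUpRightPath u S N
    rwa [(Finset.mem_filter.1 hS).2] at this
  have key : ∀ N' γ', IsUpRightPath u v N' γ' →
      pathWeight W N' γ' ≤ pathWeight W N (stepPath u S) := by
    intro N' γ' h'
    obtain rfl : N' = N := by have := h'.length_eq; have := hp.length_eq; omega
    obtain ⟨S', hS', e⟩ := h'.exists_stepPath
    rw [pathWeight_congr_path e]
    refine hmax S' (Finset.mem_filter.2 ⟨hS', ?_⟩)
    rw [← e N' le_rfl, h'.finish]
  refine ⟨N, _, hp, le_antisymm ?_ ?_, key⟩
  · exact iSup_le fun N' => iSup_le fun γ' => iSup_le fun h' => EReal.coe_le_coe_iff.2 (key _ _ h')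
  · exact le_iSup_of_le N (le_iSup_of_le _ (le_iSup_of_le hp le_rfl))

theorem lastPassage_eq_bot (W : ℤ × ℤ → ℝ) {u v : ℤ × ℤ} (huv : ¬ u ≤ v) :
    lastPassage W u v = ⊥ := by
  refine le_bot_iff.1 (iSup_le fun N' => iSup_le fun γ' => iSup_le fun h' => absurd h'.le huv)

theorem lpp_of_not_le (W : ℤ × ℤ → ℝ) {u v : ℤ × ℤ} (huv : ¬ u ≤ v) : lpp W u v = 0 := by
  simp [lpp, lastPassage_eq_bot W huv]

theorem lastPassage_eq_coe (W : ℤ × ℤ → ℝ) {u v : ℤ × ℤ} (huv : u ≤ v) :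
    lastPassage W u v = (lpp W u v : ℝ) := by
  obtain ⟨N, γ, h, e, -⟩ := exists_maximal_path W huv
  rw [lpp, e, EReal.toReal_coe]

theorem exists_path_lpp (W : ℤ × ℤ → ℝ) {u v : ℤ × ℤ} (huv : u ≤ v) :
    ∃ N γ, IsUpRightPath u v N γ ∧ pathWeight W N γ = lpp W u v := by
  obtain ⟨N, γ, h, e, -⟩ := exists_maximal_path W huv
  exact ⟨N, γ, h, by rw [lpp, e, EReal.toReal_coe]⟩

theorem IsUpRightPath.weight_le_lpp {u v : ℤ × ℤ} {N : ℕ} {γ : ℕ → ℤ × ℤ}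
    (h : IsUpRightPath u v N γ) (W : ℤ × ℤ → ℝ) : pathWeight W N γ ≤ lpp W u v := by
  obtain ⟨N, γ, h', e, hm⟩ := exists_maximal_path W h.le
  rw [lpp, e, EReal.toReal_coe]
  exact hm _ _ h

theorem le_lpp_iff (W : ℤ × ℤ → ℝ) {u v : ℤ × ℤ} (huv : u ≤ v) (a : ℝ) :
    a ≤ lpp W u v ↔ ∃ N γ, IsUpRightPath u v N γ ∧ a ≤ pathWeight W N γ := by
  constructor
  · intro h
    obtain ⟨N, γ, hγ, e⟩ := exists_path_lpp W huv
    exact ⟨N, γ, hγ, e ▸ h⟩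
  · rintro ⟨N, γ, hγ, h⟩
    exact h.trans (hγ.weight_le_lpp W)

theorem lpp_le_iff (W : ℤ × ℤ → ℝ) {u v : ℤ × ℤ} (huv : u ≤ v) (a : ℝ) :
    lpp W u v ≤ a ↔ ∀ N γ, IsUpRightPath u v N γ → pathWeight W N γ ≤ a := by
  constructor
  · intro h N γ hγ
    exact (hγ.weight_le_lpp W).trans h
  · intro h
    obtain ⟨N, γ, hγ, e⟩ := exists_path_lpp W huv
    exact e ▸ h N γ hγ

theorem lpp_nonneg {W : ℤ × ℤ → ℝ} (hW : ∀ z, 0 ≤ W z) (u v : ℤ × ℤ) : 0 ≤ lpp W u v := by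
  by_cases huv : u ≤ v
  · obtain ⟨N, γ, hγ, e⟩ := exists_path_lpp W huv
    exact e ▸ pathWeight_nonneg hW _ _
  · exact (lpp_of_not_le W huv).ge

theorem lpp_self (W : ℤ × ℤ → ℝ) (u : ℤ × ℤ) : lpp W u u = 0 := by
  obtain ⟨N, γ, hγ, e⟩ := exists_path_lpp W (le_refl u)
  obtain rfl : N = 0 := by have := hγ.length_eq; omega
  simpa [pathWeight] using e.symm

theorem lpp_add_le (W : ℤ × ℤ → ℝ) {u v x : ℤ × ℤ} (huv : u ≤ v) (hvx : v ≤ x) :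
    lpp W u v + lpp W v x ≤ lpp W u x := by
  obtain ⟨N, γ, hγ, e⟩ := exists_path_lpp W huv
  obtain ⟨N', γ', hγ', e'⟩ := exists_path_lpp W hvx
  rw [← e, ← e', ← pathWeight_append W (by rw [hγ.finish, hγ'.start])]
  exact (hγ.append hγ').weight_le_lpp W

theorem lpp_mono_right {W : ℤ × ℤ → ℝ} (hW : ∀ z, 0 ≤ W z) {u v x : ℤ × ℤ} (huv : u ≤ v)
    (hvx : v ≤ x) : lpp W u v ≤ lpp W u x := by
  linarith [lpp_add_le W huv hvx, lpp_nonneg hW v x]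

theorem lpp_anti_left {W : ℤ × ℤ → ℝ} (hW : ∀ z, 0 ≤ W z) {u v x : ℤ × ℤ} (huv : u ≤ v)
    (hvx : v ≤ x) : lpp W v x ≤ lpp W u x := by
  linarith [lpp_add_le W huv hvx, lpp_nonneg hW u v]

theorem lpp_mono_weights {W W' : ℤ × ℤ → ℝ} (hW : ∀ z, W z ≤ W' z) (u v : ℤ × ℤ) :
    lpp W u v ≤ lpp W' u v := by
  by_cases huv : u ≤ v
  · rw [lpp_le_iff W huv]
    intro N γ hγ
    exact (pathWeight_mono hW N γ).trans (hγ.weight_le_lpp W')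
  · rw [lpp_of_not_le W huv, lpp_of_not_le W' huv]

theorem lpp_translate (W : ℤ × ℤ → ℝ) (u v z : ℤ × ℤ) :
    lpp W (u + z) (v + z) = lpp (fun y => W (y + z)) u v := by
  by_cases huv : u ≤ v
  · have huv' : u + z ≤ v + z := by gcongr
    refine le_antisymm ((lpp_le_iff _ huv' _).2 fun N γ hγ => ?_)
      ((lpp_le_iff _ huv _).2 fun N γ hγ => ?_)
    · have := hγ.translate (-z)
      simp only [add_neg_cancel_right] at this
      simpa [pathWeight] using this.weight_le_lpp (fun y => W (y + z))
    · exact (hγ.translate z).weight_le_lpp W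
  · rw [lpp_of_not_le _ huv, lpp_of_not_le _ (by simpa using huv)]

theorem lpp_swap (W : ℤ × ℤ → ℝ) (u v : ℤ × ℤ) :
    lpp W u.swap v.swap = lpp (fun y => W y.swap) u v := by
  by_cases huv : u ≤ v
  · have huv' : u.swap ≤ v.swap := Prod.swap_le_swap.2 huv
    refine le_antisymm ((lpp_le_iff _ huv' _).2 fun N γ hγ => ?_)
      ((lpp_le_iff _ huv _).2 fun N γ hγ => ?_)
    · simpa [pathWeight] using hγ.swap.weight_le_lpp (fun y => W y.swap)
    · exact hγ.swap.weight_le_lpp W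
  · rw [lpp_of_not_le _ huv, lpp_of_not_le _ (by simpa using huv)]

/-- The sites that may contribute to the last-passage value from `u` to `v`. -/
noncomputable def lppSites (u v : ℤ × ℤ) : Finset (ℤ × ℤ) := (Finset.Icc u v).erase u

theorem IsUpRightPath.mem_lppSites {u v : ℤ × ℤ} {N : ℕ} {γ : ℕ → ℤ × ℤ}
    (h : IsUpRightPath u v N γ) {i : ℕ} (hi : i < N) : γ (i + 1) ∈ lppSites u v := by
  refine Finset.mem_erase.2 ⟨fun e => ?_, Finset.mem_Icc.2 ⟨h.start_le hi, h.le_finish hi⟩⟩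
  have := h.level (show i + 1 ≤ N from hi)
  rw [e] at this
  push_cast at this
  omega

theorem IsUpRightPath.weight_congr {u v : ℤ × ℤ} {N : ℕ} {γ : ℕ → ℤ × ℤ}
    (h : IsUpRightPath u v N γ) {W W' : ℤ × ℤ → ℝ} (e : ∀ z ∈ lppSites u v, W z = W' z) :
    pathWeight W N γ = pathWeight W' N γ :=
  Finset.sum_congr rfl fun _ hi => e _ (h.mem_lppSites (Finset.mem_range.1 hi))

theorem lpp_congr {W W' : ℤ × ℤ → ℝ} {u v : ℤ × ℤ} (e : ∀ z ∈ lppSites u v, W z = W' z) :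
    lpp W u v = lpp W' u v := by
  by_cases huv : u ≤ v
  · refine le_antisymm ((lpp_le_iff _ huv _).2 fun N γ hγ => ?_)
      ((lpp_le_iff _ huv _).2 fun N γ hγ => ?_)
    · rw [hγ.weight_congr e]; exact hγ.weight_le_lpp W'
    · rw [← hγ.weight_congr e]; exact hγ.weight_le_lpp W
  · rw [lpp_of_not_le W huv, lpp_of_not_le W' huv]

theorem measurable_pathWeight (N : ℕ) (γ : ℕ → ℤ × ℤ) :
    Measurable fun W : ℤ × ℤ → ℝ => pathWeight W N γ :=
  Finset.measurable_sum _ fun _ _ => measurable_pi_apply _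

theorem measurable_lpp (u v : ℤ × ℤ) : Measurable fun W : ℤ × ℤ → ℝ => lpp W u v := by
  by_cases huv : u ≤ v
  · refine measurable_of_Ici fun a => ?_
    obtain ⟨N, γ₀, h₀⟩ := exists_isUpRightPath huv
    have : (fun W => lpp W u v) ⁻¹' Set.Ici a =
        ⋃ S ∈ (Finset.range N).powerset.filter fun S => stepPath u S N = v,
          {W : ℤ × ℤ → ℝ | a ≤ pathWeight W N (stepPath u S)} := by
      ext W
      simp only [Set.mem_preimage, Set.mem_Ici, le_lpp_iff W huv, Set.mem_iUnion, Finset.mem_filter,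
        Set.mem_ofPred_eq, exists_prop]
      constructor
      · rintro ⟨N', γ, hγ, h⟩
        obtain rfl : N' = N := by have := hγ.length_eq; have := h₀.length_eq; omega
        obtain ⟨S, hS, e⟩ := hγ.exists_stepPath
        exact ⟨S, ⟨hS, by rw [← e N' le_rfl, hγ.finish]⟩, by rwa [← pathWeight_congr_path e]⟩
      · rintro ⟨S, ⟨hS, e⟩, h⟩
        exact ⟨N, _, e ▸ stepPath_isUpRightPath u S N, h⟩
    rw [this]
    exact Finset.measurableSet_biUnion _ fun S _ =>
      measurableSet_le measurable_const (measurable_pathWeight _ _)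
  · simp only [lpp_of_not_le _ huv]
    exact measurable_const

/-! ### Independent weights -/

set_option linter.unusedSectionVars false

section Weights

variable {Ω : Type*} [MeasurableSpace Ω]

/-- I.i.d. weights that are non-negative at every sample point, have some finite exponential moment
and are unbounded above. -/
structure IsNonnegWeights (P : Measure Ω) (X : Ω → ℤ × ℤ → ℝ) : Prop where
  measurable_apply : ∀ z, Measurable fun ω => X ω z
  indep : iIndepFun (fun z ω => X ω z) P
  identDistrib : ∀ z, IdentDistrib (fun ω => X ω z) (fun ω => X ω 0) P P
  nonneg : ∀ ω z, 0 ≤ X ω z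
  expMoment : ∃ α : ℝ, 0 < α ∧ Integrable (fun ω => Real.exp (α * X ω 0)) P
  unbounded : ∀ β : ℝ, 0 < P {ω | β < X ω 0}

/-- Extend a function on a finite set of sites by `0`. -/
noncomputable def extendZero (S : Finset (ℤ × ℤ)) (a : S → ℝ) (z : ℤ × ℤ) : ℝ :=
  if h : z ∈ S then a ⟨z, h⟩ else 0

theorem measurable_extendZero (S : Finset (ℤ × ℤ)) : Measurable (extendZero S) := by
  refine measurable_pi_lambda _ fun z => ?_
  unfold extendZero
  by_cases h : z ∈ S
  · simpa [h] using measurable_pi_apply (⟨z, h⟩ : S)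
  · simp [h]

theorem DependsOn.eq_extendZero {β : Type*} {F : (ℤ × ℤ → ℝ) → β} {S : Finset (ℤ × ℤ)}
    (hF : DependsOn F S) (W : ℤ × ℤ → ℝ) : F W = F (extendZero S fun z => W z) :=
  hF fun z hz => by
    have hz' : z ∈ S := hz
    simp [extendZero, hz']

theorem dependsOn_lpp (u v : ℤ × ℤ) : DependsOn (fun W => lpp W u v) (lppSites u v) :=
  fun _ _ h => lpp_congr h

namespace IsNonnegWeights

variable {P : Measure Ω} [IsProbabilityMeasure P] {X : Ω → ℤ × ℤ → ℝ}

theorem measurable (h : IsNonnegWeights P X) : Measurable X :=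
  measurable_pi_lambda _ h.measurable_apply

theorem indepFun_of_dependsOn (h : IsNonnegWeights P X) {β β' : Type*} [MeasurableSpace β]
    [MeasurableSpace β'] {F : (ℤ × ℤ → ℝ) → β} {G : (ℤ × ℤ → ℝ) → β'} (hF : Measurable F)
    (hG : Measurable G) {S T : Finset (ℤ × ℤ)} (hFS : DependsOn F S) (hGT : DependsOn G T)
    (hST : Disjoint S T) : IndepFun (fun ω => F (X ω)) (fun ω => G (X ω)) P := by
  have := (h.indep.indepFun_finset S T hST h.measurable_apply).comp
    (hF.comp (measurable_extendZero S)) (hG.comp (measurable_extendZero T))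
  convert this using 2 with ω ω
  · exact hFS.eq_extendZero _
  · exact hGT.eq_extendZero _

/-- Induction on the index set: the functions already treated are bundled into one vector depending
on the union of their sites, which reduces joint independence to the case of two blocks. -/
theorem iIndepFun_of_dependsOn (h : IsNonnegWeights P X) {ι β : Type*} [MeasurableSpace β]
    {F : ι → (ℤ × ℤ → ℝ) → β} (hF : ∀ i, Measurable (F i)) {S : ι → Finset (ℤ × ℤ)}
    (hFS : ∀ i, DependsOn (F i) (S i)) (hS : Pairwise fun i j => Disjoint (S i) (S j)) :
    iIndepFun (fun i ω => F i (X ω)) P := by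
  classical
  rw [iIndepFun_iff_measure_inter_preimage_eq_mul]
  intro I
  induction I using Finset.induction_on with
  | empty => intro sets _; simp
  | insert i I hi ih =>
    intro sets hsets
    rw [Finset.set_biInter_insert, Finset.prod_insert hi,
      ← ih fun j hj => hsets j (Finset.mem_insert_of_mem hj)]
    set T := I.biUnion S
    have hdis : Disjoint (S i) T := by
      rw [Finset.disjoint_biUnion_right]
      exact fun j hj => hS fun e => hi (e ▸ hj)
    have hG : Measurable fun (W : ℤ × ℤ → ℝ) (j : I) => F j W :=
      measurable_pi_lambda _ fun j => hF j
    have hGT : DependsOn (fun (W : ℤ × ℤ → ℝ) (j : I) => F j W) T := fun W W' e => by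
      funext j
      exact hFS j fun z hz => e z (Finset.mem_coe.2 (Finset.mem_biUnion.2 ⟨j, j.2, hz⟩))
    have hind := h.indepFun_of_dependsOn (hF i) hG (hFS i) hGT hdis
    have hm : MeasurableSet (Set.univ.pi fun j : I => sets j) :=
      MeasurableSet.univ_pi fun j => hsets j (Finset.mem_insert_of_mem j.2)
    have := hind.measure_inter_preimage_eq_mul _ _ (hsets i (Finset.mem_insert_self _ _)) hm
    convert this using 3 <;> (ext ω; simp)

/-- Both fields have the same infinite product law. It is used for translations and for the swap of
coordinates. -/
theorem identDistrib_comp (h : IsNonnegWeights P X) {e : ℤ × ℤ → ℤ × ℤ}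
    (he : Function.Injective e) : IdentDistrib (fun ω z => X ω (e z)) X P P := by
  refine ⟨(measurable_pi_lambda _ fun z => h.measurable_apply _).aemeasurable,
    h.measurable.aemeasurable, ?_⟩
  have h1 := (h.indep.precomp he).map_fun_eq_infinitePi_map fun z => h.measurable_apply (e z)
  have h2 := h.indep.map_fun_eq_infinitePi_map h.measurable_apply
  rw [h1]
  refine Eq.trans ?_ h2.symm
  congr 1
  funext z
  rw [(h.identDistrib (e z)).map_eq, (h.identDistrib z).map_eq]

theorem identDistrib_lpp_translate (h : IsNonnegWeights P X) (u v z : ℤ × ℤ) :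
    IdentDistrib (fun ω => lpp (X ω) (u + z) (v + z)) (fun ω => lpp (X ω) u v) P P := by
  simp only [lpp_translate]
  exact (h.identDistrib_comp (add_left_injective z)).comp (measurable_lpp u v)

theorem identDistrib_lpp_swap (h : IsNonnegWeights P X) (u v : ℤ × ℤ) :
    IdentDistrib (fun ω => lpp (X ω) u.swap v.swap) (fun ω => lpp (X ω) u v) P P := by
  simp only [lpp_swap]
  exact (h.identDistrib_comp Prod.swap_injective).comp (measurable_lpp u v)

theorem measurable_lpp (h : IsNonnegWeights P X) (u v : ℤ × ℤ) :
    Measurable fun ω => lpp (X ω) u v := (_root_.measurable_lpp u v).comp h.measurable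

theorem integrable_exp_apply (h : IsNonnegWeights P X) {α : ℝ}
    (hα : Integrable (fun ω => Real.exp (α * X ω 0)) P) (z : ℤ × ℤ) :
    Integrable (fun ω => Real.exp (α * X ω z)) P :=
  ((h.identDistrib z).comp (u := fun x => Real.exp (α * x)) (by fun_prop)).integrable_iff.2 hα

/-- The sites of a path are distinct, because the level x + y increases by one at each step, so the
moment generating function factorises. -/
theorem exp_pathWeight (h : IsNonnegWeights P X) {α : ℝ}
    (hα : Integrable (fun ω => Real.exp (α * X ω 0)) P) {u v : ℤ × ℤ} {N : ℕ} {γ : ℕ → ℤ × ℤ}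
    (hγ : IsUpRightPath u v N γ) :
    Integrable (fun ω => Real.exp (α * pathWeight (X ω) N γ)) P ∧
    ∫ ω, Real.exp (α * pathWeight (X ω) N γ) ∂P = (∫ ω, Real.exp (α * X ω 0) ∂P) ^ N := by
  classical
  have hinj : Set.InjOn (fun i => γ (i + 1)) (Finset.range N) := by
    intro i hi j hj e
    have h1 := hγ.level (i := i + 1) (Finset.mem_range.1 hi)
    have h2 := hγ.level (i := j + 1) (Finset.mem_range.1 hj)
    simp only at e
    rw [e, h2] at h1
    push_cast at h1
    omega
  set S := (Finset.range N).image fun i => γ (i + 1) with hS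
  have hsum : ∀ ω, pathWeight (X ω) N γ = (∑ z ∈ S, fun ω => X ω z) ω := fun ω => by
    rw [hS, Finset.sum_image hinj, Finset.sum_apply]; rfl
  simp only [hsum]
  refine ⟨h.indep.integrable_exp_mul_sum h.measurable_apply fun z _ =>
    h.integrable_exp_apply hα z, ?_⟩
  have := h.indep.mgf_sum (t := α) h.measurable_apply S
  rw [mgf] at this
  rw [this, Finset.prod_congr rfl fun z _ =>
    mgf_congr_of_identDistrib (fun ω => X ω z) (fun ω => X ω 0) (h.identDistrib z) α,
    Finset.prod_const, hS, Finset.card_image_of_injOn hinj, Finset.card_range, mgf]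

/-- Chernoff's bound for each of the 2^N step patterns, then a union bound. The endpoint is free, so
a whole line of endpoints is covered at once. -/
theorem measureReal_exists_path_ge (h : IsNonnegWeights P X) {α : ℝ} (hα0 : 0 < α)
    (hα : Integrable (fun ω => Real.exp (α * X ω 0)) P) (u : ℤ × ℤ) (N : ℕ) (a : ℝ) :
    P.real {ω | ∃ v γ, IsUpRightPath u v N γ ∧ a ≤ pathWeight (X ω) N γ} ≤
      (2 * ∫ ω, Real.exp (α * X ω 0) ∂P) ^ N * Real.exp (-α * a) := by
  have hsub : {ω | ∃ v γ, IsUpRightPath u v N γ ∧ a ≤ pathWeight (X ω) N γ} ⊆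
      ⋃ S ∈ (Finset.range N).powerset, {ω | a ≤ pathWeight (X ω) N (stepPath u S)} := by
    rintro ω ⟨v, γ, hγ, hω⟩
    obtain ⟨S, hS, e⟩ := hγ.exists_stepPath
    rw [pathWeight_congr_path e] at hω
    exact Set.mem_biUnion hS hω
  refine (measureReal_mono hsub (measure_ne_top _ _)).trans ((measureReal_biUnion_finset_le _ _).trans ?_)
  have : ∀ S ∈ (Finset.range N).powerset, P.real {ω | a ≤ pathWeight (X ω) N (stepPath u S)} ≤
      (∫ ω, Real.exp (α * X ω 0) ∂P) ^ N * Real.exp (-α * a) := fun S _ => by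
    obtain ⟨h1, h2⟩ := h.exp_pathWeight hα (stepPath_isUpRightPath u S N)
    have := measure_ge_le_exp_mul_mgf a hα0.le h1
    rwa [mgf, h2, mul_comm] at this
  refine (Finset.sum_le_card_nsmul _ _ _ this).trans (le_of_eq ?_)
  rw [Finset.card_powerset, Finset.card_range, nsmul_eq_mul, mul_pow]
  push_cast
  ring

theorem one_le_expMoment (h : IsNonnegWeights P X) {α : ℝ} (hα0 : 0 < α)
    (hα : Integrable (fun ω => Real.exp (α * X ω 0)) P) :
    1 ≤ ∫ ω, Real.exp (α * X ω 0) ∂P := by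
  have : ∫ _, (1 : ℝ) ∂P ≤ ∫ ω, Real.exp (α * X ω 0) ∂P :=
    integral_mono (integrable_const _) hα fun ω =>
      Real.one_le_exp (mul_nonneg hα0.le (h.nonneg ω 0))
  simpa using this

/-- The exponential of a maximum is dominated by the sum over all 2^N step patterns. -/
theorem exp_lpp (h : IsNonnegWeights P X) {α : ℝ}
    (hα : Integrable (fun ω => Real.exp (α * X ω 0)) P) {u v : ℤ × ℤ} (huv : u ≤ v) {N : ℕ}
    (hN : (N : ℤ) = v.1 + v.2 - u.1 - u.2) :
    Integrable (fun ω => Real.exp (α * lpp (X ω) u v)) P ∧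
    ∫ ω, Real.exp (α * lpp (X ω) u v) ∂P ≤ (2 * ∫ ω, Real.exp (α * X ω 0) ∂P) ^ N := by
  have hi : Integrable (fun ω => ∑ S ∈ (Finset.range N).powerset,
      Real.exp (α * pathWeight (X ω) N (stepPath u S))) P :=
    integrable_finsetSum _ fun S _ => (h.exp_pathWeight hα (stepPath_isUpRightPath u S N)).1
  have hle : ∀ ω, Real.exp (α * lpp (X ω) u v) ≤ ∑ S ∈ (Finset.range N).powerset,
      Real.exp (α * pathWeight (X ω) N (stepPath u S)) := fun ω => by
    obtain ⟨N', γ, hγ, e⟩ := exists_path_lpp (X ω) huv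
    obtain rfl : N' = N := by have := hγ.length_eq; omega
    obtain ⟨S, hS, e'⟩ := hγ.exists_stepPath
    rw [← e, pathWeight_congr_path e']
    exact Finset.single_le_sum
      (f := fun S => Real.exp (α * pathWeight (X ω) N' (stepPath u S)))
      (fun _ _ => (Real.exp_pos _).le) hS
  have hint : Integrable (fun ω => Real.exp (α * lpp (X ω) u v)) P :=
    hi.mono' ((h.measurable_lpp u v).const_mul α).exp.aestronglyMeasurable
      (ae_of_all _ fun ω => by rw [Real.norm_of_nonneg (Real.exp_pos _).le]; exact hle ω)
  refine ⟨hint, (integral_mono hint hi hle).trans (le_of_eq ?_)⟩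
  rw [integral_finsetSum _ fun S _ => (h.exp_pathWeight hα (stepPath_isUpRightPath u S N)).1,
    Finset.sum_congr rfl fun S _ => (h.exp_pathWeight hα (stepPath_isUpRightPath u S N)).2,
    Finset.sum_const, Finset.card_powerset, Finset.card_range, nsmul_eq_mul, mul_pow]
  push_cast
  ring

theorem exists_integrable_exp_lpp (h : IsNonnegWeights P X) :
    ∃ α : ℝ, 0 < α ∧ ∀ u v : ℤ × ℤ, Integrable (fun ω => Real.exp (α * lpp (X ω) u v)) P := by
  obtain ⟨α, hα0, hα⟩ := h.expMoment
  refine ⟨α, hα0, fun u v => ?_⟩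
  by_cases huv : u ≤ v
  · obtain ⟨h1, h2⟩ := Prod.le_def.1 huv
    exact (h.exp_lpp hα huv (N := (v.1 + v.2 - u.1 - u.2).toNat) (by omega)).1
  · simp [lpp_of_not_le _ huv]

theorem integrable_lpp (h : IsNonnegWeights P X) (u v : ℤ × ℤ) :
    Integrable (fun ω => lpp (X ω) u v) P := by
  obtain ⟨α, hα0, hα⟩ := h.exists_integrable_exp_lpp
  refine ((hα u v).const_mul α⁻¹).mono' (h.measurable_lpp u v).aestronglyMeasurable
    (ae_of_all _ fun ω => ?_)
  rw [Real.norm_of_nonneg (lpp_nonneg (h.nonneg ω) u v), ← div_eq_inv_mul, le_div_iff₀ hα0]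
  linarith [Real.add_one_le_exp (α * lpp (X ω) u v)]

theorem integrable_sq_lpp (h : IsNonnegWeights P X) (u v : ℤ × ℤ) :
    Integrable (fun ω => lpp (X ω) u v ^ 2) P := by
  obtain ⟨α, hα0, hα⟩ := h.exists_integrable_exp_lpp
  refine ((hα u v).const_mul (2 / α ^ 2)).mono' ((h.measurable_lpp u v).pow_const 2).aestronglyMeasurable
    (ae_of_all _ fun ω => ?_)
  have h0 := lpp_nonneg (h.nonneg ω) u v
  rw [Real.norm_of_nonneg (by positivity), div_mul_eq_mul_div, le_div_iff₀ (by positivity)]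
  have := Real.quadratic_le_exp_of_nonneg (mul_nonneg hα0.le h0)
  nlinarith [mul_nonneg hα0.le h0]

/-- The mean last-passage value grows at most linearly. -/
theorem exists_integral_lpp_le (h : IsNonnegWeights P X) :
    ∃ C : ℝ, ∀ (n : ℕ) (v : ℤ × ℤ), 0 ≤ v → v.1 + v.2 ≤ n →
      ∫ ω, lpp (X ω) 0 v ∂P ≤ C * (n + 1) := by
  obtain ⟨α, hα0, hα⟩ := h.expMoment
  set m := ∫ ω, Real.exp (α * X ω 0) ∂P with hm
  have hm1 : 1 ≤ m := h.one_le_expMoment hα0 hα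
  have hlog : 0 ≤ Real.log (2 * m) := Real.log_nonneg (by linarith)
  refine ⟨(Real.log (2 * m) + 1) / α, fun n v hv hvn => ?_⟩
  obtain ⟨h1, h2⟩ := Prod.le_def.1 hv
  simp only [Prod.fst_zero, Prod.snd_zero] at h1 h2
  obtain ⟨N, hN⟩ := Int.eq_ofNat_of_zero_le (add_nonneg h1 h2)
  obtain ⟨hi, hle⟩ := h.exp_lpp hα hv (N := N) (by simp [hN])
  -- This is e^y ≥ 1 + y at y = αG − N log(2m), centred at the upper bound for log E e^{αG}; taking
  -- expectations does the work of Jensen's inequality.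
  have key : ∀ ω, α * lpp (X ω) 0 v ≤
      N * Real.log (2 * m) + Real.exp (α * lpp (X ω) 0 v) * ((2 * m) ^ N)⁻¹ := fun ω => by
    have := Real.add_one_le_exp (α * lpp (X ω) 0 v - N * Real.log (2 * m))
    rw [Real.exp_sub, Real.exp_nat_mul, Real.exp_log (by linarith), div_eq_mul_inv] at this
    linarith
  have h3 := integral_mono ((h.integrable_lpp 0 v).const_mul α)
    ((integrable_const _).add (hi.mul_const _)) key
  rw [integral_const_mul, integral_add' (integrable_const _) (hi.mul_const _),
    integral_const, integral_mul_const] at h3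
  have h4 : (∫ ω, Real.exp (α * lpp (X ω) 0 v) ∂P) * ((2 * m) ^ N)⁻¹ ≤ 1 := by
    rw [← div_eq_mul_inv, div_le_one (by positivity)]; exact hle
  have hNn : (N : ℝ) ≤ n := by exact_mod_cast (by omega : (N : ℤ) ≤ n)
  simp only [probReal_univ, smul_eq_mul, one_mul] at h3
  rw [div_mul_eq_mul_div, le_div_iff₀ hα0]
  nlinarith

end IsNonnegWeights

end Weights

/-! ### Subadditive sequences that start late -/

/-- **Fekete's lemma** for non-negative sequences that are subadditive from index `2` on. -/
theorem tendsto_div_of_subadditive_from_two {a : ℕ → ℝ} (h0 : ∀ n, 0 ≤ a n)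
    (hsub : ∀ m n, 2 ≤ m → 2 ≤ n → a (m + n) ≤ a m + a n) :
    ∃ L : ℝ, Tendsto (fun n : ℕ => a n / n) atTop (𝓝 L) ∧ ∀ n, 2 ≤ n → L ≤ a n / n := by
  set s : Set ℝ := (fun n : ℕ => a n / n) '' Set.Ici 2 with hs
  have hne : s.Nonempty := ⟨_, 2, Set.mem_Ici.2 le_rfl, rfl⟩
  have hbdd : BddBelow s := ⟨0, by rintro _ ⟨n, -, rfl⟩; have := h0 n; positivity⟩
  have hle : ∀ n, 2 ≤ n → sInf s ≤ a n / n := fun n hn => csInf_le hbdd ⟨n, hn, rfl⟩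
  refine ⟨sInf s, ?_, hle⟩
  refine tendsto_order.2 ⟨fun b hb => ?_, fun b hb => ?_⟩
  · filter_upwards [eventually_ge_atTop 2] with n hn using hb.trans_le (hle n hn)
  obtain ⟨_, ⟨m, hm, rfl⟩, hmb⟩ := exists_lt_of_csInf_lt hne hb
  have hm2 : 2 ≤ m := hm
  -- The remainder r is kept at least 2 so that subadditivity applies throughout; hence n − 2, not
  -- n, is divided by m below.
  have hmul : ∀ q r, 2 ≤ r → a (q * m + r) ≤ q * a m + a r := by
    intro q r hr
    induction q with
    | zero => simp
    | succ q ih =>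
      have := hsub m (q * m + r) hm2 (by omega)
      rw [show (q + 1) * m + r = m + (q * m + r) by ring]
      push_cast
      linarith
  obtain ⟨C, hC⟩ : ∃ C, ∀ r ∈ Finset.range (m + 2), a r ≤ C :=
    ⟨∑ r ∈ Finset.range (m + 2), a r, fun r hr => Finset.single_le_sum (fun i _ => h0 i) hr⟩
  have hbound : ∀ n, 2 ≤ n → a n / n ≤ a m / m + C / n := fun n hn => by
    have hn0 : (0 : ℝ) < n := by exact_mod_cast (by omega : 0 < n)
    have hm0 : (0 : ℝ) < m := by exact_mod_cast (by omega : 0 < m)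
    have hr : (n - 2) % m < m := Nat.mod_lt _ (by omega)
    have hdecomp : (n - 2) / m * m + ((n - 2) % m + 2) = n := by
      have := Nat.div_add_mod (n - 2) m
      rw [mul_comm] at this
      omega
    have h1 := hmul ((n - 2) / m) ((n - 2) % m + 2) (by omega)
    rw [hdecomp] at h1
    have h2 := hC ((n - 2) % m + 2) (Finset.mem_range.2 (by omega))
    have h3 : (((n - 2) / m : ℕ) : ℝ) * m ≤ n := by
      exact_mod_cast (by omega : (n - 2) / m * m ≤ n)
    have h4 : (((n - 2) / m : ℕ) : ℝ) * a m ≤ n * (a m / m) := by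
      rw [mul_div_assoc', le_div_iff₀ hm0]
      nlinarith [mul_le_mul_of_nonneg_right h3 (h0 m)]
    rw [div_le_iff₀ hn0, add_mul, div_mul_cancel₀ _ hn0.ne']
    linarith
  have hlim : Tendsto (fun n : ℕ => a m / m + C / n) atTop (𝓝 (a m / m + 0)) :=
    tendsto_const_nhds.add (tendsto_const_div_atTop_nhds_zero_nat C)
  rw [add_zero] at hlim
  filter_upwards [hlim.eventually (gt_mem_nhds hmb), eventually_ge_atTop 2] with n h1 h2
    using (hbound n h2).trans_lt h1

/-! ### Lattice points in a given direction -/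

theorem dirPoint_add_le (s : ℝ) (m n : ℕ) : dirPoint s m + dirPoint s n ≤ dirPoint s (m + n) := by
  constructor
  · refine (Int.le_floor_add _ _).trans (Int.floor_mono (le_of_eq ?_)); push_cast; ring
  · refine (Int.le_floor_add _ _).trans (Int.floor_mono (le_of_eq ?_)); push_cast; ring

theorem dirPoint_nonneg {s : ℝ} (hs : s ∈ Set.Icc (-(1 / 2) : ℝ) (1 / 2)) (n : ℕ) :
    0 ≤ dirPoint s n := by
  obtain ⟨h1, h2⟩ := hs
  have hn : (0 : ℝ) ≤ n := n.cast_nonneg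
  constructor <;> refine Int.floor_nonneg.2 ?_ <;> nlinarith

theorem dirPoint_mono {s : ℝ} (hs : s ∈ Set.Icc (-(1 / 2) : ℝ) (1 / 2)) : Monotone (dirPoint s) := by
  intro m n h
  obtain ⟨k, rfl⟩ := Nat.exists_eq_add_of_le h
  exact (le_add_of_nonneg_right (dirPoint_nonneg hs k)).trans (dirPoint_add_le s m k)

theorem dirPoint_zero (s : ℝ) : dirPoint s 0 = 0 := by simp [dirPoint]

theorem dirPoint_sum_le (s : ℝ) (n : ℕ) : (dirPoint s n).1 + (dirPoint s n).2 ≤ n := by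
  have := (Int.le_floor_add ((n : ℝ) / 2 + s * n) ((n : ℝ) / 2 - s * n)).trans
    (Int.floor_mono (le_of_eq (by ring : _ = (n : ℝ))))
  rwa [Int.floor_natCast] at this

/-- Rounding two coordinates down loses less than 2, hence at most 1 by integrality. -/
theorem le_dirPoint_sum (s : ℝ) (n : ℕ) : (n : ℤ) - 1 ≤ (dirPoint s n).1 + (dirPoint s n).2 := by
  have h1 := Int.lt_floor_add_one ((n : ℝ) / 2 + s * n)
  have h2 := Int.lt_floor_add_one ((n : ℝ) / 2 - s * n)
  have h3 : ((n : ℤ) : ℝ) < (((dirPoint s n).1 + (dirPoint s n).2 + 2 : ℤ) : ℝ) := by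
    simp only [dirPoint]
    push_cast
    linarith
  have := Int.cast_lt.1 h3
  omega

/-- For s = 0 and n = 1 the point is the origin, where the passage value is 0 and tail probabilities
can vanish. This is why subadditivity of the logarithms is only claimed from index 2 on. -/
theorem dirPoint_ne_zero (s : ℝ) {n : ℕ} (hn : 2 ≤ n) : dirPoint s n ≠ 0 := by
  intro h
  have := le_dirPoint_sum s n
  rw [h] at this
  simp at this
  omega

theorem dirPoint_neg (s : ℝ) (n : ℕ) : dirPoint (-s) n = (dirPoint s n).swap := by
  simp [dirPoint, sub_eq_add_neg]

theorem nsmul_dirPoint_le (s : ℝ) (k n : ℕ) : k • dirPoint s n ≤ dirPoint s (k * n) := by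
  induction k with
  | zero => simp [dirPoint_zero]
  | succ k ih =>
    rw [succ_nsmul, add_mul, one_mul]
    exact (add_le_add_left ih _).trans (dirPoint_add_le s _ _)

/-! ### Right tails and the existence of the rate function -/

namespace IsNonnegWeights

variable {Ω : Type*} [MeasurableSpace Ω] {P : Measure Ω} [IsProbabilityMeasure P]
  {X : Ω → ℤ × ℤ → ℝ}

theorem disjoint_lppSites_consecutive {u v x : ℤ × ℤ} (_huv : u ≤ v) (_hvx : v ≤ x) :
    Disjoint (lppSites u v) (lppSites v x) := by
  rw [Finset.disjoint_left]
  intro z hz hz'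
  obtain ⟨-, h1⟩ := Finset.mem_erase.1 hz
  obtain ⟨h2, h3⟩ := Finset.mem_erase.1 hz'
  exact h2 (le_antisymm (Finset.mem_Icc.1 h1).2 (Finset.mem_Icc.1 h3).1)

/-- The rectangles from 0 to u and from u to u + v, without their starting corners, share no site.
The two passage values are therefore independent, and concatenating paths shows that their sum is at
most the value to u + v. -/
theorem tail_mul_le (h : IsNonnegWeights P X) {u v : ℤ × ℤ} (hu : 0 ≤ u) (hv : 0 ≤ v) (a b : ℝ) :
    P.real {ω | a ≤ lpp (X ω) 0 u} * P.real {ω | b ≤ lpp (X ω) 0 v} ≤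
      P.real {ω | a + b ≤ lpp (X ω) 0 (u + v)} := by
  have huv : u ≤ u + v := le_add_of_nonneg_right hv
  have hind := h.indepFun_of_dependsOn (_root_.measurable_lpp 0 u) (_root_.measurable_lpp u (u + v))
    (dependsOn_lpp 0 u) (dependsOn_lpp u (u + v)) (disjoint_lppSites_consecutive hu huv)
  have h1 := hind.measure_inter_preimage_eq_mul _ _ (measurableSet_Ici (a := a))
    (measurableSet_Ici (a := b))
  have h2 := (h.identDistrib_lpp_translate 0 v u).measure_mem_eq (measurableSet_Ici (a := b))
  rw [zero_add, add_comm v u] at h2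
  rw [h2] at h1
  have h3 := congrArg ENNReal.toReal h1
  rw [ENNReal.toReal_mul] at h3
  refine le_trans (le_of_eq h3.symm) (measureReal_mono (fun ω hω => ?_) (measure_ne_top _ _))
  exact (add_le_add hω.1 hω.2).trans (lpp_add_le _ hu huv)

theorem tail_mono (h : IsNonnegWeights P X) {u v : ℤ × ℤ} (hu : 0 ≤ u) (huv : u ≤ v) {a b : ℝ}
    (hab : b ≤ a) :
    P.real {ω | a ≤ lpp (X ω) 0 u} ≤ P.real {ω | b ≤ lpp (X ω) 0 v} :=
  measureReal_mono (fun ω hω => hab.trans (le_trans hω (lpp_mono_right (h.nonneg ω) hu huv)))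
    (measure_ne_top _ _)

theorem tail_swap (h : IsNonnegWeights P X) (v : ℤ × ℤ) (a : ℝ) :
    P.real {ω | a ≤ lpp (X ω) 0 v.swap} = P.real {ω | a ≤ lpp (X ω) 0 v} :=
  congrArg ENNReal.toReal
    ((h.identDistrib_lpp_swap 0 v).measure_mem_eq (measurableSet_Ici (a := a)))

theorem tail_pow_le (h : IsNonnegWeights P X) {v : ℤ × ℤ} (hv : 0 ≤ v) (a : ℝ) (k : ℕ) :
    P.real {ω | a ≤ lpp (X ω) 0 v} ^ k ≤ P.real {ω | k * a ≤ lpp (X ω) 0 (k • v)} := by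
  induction k with
  | zero => simp [lpp_self]
  | succ k ih =>
    rw [pow_succ, succ_nsmul]
    refine (mul_le_mul_of_nonneg_right ih measureReal_nonneg).trans ?_
    refine (h.tail_mul_le (nsmul_nonneg hv k) hv _ _).trans (le_of_eq ?_)
    push_cast
    ring_nf

theorem measureReal_lt_apply_pos (h : IsNonnegWeights P X) (z : ℤ × ℤ) (a : ℝ) :
    0 < P.real {ω | a < X ω z} := by
  have := (h.identDistrib z).measure_mem_eq (measurableSet_Ioi (a := a))
  refine ENNReal.toReal_pos ?_ (measure_ne_top _ _)
  have h2 := h.unbounded a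
  change P ((fun ω => X ω z) ⁻¹' Set.Ioi a) ≠ 0
  rw [this]
  exact h2.ne'

/-- Every path to v ≠ 0 collects the weight at v, which alone exceeds any level with positive
probability. -/
theorem tail_pos (h : IsNonnegWeights P X) {v : ℤ × ℤ} (hv : 0 ≤ v) (hv0 : v ≠ 0) (a : ℝ) :
    0 < P.real {ω | a ≤ lpp (X ω) 0 v} := by
  refine (h.measureReal_lt_apply_pos v a).trans_le
    (measureReal_mono (fun ω hω => ?_) (measure_ne_top _ _))
  obtain ⟨N, γ, hγ⟩ := exists_isUpRightPath hv
  refine le_trans ?_ (hγ.weight_le_lpp _)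
  have hN : N ≠ 0 := by
    rintro rfl
    exact hv0 (hγ.finish.symm.trans hγ.start)
  obtain ⟨k, rfl⟩ := Nat.exists_eq_succ_of_ne_zero hN
  have h1 : X ω (γ (k + 1)) ≤ pathWeight (X ω) (k + 1) γ :=
    Finset.single_le_sum (f := fun i => X ω (γ (i + 1))) (fun i _ => h.nonneg ω _)
      (Finset.self_mem_range_succ k)
  rw [hγ.finish] at h1
  exact (le_of_lt hω).trans h1

/-- Existence of the right tail rate function, in its subadditive form. -/
theorem exists_rate (h : IsNonnegWeights P X) {s : ℝ} (hs : s ∈ Set.Icc (-(1 / 2) : ℝ) (1 / 2))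
    (r : ℝ) :
    ∃ j : ℝ, Tendsto (fun n : ℕ =>
        -Real.log (P.real {ω | r * n ≤ lpp (X ω) 0 (dirPoint s n)}) / n) atTop (𝓝 j) ∧
      ∀ n : ℕ, 2 ≤ n →
        j ≤ -Real.log (P.real {ω | r * n ≤ lpp (X ω) 0 (dirPoint s n)}) / n := by
  refine tendsto_div_of_subadditive_from_two
    (a := fun n : ℕ => -Real.log (P.real {ω | r * n ≤ lpp (X ω) 0 (dirPoint s n)}))
    (fun n => ?_) fun m n hm hn => ?_
  · exact neg_nonneg.2 (Real.log_nonpos measureReal_nonneg measureReal_le_one)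
  · have h1 := h.tail_mul_le (dirPoint_nonneg hs m) (dirPoint_nonneg hs n) (r * m) (r * n)
    have h2 := h.tail_mono (add_nonneg (dirPoint_nonneg hs m) (dirPoint_nonneg hs n))
      (dirPoint_add_le s m n) (a := r * m + r * n) (b := r * (m + n : ℕ))
      (by push_cast; linarith)
    have pm := h.tail_pos (dirPoint_nonneg hs m) (dirPoint_ne_zero s hm) (r * m)
    have pn := h.tail_pos (dirPoint_nonneg hs n) (dirPoint_ne_zero s hn) (r * n)
    have := Real.log_le_log (mul_pos pm pn) (h1.trans h2)
    rw [Real.log_mul pm.ne' pn.ne'] at this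
    linarith

end IsNonnegWeights

/-- The right tail rate function of the last-passage value in direction `s`. -/
noncomputable def rate {Ω : Type*} [MeasurableSpace Ω] (P : Measure Ω) (X : Ω → ℤ × ℤ → ℝ)
    (s r : ℝ) : ℝ :=
  limUnder atTop fun n : ℕ => -Real.log (P.real {ω | r * n ≤ lpp (X ω) 0 (dirPoint s n)}) / n

namespace IsNonnegWeights

variable {Ω : Type*} [MeasurableSpace Ω] {P : Measure Ω} [IsProbabilityMeasure P]
  {X : Ω → ℤ × ℤ → ℝ}

theorem tendsto_rate (h : IsNonnegWeights P X) {s : ℝ}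
    (hs : s ∈ Set.Icc (-(1 / 2) : ℝ) (1 / 2)) (r : ℝ) :
    Tendsto (fun n : ℕ =>
      -Real.log (P.real {ω | r * n ≤ lpp (X ω) 0 (dirPoint s n)}) / n) atTop (𝓝 (rate P X s r)) := by
  obtain ⟨j, hj, -⟩ := h.exists_rate hs r
  rw [rate, hj.limUnder_eq]
  exact hj

/-- Fekete's limit is a lower bound for all terms from index 2 on, so no error term is needed. -/
theorem tail_le_exp_rate (h : IsNonnegWeights P X) {s : ℝ}
    (hs : s ∈ Set.Icc (-(1 / 2) : ℝ) (1 / 2)) (r : ℝ) {n : ℕ} (hn : 2 ≤ n) :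
    P.real {ω | r * n ≤ lpp (X ω) 0 (dirPoint s n)} ≤ Real.exp (-n * rate P X s r) := by
  obtain ⟨j, hj, hle⟩ := h.exists_rate hs r
  rw [rate, hj.limUnder_eq]
  have hn0 : (0 : ℝ) < n := by exact_mod_cast (by omega : 0 < n)
  have := hle n hn
  rw [le_div_iff₀ hn0] at this
  rw [← Real.log_le_iff_le_exp (h.tail_pos (dirPoint_nonneg hs n) (dirPoint_ne_zero s hn) _)]
  linarith

/-- A stretch of size (k − 1)n with slope r followed by one of size n with slope R has slope ((k −
1)r + R)/k over size kn. This is convexity with weights 1 − 1/k and 1/k, enough for left continuity.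
-/
theorem rate_convex_step (h : IsNonnegWeights P X) {s : ℝ}
    (hs : s ∈ Set.Icc (-(1 / 2) : ℝ) (1 / 2)) (r R : ℝ) {k : ℕ} (hk : 2 ≤ k) :
    rate P X s (((k - 1) * r + R) / k) ≤ ((k - 1) * rate P X s r + rate P X s R) / k := by
  have hk0 : (0 : ℝ) < k := by exact_mod_cast (by omega : 0 < k)
  have hk1 : ((k - 1 : ℕ) : ℝ) = k - 1 := by rw [Nat.cast_sub (by omega)]; simp
  have hk1' : (0 : ℝ) < k - 1 := by rw [← hk1]; exact_mod_cast (by omega : 0 < k - 1)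
  have ha : Tendsto (fun n : ℕ => k * n) atTop atTop :=
    tendsto_id.const_mul_atTop' (by omega)
  have hb : Tendsto (fun n : ℕ => (k - 1) * n) atTop atTop :=
    tendsto_id.const_mul_atTop' (by omega)
  have h1 := (h.tendsto_rate hs (((k - 1) * r + R) / k)).comp ha
  have h2 := (h.tendsto_rate hs r).comp hb
  have h3 := h.tendsto_rate hs R
  refine le_of_tendsto_of_tendsto h1 (((h2.const_mul ((k : ℝ) - 1)).add h3).div_const k) ?_
  filter_upwards [eventually_ge_atTop 2] with n hn
  have hn0 : (0 : ℝ) < n := by exact_mod_cast (by omega : 0 < n)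
  simp only [Function.comp_apply]
  have e : (k - 1) * n + n = k * n := by
    obtain ⟨j, rfl⟩ := Nat.exists_eq_add_of_le hk
    rw [show 2 + j - 1 = 1 + j by omega]; ring
  have hn' : 2 ≤ (k - 1) * n := le_trans hn (Nat.le_mul_of_pos_left n (by omega))
  have g1 := h.tail_mul_le (dirPoint_nonneg hs ((k - 1) * n)) (dirPoint_nonneg hs n)
    (r * ((k - 1) * n : ℕ)) (R * n)
  have g2 := h.tail_mono (add_nonneg (dirPoint_nonneg hs ((k - 1) * n)) (dirPoint_nonneg hs n))
    (e ▸ dirPoint_add_le s ((k - 1) * n) n) (a := r * ((k - 1) * n : ℕ) + R * n)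
    (b := ((k - 1) * r + R) / k * (k * n : ℕ))
    (by push_cast; rw [hk1, div_mul_eq_mul_div, div_le_iff₀ hk0]; exact le_of_eq (by ring))
  have pm := h.tail_pos (dirPoint_nonneg hs _) (dirPoint_ne_zero s hn') (r * ((k - 1) * n : ℕ))
  have pn := h.tail_pos (dirPoint_nonneg hs n) (dirPoint_ne_zero s hn) (R * n)
  have := Real.log_le_log (mul_pos pm pn) (g1.trans g2)
  rw [Real.log_mul pm.ne' pn.ne'] at this
  set A := Real.log (P.real {ω | ((k - 1) * r + R) / k * (k * n : ℕ) ≤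
    lpp (X ω) 0 (dirPoint s (k * n))})
  set B := Real.log (P.real {ω | r * ((k - 1) * n : ℕ) ≤ lpp (X ω) 0 (dirPoint s ((k - 1) * n))})
  set C := Real.log (P.real {ω | R * n ≤ lpp (X ω) 0 (dirPoint s n)})
  have e2 : ((k - 1) * (-B / ((k - 1) * n : ℕ)) + -C / n) / k = (-B + -C) / (k * n : ℕ) := by
    push_cast
    rw [hk1]
    field_simp
  rw [e2]
  gcongr
  linarith

/-- Left continuity of the rate function. -/
theorem exists_rate_gt (h : IsNonnegWeights P X) {s : ℝ}
    (hs : s ∈ Set.Icc (-(1 / 2) : ℝ) (1 / 2)) {r : ℝ} (hr : 0 < r) {ε : ℝ} (hε : 0 < ε) :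
    ∃ r', 0 < r' ∧ r' < r ∧ rate P X s r - ε < rate P X s r' := by
  obtain ⟨k, hk⟩ := exists_nat_gt (max 2 (|rate P X s (2 * r)| / ε))
  have hk2 : (2 : ℝ) < k := (le_max_left _ _).trans_lt hk
  have hkε : |rate P X s (2 * r)| / ε < k := (le_max_right _ _).trans_lt hk
  have hk0 : (0 : ℝ) < k := by linarith
  -- Chosen so that r is the average of k − 1 copies of r' and one of 2r. The bound k > 2 keeps r'
  -- positive, and the contribution of the rate at 2r, divided by k, is below ε.
  set r' := r * ((k - 2) / (k - 1)) with hr'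
  have hlt : (k - 2 : ℝ) / (k - 1) < 1 := by rw [div_lt_one (by linarith)]; linarith
  refine ⟨r', mul_pos hr (div_pos (by linarith) (by linarith)), by nlinarith, ?_⟩
  have h1 := h.rate_convex_step hs r' (2 * r) (k := k) (by exact_mod_cast hk2.le)
  have e : ((k - 1) * r' + 2 * r) / k = r := by
    have : (k - 1 : ℝ) ≠ 0 := by linarith
    rw [hr']; field_simp; ring
  rw [e, le_div_iff₀ hk0] at h1
  have h0 : 0 ≤ rate P X s r' := by
    refine ge_of_tendsto (h.tendsto_rate hs r') (Eventually.of_forall fun n => ?_)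
    exact div_nonneg (neg_nonneg.2 (Real.log_nonpos measureReal_nonneg measureReal_le_one))
      n.cast_nonneg
  rw [div_lt_iff₀ hε] at hkε
  have := le_abs_self (rate P X s (2 * r))
  nlinarith

end IsNonnegWeights

/-! ### A right tail bound uniform over endpoints -/

namespace IsNonnegWeights

variable {Ω : Type*} [MeasurableSpace Ω] {P : Measure Ω} [IsProbabilityMeasure P]
  {X : Ω → ℤ × ℤ → ℝ}

theorem rate_nonneg (h : IsNonnegWeights P X) {s : ℝ} (hs : s ∈ Set.Icc (-(1 / 2) : ℝ) (1 / 2))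
    (r : ℝ) : 0 ≤ rate P X s r :=
  ge_of_tendsto (h.tendsto_rate hs r) (Eventually.of_forall fun n =>
    div_nonneg (neg_nonneg.2 (Real.log_nonpos measureReal_nonneg measureReal_le_one))
      n.cast_nonneg)

/-- Copies of `v` and of its mirror image can be combined to a point close to the line in
direction `t`. -/
theorem exists_combination_le_dirPoint {t : ℝ} (ht0 : 0 < t) (ht : t < 1 / 2) {n : ℕ}
    (hn : 1 ≤ t * n) {v : ℤ × ℤ} (hv0 : 0 ≤ v) (hvn : v.1 + v.2 = n)
    (hv : ⌊(n : ℝ) / 2 + t * n⌋ ≤ v.1) (m : ℕ) {M : ℕ}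
    (hM : n * m + (m + n) / (1 / 2 - t) ≤ (M : ℝ)) :
    ∃ k l : ℕ, k + l = m ∧ k • v + l • v.swap ≤ dirPoint t M := by
  obtain ⟨a, b⟩ := v
  simp only at hvn hv
  have hb : (0 : ℝ) ≤ b := by exact_mod_cast hv0.2
  have hab : (a : ℝ) + b = n := by exact_mod_cast hvn
  set τ : ℝ := (n : ℝ) / 2 + t * n with hτ
  have ha : τ - 1 < a := (Int.sub_one_lt_floor τ).trans_le (by exact_mod_cast hv)
  have hab' : (b : ℝ) ≤ a := by linarith
  have hbτ : (b : ℝ) ≤ τ := by linarith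
  have ht' : 0 < 1 / 2 - t := by linarith
  have hM' : n * m * (1 / 2 - t) + (m + n) ≤ M * (1 / 2 - t) := by
    have := mul_le_mul_of_nonneg_right hM ht'.le
    rwa [add_mul, div_mul_cancel₀ _ ht'.ne'] at this
  have hM1 : (n : ℝ) * m ≤ M := le_trans (le_add_of_nonneg_right (by positivity)) hM
  -- With k copies of v and m − k mirror images, the first coordinate is ka + (m − k)b and the
  -- second is mn minus that. So the first must not exceed mτ, while a deficit of at most m + n is
  -- paid for in the second coordinate by the surplus (m + n)/(1/2 − t) in M.
  suffices hk : ∃ k ≤ m, (k * a + (m - k) * b : ℝ) ≤ m * τ ∧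
      m * τ - m - n ≤ (k * a + (m - k) * b : ℝ) by
    obtain ⟨k, hkm, h1, h2⟩ := hk
    refine ⟨k, m - k, by omega, ?_⟩
    have e : ((m - k : ℕ) : ℝ) = m - k := by rw [Nat.cast_sub hkm]
    constructor
    · refine Int.le_floor.2 ?_
      simp only [Prod.swap_prod_mk, Prod.smul_mk, Prod.mk_add_mk]
      simp only [nsmul_eq_mul]
      push_cast
      rw [e]
      refine h1.trans ?_
      rw [hτ]
      nlinarith
    · refine Int.le_floor.2 ?_
      simp only [Prod.swap_prod_mk, Prod.smul_mk, Prod.mk_add_mk]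
      simp only [nsmul_eq_mul]
      push_cast
      rw [e]
      have : (b : ℝ) = n - a := by linarith
      rw [this] at h2 ⊢
      nlinarith
  classical
  -- By maximality, exchanging one more mirror image for v, a change of a − b ≤ n, overshoots mτ. If
  -- k = m already, the deficit is m(τ − a) ≤ m.
  set k := Nat.findGreatest (fun k => (k * a + (m - k) * b : ℝ) ≤ m * τ) m with hk
  have hm0 : (0 : ℝ) ≤ m := m.cast_nonneg
  have hP0 : ((0 : ℕ) * a + (m - (0 : ℕ)) * b : ℝ) ≤ m * τ := by
    simp only [Nat.cast_zero, zero_mul, sub_zero, zero_add]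
    exact mul_le_mul_of_nonneg_left hbτ hm0
  have hPk := Nat.findGreatest_spec (P := fun k : ℕ => (k * a + (m - k) * b : ℝ) ≤ m * τ)
    (Nat.zero_le m) hP0
  refine ⟨k, Nat.findGreatest_le m, hPk, ?_⟩
  rcases eq_or_lt_of_le (Nat.findGreatest_le (P := fun k : ℕ => (k * a + (m - k) * b : ℝ) ≤ m * τ) m)
    with hkm | hkm
  · rw [← hk] at hkm
    rw [hkm]
    nlinarith [n.cast_nonneg (α := ℝ)]
  · have := Nat.findGreatest_is_greatest (P := fun k : ℕ => (k * a + (m - k) * b : ℝ) ≤ m * τ)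
      (Nat.lt_succ_self _) hkm
    rw [← hk] at this
    push_cast at this
    nlinarith

/-- A non-asymptotic upper tail bound, uniform over the endpoints to the right of direction `t`. -/
theorem exists_tail_le_exp_rate (h : IsNonnegWeights P X) {t : ℝ} (ht0 : 0 < t) (ht : t ≤ 1 / 2)
    {r r' : ℝ} (hr' : 0 < r') (hr : r' < r) :
    ∃ n₀ : ℕ, ∀ n : ℕ, n₀ ≤ n → ∀ v : ℤ × ℤ, 0 ≤ v → v.1 + v.2 = n →
      ⌊(n : ℝ) / 2 + t * n⌋ ≤ v.1 →
        P.real {ω | r * n ≤ lpp (X ω) 0 v} ≤ Real.exp (-n * rate P X t r') := by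
  have hts : t ∈ Set.Icc (-(1 / 2) : ℝ) (1 / 2) := ⟨by linarith, ht⟩
  rcases ht.eq_or_lt with ht2 | ht2
  -- For t = 1/2 the only admissible v is (n, 0), which is `dirPoint t n` itself.
  · refine ⟨2, fun n hn v hv0 hvn hv => ?_⟩
    have hv' : v ≤ dirPoint t n := by
      have e1 : (n : ℝ) / 2 + t * n = (n : ℤ) := by rw [ht2]; push_cast; ring
      have e2 : (n : ℝ) / 2 - t * n = (0 : ℤ) := by rw [ht2]; push_cast; ring
      have h1 : (dirPoint t n).1 = n := by rw [dirPoint, e1, Int.floor_intCast]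
      have h2 : (dirPoint t n).2 = 0 := by rw [dirPoint, e2, Int.floor_intCast]
      rw [e1, Int.floor_intCast] at hv
      have h3 : 0 ≤ v.2 := hv0.2
      constructor
      · rw [h1]; omega
      · rw [h2]; omega
    refine (h.tail_mono hv0 hv' ?_).trans (h.tail_le_exp_rate hts r' hn)
    exact mul_le_mul_of_nonneg_right hr.le n.cast_nonneg
  · have ht' : 0 < 1 / 2 - t := by linarith
    set c : ℝ := 1 / (1 / 2 - t) with hc
    have hc2 : 2 ≤ c := by rw [hc, le_div_iff₀ ht']; linarith
    obtain ⟨n₁, hn₁⟩ := exists_nat_gt (max (1 / t) (2 * c * r' / (r - r')))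
    refine ⟨n₁ + 2, fun n hn v hv0 hvn hv => ?_⟩
    have hnR : (n₁ : ℝ) ≤ n := by exact_mod_cast (by omega : n₁ ≤ n)
    have hn1 : 1 ≤ t * n := by
      have := (le_max_left _ _).trans (hn₁.le.trans hnR)
      rw [div_le_iff₀ ht0] at this
      linarith
    have hn2 : r' * (n + 2 * c) ≤ r * n := by
      have := (le_max_right _ _).trans (hn₁.le.trans hnR)
      rw [div_le_iff₀ (by linarith)] at this
      nlinarith
    have hn0 : (2 : ℝ) ≤ n := by exact_mod_cast (by omega : 2 ≤ n)
    -- With this number of copies m + n + 1 ≤ 2m, hence M ≤ (n + 2c)m, and the gap between r' and r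
    -- absorbs the overhead 2c for large n.
    set m : ℕ := n + 2 with hm
    have hmR : (m : ℝ) = n + 2 := by rw [hm]; push_cast; ring
    set M : ℕ := n * m + ⌈c * (m + n)⌉₊ with hM
    have hMle : (M : ℝ) ≤ n * m + c * (m + n + 1) := by
      have := Nat.ceil_lt_add_one (show 0 ≤ c * (m + n) by positivity)
      rw [hM]; push_cast; linarith
    have hMge : n * m + (m + n) / (1 / 2 - t) ≤ (M : ℝ) := by
      have := Nat.le_ceil (c * (m + n))
      rw [hM]; push_cast
      rw [hc, one_div_mul_eq_div] at this
      rw [hc, one_div_mul_eq_div]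
      linarith
    obtain ⟨k, l, hkl, hle⟩ := exists_combination_le_dirPoint ht0 ht2 hn1 hv0 hvn hv m hMge
    have hs0 : 0 ≤ v.swap := ⟨hv0.2, hv0.1⟩
    set p := P.real {ω | r * n ≤ lpp (X ω) 0 v} with hp
    have hvne : v ≠ 0 := by
      rintro rfl
      simp at hvn
      omega
    have hp0 : 0 < p := h.tail_pos hv0 hvne _
    have g1 := h.tail_pow_le hv0 (r * n) k
    have g2 := h.tail_pow_le hs0 (r * n) l
    rw [h.tail_swap] at g2
    have g3 := (mul_le_mul g1 g2 (by positivity) measureReal_nonneg).trans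
      (h.tail_mul_le (nsmul_nonneg hv0 k) (nsmul_nonneg hs0 l) _ _)
    rw [← pow_add, hkl] at g3
    have g4 := g3.trans ((h.tail_mono (add_nonneg (nsmul_nonneg hv0 k) (nsmul_nonneg hs0 l)) hle
      (b := r' * M) ?_).trans (h.tail_le_exp_rate hts r' (n := M) (by rw [hM, hm]; nlinarith)))
    · have hj := h.rate_nonneg hts r'
      have hm0 : (0 : ℝ) < m := by rw [hmR]; linarith
      -- As M ≥ nm and the rate is non-negative, an m-th root brings the bound at scale M back to
      -- scale n.
      have hpow : p ^ m ≤ Real.exp (-n * rate P X t r') ^ m := by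
        rw [← Real.exp_nat_mul]
        refine g4.trans (Real.exp_le_exp.2 ?_)
        have : (n : ℝ) * m ≤ M := le_trans (le_add_of_nonneg_right (by positivity)) hMge
        nlinarith
      exact le_of_pow_le_pow_left₀ (by omega) (Real.exp_pos _).le hpow
    · have hklR : (k : ℝ) + l = m := by exact_mod_cast hkl
      calc r' * M ≤ r' * ((n + 2 * c) * m) := by
            refine mul_le_mul_of_nonneg_left (hMle.trans ?_) hr'.le
            rw [hmR]
            nlinarith
        _ = r' * (n + 2 * c) * m := by ring
        _ ≤ r * n * m := mul_le_mul_of_nonneg_right hn2 m.cast_nonneg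
        _ = k * (r * n) + l * (r * n) := by rw [← hklR]; ring

end IsNonnegWeights

/-- The shape function: the limit of the normalised mean last-passage value in direction `s`. -/
noncomputable def shape {Ω : Type*} [MeasurableSpace Ω] (P : Measure Ω) (X : Ω → ℤ × ℤ → ℝ)
    (s : ℝ) : ℝ :=
  limUnder atTop fun n : ℕ => (∫ ω, lpp (X ω) 0 (dirPoint s n) ∂P) / n

/-- The last-passage value dominates the sum of the values along consecutive blocks. -/
theorem sum_lpp_le {W : ℤ × ℤ → ℝ} (p : ℕ → ℤ × ℤ) (hp : Monotone p) (q : ℕ) :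
    ∑ i ∈ Finset.range q, lpp W (p i) (p (i + 1)) ≤ lpp W (p 0) (p q) := by
  induction q with
  | zero => simp [lpp_self]
  | succ q ih =>
    rw [Finset.sum_range_succ]
    exact (add_le_add_left ih _).trans (lpp_add_le W (hp (Nat.zero_le q)) (hp q.le_succ))

/-- Used with x = θY to control the Laplace transform of a block by its first two moments. -/
theorem exp_neg_le_quadratic {x : ℝ} (hx : 0 ≤ x) : Real.exp (-x) ≤ 1 - x + x ^ 2 := by
  have h1 := Real.quadratic_le_exp_of_nonneg hx
  rw [Real.exp_neg, inv_le_comm₀ (Real.exp_pos _) (by nlinarith [sq_nonneg (x - 1)])]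
  refine le_trans ?_ h1
  rw [inv_le_iff_one_le_mul₀ (by nlinarith [sq_nonneg (x - 1)])]
  nlinarith [pow_nonneg hx 3, pow_nonneg hx 4, sq_nonneg x]

/-! ### Mean passage values and the almost sure lower bound -/

namespace IsNonnegWeights

variable {Ω : Type*} [MeasurableSpace Ω] {P : Measure Ω} [IsProbabilityMeasure P]
  {X : Ω → ℤ × ℤ → ℝ}

theorem integral_lpp_add_le (h : IsNonnegWeights P X) {u v x : ℤ × ℤ} (hu : 0 ≤ u) (hv : 0 ≤ v)
    (hx : u + v ≤ x) :
    ∫ ω, lpp (X ω) 0 u ∂P + ∫ ω, lpp (X ω) 0 v ∂P ≤ ∫ ω, lpp (X ω) 0 x ∂P := by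
  have e := (h.identDistrib_lpp_translate 0 v u).integral_eq
  rw [zero_add, add_comm v u] at e
  rw [← e, ← integral_add (h.integrable_lpp _ _) (h.integrable_lpp _ _)]
  refine integral_mono ((h.integrable_lpp _ _).add (h.integrable_lpp _ _)) (h.integrable_lpp _ _)
    fun ω => ?_
  have huv : u ≤ u + v := le_add_of_nonneg_right hv
  exact (lpp_add_le (X ω) hu huv).trans (lpp_mono_right (h.nonneg ω) (hu.trans huv) hx)

/-- The means are superadditive along direction s, so their limit is a supremum and bounds the mean
at every n from above. -/
theorem tendsto_shape_aux (h : IsNonnegWeights P X) {s : ℝ}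
    (hs : s ∈ Set.Icc (-(1 / 2) : ℝ) (1 / 2)) :
    Tendsto (fun n : ℕ => (∫ ω, lpp (X ω) 0 (dirPoint s n) ∂P) / n) atTop (𝓝 (shape P X s)) ∧
      ∀ n : ℕ, ∫ ω, lpp (X ω) 0 (dirPoint s n) ∂P ≤ shape P X s * n := by
  set g : ℕ → ℝ := fun n => ∫ ω, lpp (X ω) 0 (dirPoint s n) ∂P with hg
  have hsub : Subadditive fun n => -g n := fun m n => by
    have := h.integral_lpp_add_le (dirPoint_nonneg hs m) (dirPoint_nonneg hs n)
      (dirPoint_add_le s m n)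
    simp only [hg]
    linarith
  obtain ⟨C, hC⟩ := h.exists_integral_lpp_le
  have hbdd : BddBelow (Set.range fun n : ℕ => -g n / n) := by
    refine ⟨-(2 * |C|), ?_⟩
    rintro _ ⟨n, rfl⟩
    rcases Nat.eq_zero_or_pos n with rfl | hn
    · simp
    have hn1 : (1 : ℝ) ≤ n := by exact_mod_cast hn
    have h1 := hC n (dirPoint s n) (dirPoint_nonneg hs n) (dirPoint_sum_le s n)
    change g n ≤ _ at h1
    simp only
    rw [le_div_iff₀ (by linarith)]
    nlinarith [le_abs_self C, abs_nonneg C]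
  have hlim := (hsub.tendsto_lim hbdd).neg
  have hlim' : Tendsto (fun n : ℕ => g n / n) atTop (𝓝 (-hsub.lim)) :=
    hlim.congr fun n => by ring
  have e : shape P X s = -hsub.lim := hlim'.limUnder_eq
  rw [e]
  refine ⟨hlim', fun n => ?_⟩
  rcases Nat.eq_zero_or_pos n with rfl | hn
  · simp [dirPoint_zero, lpp_self]
  have h1 := hsub.lim_le_div hbdd hn.ne'
  have hn0 : (0 : ℝ) < n := by exact_mod_cast hn
  rw [le_div_iff₀ hn0] at h1
  change g n ≤ _
  linarith

theorem shape_nonneg (h : IsNonnegWeights P X) {s : ℝ}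
    (hs : s ∈ Set.Icc (-(1 / 2) : ℝ) (1 / 2)) : 0 ≤ shape P X s :=
  ge_of_tendsto (h.tendsto_shape_aux hs).1 (Eventually.of_forall fun n =>
    div_nonneg (integral_nonneg fun ω => lpp_nonneg (h.nonneg ω) _ _) n.cast_nonneg)

/-- By the swap symmetry, directions s and −s have equal means, and a stretch in one followed by a
stretch in the other ends below the diagonal point of size 2n. -/
theorem shape_le_shape_zero (h : IsNonnegWeights P X) {s : ℝ}
    (hs : s ∈ Set.Icc (-(1 / 2) : ℝ) (1 / 2)) : shape P X s ≤ shape P X 0 := by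
  have h0 : (0 : ℝ) ∈ Set.Icc (-(1 / 2) : ℝ) (1 / 2) := by constructor <;> norm_num
  refine le_of_tendsto (h.tendsto_shape_aux hs).1 ?_
  filter_upwards [eventually_gt_atTop 0] with n hn
  have hn0 : (0 : ℝ) < n := by exact_mod_cast hn
  have hle : dirPoint s n + dirPoint (-s) n ≤ dirPoint 0 (2 * n) := by
    constructor
    · refine (Int.le_floor_add _ _).trans (Int.floor_mono (le_of_eq ?_)); push_cast; ring
    · refine (Int.le_floor_add _ _).trans (Int.floor_mono (le_of_eq ?_)); push_cast; ring
  have hs' : -s ∈ Set.Icc (-(1 / 2) : ℝ) (1 / 2) := ⟨by linarith [hs.2], by linarith [hs.1]⟩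
  have h1 := h.integral_lpp_add_le (dirPoint_nonneg hs n) (dirPoint_nonneg hs' n) hle
  have h2 := (h.tendsto_shape_aux h0).2 (2 * n)
  have e := (h.identDistrib_lpp_swap 0 (dirPoint s n)).integral_eq
  rw [← dirPoint_neg, Prod.swap_zero] at e
  rw [e] at h1
  push_cast at h2
  rw [div_le_iff₀ hn0]
  linarith

/-- Lower tail bound for sums of last-passage values over disjoint translates of a rectangle. -/
theorem exists_block_lower_tail (h : IsNonnegWeights P X) (d : ℤ × ℤ) {m : ℝ}
    (hm : m < ∫ ω, lpp (X ω) 0 d ∂P) :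
    ∃ c : ℝ, 0 < c ∧ ∀ (ι : Type) (I : Finset ι) (b : ι → ℤ × ℤ),
      (Pairwise fun i j => Disjoint (lppSites (b i) (b i + d)) (lppSites (b j) (b j + d))) →
      P.real {ω | ∑ i ∈ I, lpp (X ω) (b i) (b i + d) ≤ I.card * m} ≤ Real.exp (-c * I.card) := by
  set Y : Ω → ℝ := fun ω => lpp (X ω) 0 d with hY
  set E := ∫ ω, Y ω ∂P with hE
  set E2 := ∫ ω, Y ω ^ 2 ∂P with hE2
  have hE2' : 0 ≤ E2 := integral_nonneg fun ω => sq_nonneg _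
  -- Small enough that θ(E − m), the linear gain in the exponent, beats the quadratic error θ²E2;
  -- the + 1 excludes a zero denominator.
  set θ := (E - m) / (2 * (E2 + 1)) with hθ
  have hθ0 : 0 < θ := div_pos (by linarith) (by linarith)
  have hY0 : ∀ ω, 0 ≤ Y ω := fun ω => lpp_nonneg (h.nonneg ω) _ _
  have hint : ∀ u v, Integrable (fun ω => Real.exp (-θ * lpp (X ω) u v)) P := fun u v =>
    (integrable_const (1 : ℝ)).mono' ((h.measurable_lpp u v).const_mul _).exp.aestronglyMeasurable
      (ae_of_all _ fun ω => by
        rw [Real.norm_of_nonneg (Real.exp_pos _).le]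
        exact Real.exp_le_one_iff.2 (by nlinarith [lpp_nonneg (h.nonneg ω) u v]))
  have hmgf : mgf Y P (-θ) ≤ Real.exp (-θ * E + θ ^ 2 * E2) := by
    have i1 : Integrable (fun ω => 1 - θ * Y ω) P :=
      (integrable_const _).sub ((h.integrable_lpp 0 d).const_mul θ)
    have i2 : Integrable (fun ω => θ ^ 2 * Y ω ^ 2) P := (h.integrable_sq_lpp 0 d).const_mul _
    have hi : Integrable (fun ω => 1 - θ * Y ω + θ ^ 2 * Y ω ^ 2) P := i1.add i2
    have h1 : mgf Y P (-θ) ≤ ∫ ω, (1 - θ * Y ω + θ ^ 2 * Y ω ^ 2) ∂P := by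
      refine integral_mono (hint 0 d) hi fun ω => ?_
      have := exp_neg_le_quadratic (mul_nonneg hθ0.le (hY0 ω))
      simp only [neg_mul]
      linarith [mul_pow θ (Y ω) 2]
    rw [integral_add i1 i2,
      integral_sub (integrable_const _) ((h.integrable_lpp 0 d).const_mul θ),
      integral_const_mul, integral_const_mul, integral_const] at h1
    simp only [probReal_univ, one_smul] at h1
    refine h1.trans (le_trans (le_of_eq ?_) (Real.add_one_le_exp _))
    simp only [← hE2]
    ring
  refine ⟨θ * (E - m) - θ ^ 2 * E2, ?_, fun ι I b hb => ?_⟩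
  · have : θ * E2 ≤ (E - m) / 2 := by
      rw [hθ, div_mul_eq_mul_div, div_le_div_iff₀ (by linarith) two_pos]
      nlinarith
    nlinarith
  · have hind := h.iIndepFun_of_dependsOn (F := fun i W => lpp W (b i) (b i + d))
      (fun i => _root_.measurable_lpp _ _) (fun i => dependsOn_lpp _ _) hb
    have hmeas : ∀ i, Measurable fun ω => lpp (X ω) (b i) (b i + d) :=
      fun i => h.measurable_lpp _ _
    have h1 := measure_le_le_exp_mul_mgf (μ := P) (t := -θ) (I.card * m) (by linarith)
      (hind.integrable_exp_mul_sum hmeas (s := I) fun i _ => hint _ _)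
    have h2 := hind.mgf_sum (t := -θ) hmeas I
    have h3 : ∀ i ∈ I, mgf (fun ω => lpp (X ω) (b i) (b i + d)) P (-θ) = mgf Y P (-θ) := by
      intro i _
      refine mgf_congr_of_identDistrib _ _ ?_ _
      have := h.identDistrib_lpp_translate 0 d (b i)
      rwa [zero_add, add_comm d] at this
    rw [h2, Finset.prod_congr rfl h3, Finset.prod_const] at h1
    have h4 : mgf Y P (-θ) ^ I.card ≤ Real.exp (-θ * E + θ ^ 2 * E2) ^ I.card :=
      pow_le_pow_left₀ mgf_nonneg hmgf _
    simp only [Finset.sum_apply] at h1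
    refine h1.trans ((mul_le_mul_of_nonneg_left h4 (Real.exp_pos _).le).trans (le_of_eq ?_))
    rw [← Real.exp_nat_mul, ← Real.exp_add]
    congr 1
    ring

theorem pairwise_disjoint_lppSites_nsmul {d : ℤ × ℤ} (hd : 0 ≤ d) :
    Pairwise fun i j : ℕ => Disjoint (lppSites (i • d) (i • d + d)) (lppSites (j • d) (j • d + d)) := by
  have key : ∀ i j : ℕ, i < j →
      Disjoint (lppSites (i • d) (i • d + d)) (lppSites (j • d) (j • d + d)) := by
    intro i j hij
    rw [Finset.disjoint_left]
    intro z hz hz'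
    obtain ⟨-, h1⟩ := Finset.mem_erase.1 hz
    obtain ⟨h2, h3⟩ := Finset.mem_erase.1 hz'
    refine h2 (le_antisymm ((Finset.mem_Icc.1 h1).2.trans ?_) (Finset.mem_Icc.1 h3).1)
    rw [← succ_nsmul]
    exact nsmul_le_nsmul_left hd hij
  intro i j hij
  rcases lt_or_gt_of_ne hij with h | h
  · exact key i j h
  · exact (key j i h).symm

/-- Almost surely, the last-passage value eventually exceeds any linear function of slope below the
shape value. -/
theorem ae_eventually_le_lpp (h : IsNonnegWeights P X) {s : ℝ}
    (hs : s ∈ Set.Icc (-(1 / 2) : ℝ) (1 / 2)) {m : ℝ} (hm : m < shape P X s) :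
    ∀ᵐ ω ∂P, ∀ᶠ n : ℕ in atTop, m * n ≤ lpp (X ω) 0 (dirPoint s n) := by
  rcases lt_or_ge m 0 with hm0 | hm0
  · refine ae_of_all _ fun ω => Eventually.of_forall fun n => ?_
    exact le_trans (mul_nonpos_of_nonpos_of_nonneg hm0.le n.cast_nonneg)
      (lpp_nonneg (h.nonneg ω) _ _)
  obtain ⟨m', hmm', hm's⟩ := exists_between hm
  obtain ⟨N, hN0, hN⟩ := ((eventually_gt_atTop 0).and
    ((h.tendsto_shape_aux hs).1.eventually (lt_mem_nhds hm's))).exists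
  have hN0' : (0 : ℝ) < N := by exact_mod_cast hN0
  rw [lt_div_iff₀ hN0'] at hN
  set d := dirPoint s N with hd
  have hd0 : 0 ≤ d := dirPoint_nonneg hs N
  obtain ⟨c, hc, hb⟩ := h.exists_block_lower_tail d hN
  have hB : ∀ q : ℕ, P {ω | ∑ i ∈ Finset.range q, lpp (X ω) (i • d) (i • d + d) ≤ q * (m' * N)} ≤
      ENNReal.ofReal (Real.exp (-c) ^ q) := fun q => by
    have := hb ℕ (Finset.range q) (fun i => i • d) (pairwise_disjoint_lppSites_nsmul hd0)
    rw [Finset.card_range] at this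
    rw [← ENNReal.ofReal_toReal (measure_ne_top P _)]
    refine ENNReal.ofReal_le_ofReal (this.trans (le_of_eq ?_))
    rw [← Real.exp_nat_mul]; congr 1; ring
  have hsum : ∑' q : ℕ, P {ω | ∑ i ∈ Finset.range q, lpp (X ω) (i • d) (i • d + d) ≤
      q * (m' * N)} ≠ ⊤ := by
    refine ne_top_of_le_ne_top ?_ (ENNReal.tsum_le_tsum hB)
    refine Summable.tsum_ofReal_ne_top ?_
    exact summable_geometric_of_lt_one (Real.exp_pos _).le (Real.exp_lt_one_iff.2 (by linarith))
  filter_upwards [ae_eventually_notMem hsum] with ω hω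
  have hdiv : Tendsto (fun n : ℕ => n / N) atTop atTop :=
    Nat.tendsto_div_const_atTop hN0.ne'
  -- From n₁ on, the slack (m' − m)n covers m'N, the loss caused by the incomplete last block.
  obtain ⟨n₁, hn₁⟩ := exists_nat_ge (m' * N / (m' - m))
  filter_upwards [hdiv.eventually hω, eventually_ge_atTop n₁] with n hn hnn
  have hnR : (n₁ : ℝ) ≤ n := by exact_mod_cast hnn
  have h1 : (n / N : ℕ) * (m' * N) < ∑ i ∈ Finset.range (n / N), lpp (X ω) (i • d) (i • d + d) :=
    not_le.1 hn
  have h2 := sum_lpp_le (W := X ω) (fun i => i • d) (fun i j hij => nsmul_le_nsmul_left hd0 hij)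
    (n / N)
  simp only [succ_nsmul, zero_nsmul] at h2
  have h3 : lpp (X ω) 0 ((n / N) • d) ≤ lpp (X ω) 0 (dirPoint s n) :=
    lpp_mono_right (h.nonneg ω) (nsmul_nonneg hd0 _)
      ((nsmul_dirPoint_le s (n / N) N).trans (dirPoint_mono hs (Nat.div_mul_le_self n N)))
  have h4 : (n : ℝ) - N ≤ (n / N : ℕ) * N := by
    have := Nat.div_add_mod n N
    have h5 : n ≤ n / N * N + N := by
      have := Nat.mod_lt n hN0
      nlinarith
    have : (n : ℝ) ≤ (n / N : ℕ) * N + N := by exact_mod_cast h5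
    linarith
  have h6 := hn₁.trans hnR
  rw [div_le_iff₀ (by linarith)] at h6
  have h7 : m' * (n - N) ≤ m' * ((n / N : ℕ) * N) :=
    mul_le_mul_of_nonneg_left h4 (hm0.trans hmm'.le)
  nlinarith

end IsNonnegWeights

/-! ### Changing finitely many weights -/

open Classical in
/-- Replace the weights on `S` by `0`. -/
noncomputable def zeroOn (S : Set (ℤ × ℤ)) (W : ℤ × ℤ → ℝ) (z : ℤ × ℤ) : ℝ :=
  if z ∈ S then 0 else W z

theorem zeroOn_le {W : ℤ × ℤ → ℝ} (hW : ∀ z, 0 ≤ W z) (S : Set (ℤ × ℤ)) (z : ℤ × ℤ) :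
    zeroOn S W z ≤ W z := by
  unfold zeroOn; split_ifs
  · exact hW z
  · exact le_rfl

theorem zeroOn_nonneg {W : ℤ × ℤ → ℝ} (hW : ∀ z, 0 ≤ W z) (S : Set (ℤ × ℤ)) (z : ℤ × ℤ) :
    0 ≤ zeroOn S W z := by
  unfold zeroOn; split_ifs
  · exact le_rfl
  · exact hW z

theorem IsUpRightPath.injOn_succ {u v : ℤ × ℤ} {N : ℕ} {γ : ℕ → ℤ × ℤ}
    (hγ : IsUpRightPath u v N γ) : Set.InjOn (fun i => γ (i + 1)) (Finset.range N) := by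
  intro i hi j hj e
  have h1 := hγ.level (i := i + 1) (Finset.mem_range.1 hi)
  have h2 := hγ.level (i := j + 1) (Finset.mem_range.1 hj)
  simp only at e
  rw [e, h2] at h1
  push_cast at h1
  omega

/-- A path visits each site of S at most once, so zeroing S costs it at most the total weight of S.
-/
theorem lpp_le_zeroOn_add {W : ℤ × ℤ → ℝ} (hW : ∀ z, 0 ≤ W z) (S : Finset (ℤ × ℤ))
    {u v : ℤ × ℤ} (huv : u ≤ v) : lpp W u v ≤ lpp (zeroOn S W) u v + ∑ z ∈ S, W z := by
  classical
  refine (lpp_le_iff W huv _).2 fun N γ hγ => ?_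
  have h1 := hγ.weight_le_lpp (zeroOn S W)
  have h2 : pathWeight W N γ = pathWeight (zeroOn S W) N γ +
      ∑ i ∈ Finset.range N, if γ (i + 1) ∈ S then W (γ (i + 1)) else 0 := by
    rw [pathWeight, pathWeight, ← Finset.sum_add_distrib]
    refine Finset.sum_congr rfl fun i _ => ?_
    unfold zeroOn
    by_cases h : γ (i + 1) ∈ S <;> simp [h]
  have h3 : ∑ i ∈ Finset.range N, (if γ (i + 1) ∈ S then W (γ (i + 1)) else 0) ≤ ∑ z ∈ S, W z := by
    rw [← Finset.sum_filter, ← Finset.sum_image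
      (f := W) (g := fun i => γ (i + 1)) (fun i hi j hj => hγ.injOn_succ
        (Finset.mem_coe.2 (Finset.mem_filter.1 hi).1) (Finset.mem_coe.2 (Finset.mem_filter.1 hj).1))]
    refine Finset.sum_le_sum_of_subset_of_nonneg (fun z hz => ?_) fun z _ _ => hW z
    obtain ⟨i, hi, rfl⟩ := Finset.mem_image.1 hz
    exact (Finset.mem_filter.1 hi).2
  linarith

/-! ### Almost sure upper bound -/

/-- The environments for which the passage values in direction `s` infinitely often exceed every
function `n ↦ c n + b`. -/
def exceedSet (s c : ℝ) : Set (ℤ × ℤ → ℝ) :=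
  {W | ∀ b N : ℕ, ∃ n : ℕ, N ≤ n ∧ c * n + b ≤ lpp W 0 (dirPoint s n)}

theorem measurableSet_exceedSet (s c : ℝ) : MeasurableSet (exceedSet s c) := by
  have : exceedSet s c = ⋂ (b : ℕ) (N : ℕ), ⋃ (n : ℕ) (_ : N ≤ n),
      {W | c * n + b ≤ lpp W 0 (dirPoint s n)} := by
    ext W; simp [exceedSet]
  rw [this]
  exact MeasurableSet.iInter fun b => MeasurableSet.iInter fun N => MeasurableSet.iUnion fun n =>
    MeasurableSet.iUnion fun _ => measurableSet_le measurable_const (measurable_lpp _ _)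

/-- The quantifier over all constants b in `exceedSet` absorbs the bounded effect of finitely many
weights; this makes the event a tail event. -/
theorem zeroOn_mem_exceedSet_iff {s : ℝ} (hs : s ∈ Set.Icc (-(1 / 2) : ℝ) (1 / 2)) (c : ℝ)
    {W : ℤ × ℤ → ℝ} (hW : ∀ z, 0 ≤ W z) (S : Finset (ℤ × ℤ)) :
    zeroOn S W ∈ exceedSet s c ↔ W ∈ exceedSet s c := by
  constructor
  · intro h b N
    obtain ⟨n, hn, h'⟩ := h b N
    exact ⟨n, hn, h'.trans (lpp_mono_weights (zeroOn_le hW _) _ _)⟩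
  · intro h b N
    obtain ⟨k, hk⟩ := exists_nat_ge (∑ z ∈ S, W z)
    obtain ⟨n, hn, h'⟩ := h (b + k) N
    refine ⟨n, hn, ?_⟩
    have := lpp_le_zeroOn_add hW S (dirPoint_nonneg hs n)
    push_cast at h'
    linarith

/-- Greedy concatenation: the passage value dominates the number of points from which some passage
of bounded length has large slope. -/
theorem card_good_mul_le_lpp {W : ℤ × ℤ → ℝ} (hW : ∀ z, 0 ≤ W z) {p : ℕ → ℤ × ℤ}
    (hp : Monotone p) {c : ℝ} (hc : 0 ≤ c) {N : ℕ} {good : ℕ → Prop} [DecidablePred good]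
    (hgood : ∀ j, good j → ∃ n, 1 ≤ n ∧ n ≤ N ∧ c * n ≤ lpp W (p j) (p (j + n))) (M : ℕ) :
    c * ((Finset.range M).filter good).card ≤ lpp W (p 0) (p (M + N)) := by
  suffices H : ∀ k j : ℕ, j + k = M →
      c * ((Finset.Ico j M).filter good).card ≤ lpp W (p j) (p (M + N)) by
    simpa using H M 0 (by simp)
  intro k
  induction k using Nat.strong_induction_on with
  | _ k ih =>
    intro j hj
    rcases Nat.eq_zero_or_pos k with rfl | hk
    · obtain rfl : j = M := by omega
      simpa using lpp_nonneg hW _ _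
    by_cases hg : good j
    · obtain ⟨n, hn1, hnN, hn⟩ := hgood j hg
      rcases lt_or_ge (j + n) M with hlt | hge
      · have h1 := ih (k - n) (by omega) (j + n) (by omega)
        have h2 := lpp_add_le W (hp (show j ≤ j + n by omega))
          (hp (show j + n ≤ M + N by omega))
        have h3 : ((Finset.Ico j M).filter good).card ≤
            n + ((Finset.Ico (j + n) M).filter good).card := by
          rw [← Finset.Ico_union_Ico_eq_Ico (show j ≤ j + n by omega) hlt.le, Finset.filter_union]
          refine (Finset.card_union_le _ _).trans (Nat.add_le_add_right ?_ _)
          refine (Finset.card_filter_le _ _).trans ?_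
          simp
        have h4 : (((Finset.Ico j M).filter good).card : ℝ) ≤
            n + ((Finset.Ico (j + n) M).filter good).card := by exact_mod_cast h3
        nlinarith
      · have h1 : ((Finset.Ico j M).filter good).card ≤ n := by
          refine (Finset.card_filter_le _ _).trans ?_
          rw [Nat.card_Ico]; omega
        have h2 : (((Finset.Ico j M).filter good).card : ℝ) ≤ n := by exact_mod_cast h1
        have h3 := lpp_mono_right hW (hp (show j ≤ j + n by omega))
          (hp (show j + n ≤ M + N by omega))
        nlinarith
    · have h1 := ih (k - 1) (by omega) (j + 1) (by omega)
      have h2 : (Finset.Ico j M).filter good = (Finset.Ico (j + 1) M).filter good := by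
        rw [← Finset.insert_Ico_add_one_left_eq_Ico (show j < M by omega), Finset.filter_insert,
          if_neg hg]
      rw [h2]
      exact h1.trans (lpp_anti_left hW (hp j.le_succ) (hp (by omega)))

namespace IsNonnegWeights

variable {Ω : Type*} [MeasurableSpace Ω] {P : Measure Ω} [IsProbabilityMeasure P]
  {X : Ω → ℤ × ℤ → ℝ}

/-- Kolmogorov's zero-one law. For each finite S the event can be rewritten through `zeroOn S`, so
it is measurable with respect to the weights off S. -/
theorem measure_exceedSet_zero_or_one (h : IsNonnegWeights P X) {s : ℝ}
    (hs : s ∈ Set.Icc (-(1 / 2) : ℝ) (1 / 2)) (c : ℝ) :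
    P (X ⁻¹' exceedSet s c) = 0 ∨ P (X ⁻¹' exceedSet s c) = 1 := by
  classical
  set σ : ℤ × ℤ → MeasurableSpace Ω := fun z => MeasurableSpace.comap (fun ω => X ω z) inferInstance
  refine measure_zero_or_one_of_measurableSet_limsup (s := σ) (f := cofinite)
    (p := fun t : Set (ℤ × ℤ) => t.Finite) (ns := fun S : Finset (ℤ × ℤ) => (S : Set (ℤ × ℤ)))
    (fun z => (h.measurable_apply z).comap_le) h.indep.iIndep (fun t ht => ht.compl_mem_cofinite)
    ?_ (fun S => S.finite_toSet) (fun z => ⟨{z}, by simp⟩) ?_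
  · intro S T
    exact ⟨S ∪ T, by simp, by simp⟩
  · rw [limsup_eq_iInf_iSup, MeasurableSpace.measurableSet_iInf]
    intro t
    rw [MeasurableSpace.measurableSet_iInf]
    intro ht
    have hfin : tᶜ.Finite := ht
    set S := hfin.toFinset with hS
    have e : X ⁻¹' exceedSet s c = (fun ω => zeroOn S (X ω)) ⁻¹' exceedSet s c := by
      ext ω
      exact (zeroOn_mem_exceedSet_iff hs c (h.nonneg ω) S).symm
    rw [e]
    have hm : @Measurable _ _ (⨆ a ∈ t, σ a) _ fun ω => zeroOn S (X ω) := by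
      refine @measurable_pi_lambda _ _ _ (⨆ a ∈ t, σ a) _ _ fun z => ?_
      by_cases hz : z ∈ t
      · have : (fun ω => zeroOn S (X ω) z) = fun ω => X ω z := by
          funext ω; simp [zeroOn, hS, hz]
        rw [this]
        exact (comap_measurable _).mono (le_iSup₂_of_le z hz le_rfl) le_rfl
      · have : (fun ω => zeroOn S (X ω) z) = fun ω => 0 := by
          funext ω; simp [zeroOn, hS, hz]
        rw [this]
        exact @measurable_const _ _ _ (⨆ a ∈ t, σ a) _
    exact hm (measurableSet_exceedSet s c)

/-- The probability that some passage from the origin of length at most `N` has slope at least `c`,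
times `c`, is at most the shape value. -/
theorem mul_measureReal_exists_le_shape (h : IsNonnegWeights P X) {s : ℝ}
    (hs : s ∈ Set.Icc (-(1 / 2) : ℝ) (1 / 2)) {c : ℝ} (hc : 0 ≤ c) (N : ℕ) :
    c * P.real {ω | ∃ n : ℕ, 1 ≤ n ∧ n ≤ N ∧ c * n ≤ lpp (X ω) 0 (dirPoint s n)} ≤
      shape P X s := by
  classical
  set p := dirPoint s with hp
  have hpm : Monotone p := dirPoint_mono hs
  set E : Set (ℤ × ℤ → ℝ) := {W | ∃ n : ℕ, 1 ≤ n ∧ n ≤ N ∧ c * n ≤ lpp W 0 (p n)} with hE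
  have hEm : MeasurableSet E := by
    have : E = ⋃ (n : ℕ) (_ : 1 ≤ n) (_ : n ≤ N), {W | c * n ≤ lpp W 0 (p n)} := by
      ext W
      simp only [hE, Set.mem_iUnion, exists_prop, Set.mem_ofPred_eq]
    rw [this]
    exact MeasurableSet.iUnion fun n => MeasurableSet.iUnion fun _ => MeasurableSet.iUnion fun _ =>
      measurableSet_le measurable_const (_root_.measurable_lpp _ _)
  set A : ℕ → Set Ω := fun j => (fun ω z => X ω (z + p j)) ⁻¹' E with hA
  have hAm : ∀ j, MeasurableSet (A j) := fun j =>
    (measurable_pi_lambda _ fun z => h.measurable_apply _) hEm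
  have hAP : ∀ j, P.real (A j) = P.real (X ⁻¹' E) := fun j =>
    congrArg ENNReal.toReal
      ((h.identDistrib_comp (add_left_injective (p j))).measure_mem_eq hEm)
  set x := P.real (X ⁻¹' E) with hx
  change c * x ≤ _
  have hgood : ∀ ω j, ω ∈ A j →
      ∃ n, 1 ≤ n ∧ n ≤ N ∧ c * n ≤ lpp (X ω) (p j) (p (j + n)) := by
    rintro ω j ⟨n, h1, h2, h3⟩
    refine ⟨n, h1, h2, h3.trans ?_⟩
    rw [← lpp_translate, zero_add]
    refine lpp_mono_right (h.nonneg ω) (le_add_of_nonneg_left (dirPoint_nonneg hs n)) ?_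
    rw [add_comm]
    exact dirPoint_add_le s j n
  -- Expectation of the greedy bound: by translation invariance each of the M starting points is
  -- good with probability x. Dividing by M later removes the boundary term N.
  have hM : ∀ M : ℕ, c * (M * x) ≤ shape P X s * (M + N) := fun M => by
    have h1 : ∀ ω, c * ∑ j ∈ Finset.range M, (A j).indicator (fun _ => (1 : ℝ)) ω ≤
        lpp (X ω) 0 (p (M + N)) := fun ω => by
      have := card_good_mul_le_lpp (h.nonneg ω) hpm hc (good := fun j => ω ∈ A j) (hgood ω) M
      rw [hp, dirPoint_zero] at this
      convert this using 2
      rw [Finset.card_filter]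
      push_cast
      exact Finset.sum_congr rfl fun j _ => by simp [Set.indicator_apply]
    have hi : ∀ j, Integrable ((A j).indicator fun _ => (1 : ℝ)) P := fun j =>
      (integrable_const _).indicator (hAm j)
    have h2 := integral_mono ((integrable_finsetSum _ fun j _ => hi j).const_mul c)
      (h.integrable_lpp 0 (p (M + N))) h1
    rw [integral_const_mul, integral_finsetSum _ fun j _ => hi j] at h2
    have h3 := (h.tendsto_shape_aux hs).2 (M + N)
    refine le_trans (le_of_eq ?_) (h2.trans (h3.trans (le_of_eq ?_)))
    · congr 1
      rw [Finset.sum_congr rfl fun j _ => integral_indicator_const (1 : ℝ) (hAm j)]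
      simp [hAP]
    · push_cast; ring
  have hlim : Tendsto (fun M : ℕ => shape P X s + shape P X s * N / M) atTop
      (𝓝 (shape P X s + 0)) :=
    tendsto_const_nhds.add (tendsto_const_div_atTop_nhds_zero_nat _)
  rw [add_zero] at hlim
  refine ge_of_tendsto hlim ?_
  filter_upwards [eventually_gt_atTop 0] with M hM0
  have hM0' : (0 : ℝ) < M := by exact_mod_cast hM0
  have := hM M
  rw [← add_le_add_iff_right (0 : ℝ)] at this
  have e : shape P X s + shape P X s * N / M = shape P X s * (M + N) / M := by field_simp
  rw [e, le_div_iff₀ hM0']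
  linarith

/-- Otherwise the event has probability one, so almost surely some passage from the origin has slope
at least c. The probabilities in `mul_measureReal_exists_le_shape` then tend to one, which forces c
to be at most the shape value. -/
theorem measure_exceedSet_eq_zero (h : IsNonnegWeights P X) {s : ℝ}
    (hs : s ∈ Set.Icc (-(1 / 2) : ℝ) (1 / 2)) {c : ℝ} (hc : shape P X s < c) :
    P (X ⁻¹' exceedSet s c) = 0 := by
  refine (h.measure_exceedSet_zero_or_one hs c).resolve_right fun h1 => ?_
  have hc0 : 0 < c := (h.shape_nonneg hs).trans_lt hc
  set B : ℕ → Set Ω := fun N =>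
    {ω | ∃ n : ℕ, 1 ≤ n ∧ n ≤ N ∧ c * n ≤ lpp (X ω) 0 (dirPoint s n)} with hB
  have hBm : Monotone B := fun M N hMN ω ⟨n, h1, h2, h3⟩ => ⟨n, h1, h2.trans hMN, h3⟩
  have hU : P (⋃ N, B N) = 1 := by
    refine le_antisymm prob_le_one (h1.symm.le.trans (measure_mono fun ω hω => ?_))
    obtain ⟨n, hn, hn'⟩ := hω 0 1
    exact Set.mem_iUnion.2 ⟨n, n, hn, le_rfl, by simpa using hn'⟩
  have hlim := tendsto_measure_iUnion_atTop (μ := P) hBm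
  rw [hU] at hlim
  have hlim' : Tendsto (fun N => P.real (B N)) atTop (𝓝 1) := by
    have := (ENNReal.tendsto_toReal ENNReal.one_ne_top).comp hlim
    rwa [ENNReal.toReal_one] at this
  have := le_of_tendsto (hlim'.const_mul c)
    (Eventually.of_forall fun N => h.mul_measureReal_exists_le_shape hs hc0.le N)
  linarith

theorem ae_eventually_lpp_le (h : IsNonnegWeights P X) {s : ℝ}
    (hs : s ∈ Set.Icc (-(1 / 2) : ℝ) (1 / 2)) {c : ℝ} (hc : shape P X s < c) :
    ∀ᵐ ω ∂P, ∀ᶠ n : ℕ in atTop, lpp (X ω) 0 (dirPoint s n) ≤ c * n := by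
  -- The surplus (c − c')n outgrows every constant b in `exceedSet s c'`.
  obtain ⟨c', h1, h2⟩ := exists_between hc
  have := h.measure_exceedSet_eq_zero hs h1
  filter_upwards [measure_eq_zero_iff_ae_notMem.1 this] with ω hω
  by_contra hcon
  refine hω fun b N => ?_
  obtain ⟨n₁, hn₁⟩ := exists_nat_ge (b / (c - c'))
  obtain ⟨n, hn, hn'⟩ := frequently_atTop.1 (not_eventually.1 hcon) (max N n₁)
  refine ⟨n, (le_max_left _ _).trans hn, ?_⟩
  have h3 : (n₁ : ℝ) ≤ n := by exact_mod_cast (le_max_right _ _).trans hn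
  have h4 := hn₁.trans h3
  rw [div_le_iff₀ (by linarith)] at h4
  have := not_le.1 hn'
  linarith

/-- The shape theorem in a fixed direction. -/
theorem ae_tendsto_shape (h : IsNonnegWeights P X) {s : ℝ}
    (hs : s ∈ Set.Icc (-(1 / 2) : ℝ) (1 / 2)) :
    ∀ᵐ ω ∂P, Tendsto (fun n : ℕ => lpp (X ω) 0 (dirPoint s n) / n) atTop (𝓝 (shape P X s)) := by
  have h1 : ∀ᵐ ω ∂P, ∀ k : ℕ, ∀ᶠ n : ℕ in atTop,
      (shape P X s - 1 / (k + 1)) * n ≤ lpp (X ω) 0 (dirPoint s n) := ae_all_iff.2 fun k =>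
    h.ae_eventually_le_lpp hs (by have : (0 : ℝ) < 1 / (k + 1) := by positivity
                                  linarith)
  have h2 : ∀ᵐ ω ∂P, ∀ k : ℕ, ∀ᶠ n : ℕ in atTop,
      lpp (X ω) 0 (dirPoint s n) ≤ (shape P X s + 1 / (k + 1)) * n := ae_all_iff.2 fun k =>
    h.ae_eventually_lpp_le hs (by have : (0 : ℝ) < 1 / (k + 1) := by positivity
                                  linarith)
  filter_upwards [h1, h2] with ω h1 h2
  refine tendsto_order.2 ⟨fun a ha => ?_, fun a ha => ?_⟩
  · obtain ⟨k, hk⟩ := exists_nat_one_div_lt (sub_pos.2 ha)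
    filter_upwards [h1 k, eventually_gt_atTop 0] with n hn hn0
    have hn0' : (0 : ℝ) < n := by exact_mod_cast hn0
    rw [lt_div_iff₀ hn0']
    refine lt_of_lt_of_le ?_ hn
    nlinarith
  · obtain ⟨k, hk⟩ := exists_nat_one_div_lt (sub_pos.2 ha)
    filter_upwards [h2 k, eventually_gt_atTop 0] with n hn hn0
    have hn0' : (0 : ℝ) < n := by exact_mod_cast hn0
    rw [div_lt_iff₀ hn0']
    refine lt_of_le_of_lt hn ?_
    nlinarith

end IsNonnegWeights

theorem zero_mem_Icc_half : (0 : ℝ) ∈ Set.Icc (-(1 / 2) : ℝ) (1 / 2) := by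
  constructor <;> norm_num

theorem dirPoint_zero_two_mul (k : ℕ) : dirPoint 0 (2 * k) = ((k : ℤ), (k : ℤ)) := by
  have e1 : ((2 * k : ℕ) : ℝ) / 2 + 0 * ((2 * k : ℕ) : ℝ) = (k : ℤ) := by push_cast; ring
  have e2 : ((2 * k : ℕ) : ℝ) / 2 - 0 * ((2 * k : ℕ) : ℝ) = (k : ℤ) := by push_cast; ring
  rw [dirPoint, e1, e2, Int.floor_intCast]

/-! ### Endpoints of point-to-line geodesics -/

theorem exists_maximal_endpoint (W : ℤ × ℤ → ℝ) (n : ℕ) :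
    ∃ v : ℤ × ℤ, 0 ≤ v ∧ v.1 + v.2 = n ∧ pointToLine W n = (lpp W 0 v : ℝ) ∧
      ∀ u : ℤ × ℤ, 0 ≤ u → u.1 + u.2 = n → lpp W 0 u ≤ lpp W 0 v := by
  set F := (Finset.Icc (0 : ℤ × ℤ) (n, n)).filter fun v => v.1 + v.2 = (n : ℤ) with hF
  have hmem : ∀ u : ℤ × ℤ, 0 ≤ u → u.1 + u.2 = n → u ∈ F := fun u h0 hu => by
    obtain ⟨h1, h2⟩ := Prod.le_def.1 h0
    simp only [Prod.fst_zero, Prod.snd_zero] at h1 h2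
    refine Finset.mem_filter.2 ⟨Finset.mem_Icc.2 ⟨h0, ?_⟩, hu⟩
    constructor <;> simp only <;> omega
  have hne : F.Nonempty := ⟨((n : ℤ), 0), hmem _ (by constructor <;> simp) (by simp)⟩
  obtain ⟨v, hv, hmax⟩ := F.exists_max_image (fun v => lpp W 0 v) hne
  obtain ⟨hv1, hv2⟩ := Finset.mem_filter.1 hv
  have hv0 := (Finset.mem_Icc.1 hv1).1
  refine ⟨v, hv0, hv2, le_antisymm ?_ ?_, fun u h0 hu => hmax u (hmem u h0 hu)⟩
  · refine iSup₂_le fun u hu => ?_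
    by_cases h0 : 0 ≤ u
    · rw [lastPassage_eq_coe W h0]
      exact EReal.coe_le_coe_iff.2 (hmax u (hmem u h0 hu))
    · rw [lastPassage_eq_bot W h0]; exact bot_le
  · rw [← lastPassage_eq_coe W hv0]
    exact le_iSup₂_of_le v hv2 le_rfl

/-- The supremum defining the endpoint is over a nonempty set of integers bounded above by n, so it
is attained by an actual geodesic. -/
theorem pointToLineEnd_spec (W : ℤ × ℤ → ℝ) (n : ℕ) :
    ∃ v : ℤ × ℤ, 0 ≤ v ∧ v.1 + v.2 = n ∧ (pointToLineEnd W n).1 = v.1 ∧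
      ∀ u : ℤ × ℤ, 0 ≤ u → u.1 + u.2 = n → lpp W 0 u ≤ lpp W 0 v := by
  obtain ⟨v, hv0, hvn, hvp, hmax⟩ := exists_maximal_endpoint W n
  set S : Set ℤ := {x : ℤ | ∃ γ, IsPointToLineGeodesic W n γ ∧ (γ n).1 = x} with hS
  have hprop : ∀ x ∈ S, ∃ u : ℤ × ℤ, 0 ≤ u ∧ u.1 + u.2 = n ∧ x = u.1 ∧ lpp W 0 v ≤ lpp W 0 u := by
    rintro x ⟨γ, ⟨u, hu, hγ, hw⟩, rfl⟩
    refine ⟨u, hγ.le, hu, by rw [hγ.finish], ?_⟩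
    rw [hvp, EReal.coe_eq_coe_iff] at hw
    rw [← hw]
    exact hγ.weight_le_lpp W
  have hne : S.Nonempty := by
    obtain ⟨N, γ, hγ, e⟩ := exists_path_lpp W hv0
    have hN := hγ.length_eq
    simp only [Prod.fst_zero, Prod.snd_zero] at hN
    obtain rfl : N = n := by omega
    exact ⟨v.1, γ, ⟨v, hvn, hγ, by rw [hvp, e]⟩, by rw [hγ.finish]⟩
  have hbdd : BddAbove S := by
    refine ⟨n, fun x hx => ?_⟩
    obtain ⟨u, h0, hu, rfl, -⟩ := hprop x hx
    have := h0.2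
    simp only [Prod.snd_zero] at this
    omega
  obtain ⟨u, h0, hu, hx, hle⟩ := hprop _ (Int.csSup_mem hne hbdd)
  exact ⟨u, h0, hu, hx, fun u' h0' hu' => (hmax u' h0' hu').trans hle⟩

theorem pointToLineEnd_eq_of_forall_lt {W : ℤ × ℤ → ℝ} {n : ℕ} {v : ℤ × ℤ} (hv0 : 0 ≤ v)
    (hvn : v.1 + v.2 = n)
    (hlt : ∀ u : ℤ × ℤ, 0 ≤ u → u.1 + u.2 = n → u ≠ v → lpp W 0 u < lpp W 0 v) :
    (pointToLineEnd W n).1 = v.1 := by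
  obtain ⟨u, h0, hu, hx, hmax⟩ := pointToLineEnd_spec W n
  by_cases huv : u = v
  · rw [hx, huv]
  · exact absurd (hmax v hv0 hvn) (not_le.2 (hlt u h0 hu huv))

theorem exists_le_lpp_of_le_pointToLineEnd {W : ℤ × ℤ → ℝ} (hW : ∀ z, 0 ≤ W z) {n : ℕ} {x : ℤ}
    (hx : x ≤ (pointToLineEnd W n).1) :
    ∃ v : ℤ × ℤ, 0 ≤ v ∧ v.1 + v.2 = n ∧ x ≤ v.1 ∧ lpp W 0 (dirPoint 0 n) ≤ lpp W 0 v := by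
  obtain ⟨v, h0, hv, hvx, hmax⟩ := pointToLineEnd_spec W n
  refine ⟨v, h0, hv, hvx ▸ hx, ?_⟩
  have hd := dirPoint_nonneg zero_mem_Icc_half n
  have hs := dirPoint_sum_le 0 n
  -- For odd n the diagonal point lies on x + y = n − 1; u lifts it to the line.
  set u : ℤ × ℤ := ((dirPoint 0 n).1, n - (dirPoint 0 n).1)
  have hdu : dirPoint 0 n ≤ u := ⟨le_rfl, by simp only [u]; omega⟩
  exact (lpp_mono_right hW hd hdu).trans (hmax u (hd.trans hdu) (by simp [u]))

/-- Base points of parallel diagonal columns of `a × a` squares. -/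
def columnPoint (a K : ℕ) (ji : ℕ × ℕ) : ℤ × ℤ :=
  (2 * a * ji.1 + ji.2 * a, 2 * a * K - 2 * a * ji.1 + ji.2 * a)

/-- Consecutive squares of one column meet in a single corner, which is excluded as the starting
point of the later square. Between columns x − y jumps by 4a, while inside a column it deviates by
at most a from its base value. -/
theorem pairwise_disjoint_columnPoint {a : ℕ} (ha : 0 < a) (K : ℕ) :
    Pairwise fun x y : ℕ × ℕ =>
      Disjoint (lppSites (columnPoint a K x) (columnPoint a K x + ((a : ℤ), (a : ℤ))))
        (lppSites (columnPoint a K y) (columnPoint a K y + ((a : ℤ), (a : ℤ)))) := by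
  rintro ⟨j, i⟩ ⟨j', i'⟩ hne
  rw [Finset.disjoint_left]
  rintro ⟨z1, z2⟩ hz hz'
  obtain ⟨h1, h2⟩ := Finset.mem_erase.1 hz
  obtain ⟨h3, h4⟩ := Finset.mem_erase.1 hz'
  obtain ⟨⟨h5, h6⟩, h7, h8⟩ := Finset.mem_Icc.1 h2
  obtain ⟨⟨g5, g6⟩, g7, g8⟩ := Finset.mem_Icc.1 h4
  simp only [columnPoint, Prod.mk_add_mk, ne_eq, Prod.mk.injEq, not_and] at h1 h3 h5 h6 h7 h8 g5 g6 g7 g8 hne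
  have ha1 : (1 : ℤ) ≤ a := by exact_mod_cast ha
  rcases lt_trichotomy j j' with hj | rfl | hj
  · have : (j : ℤ) + 1 ≤ j' := by exact_mod_cast hj
    nlinarith
  · rcases lt_trichotomy i i' with hi | rfl | hi
    · have : (i : ℤ) + 1 ≤ i' := by exact_mod_cast hi
      exact h3 (by nlinarith) (by nlinarith)
    · exact hne rfl rfl
    · have : (i' : ℤ) + 1 ≤ i := by exact_mod_cast hi
      exact h1 (by nlinarith) (by nlinarith)
  · have : (j' : ℤ) + 1 ≤ j := by exact_mod_cast hj
    nlinarith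

/-- The hypothesis `hq` keeps the whole column inside the rectangle from the origin to the diagonal
point, so its value can be extended at both ends. -/
theorem sum_column_le {W : ℤ × ℤ → ℝ} (hW : ∀ z, 0 ≤ W z) {a K j q n : ℕ} (hj : j ≤ K)
    (hq : 2 * a * (q + 2 * K) ≤ n) :
    ∑ i ∈ Finset.range q, lpp W (columnPoint a K (j, i))
      (columnPoint a K (j, i) + ((a : ℤ), (a : ℤ))) ≤ lpp W 0 (dirPoint 0 n) := by
  have hjK : (j : ℤ) ≤ K := by exact_mod_cast hj
  have hmono : Monotone fun i : ℕ => columnPoint a K (j, i) := by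
    intro i i' hii
    have : (i : ℤ) * a ≤ i' * a :=
      mul_le_mul_of_nonneg_right (by exact_mod_cast hii) (by positivity)
    constructor <;> simp only [columnPoint] <;> linarith
  have h1 := sum_lpp_le (W := W) (fun i => columnPoint a K (j, i)) hmono q
  have hsucc : ∀ i, columnPoint a K (j, i + 1) =
      columnPoint a K (j, i) + ((a : ℤ), (a : ℤ)) := fun i => by
    simp only [columnPoint]; ext <;> simp <;> ring
  simp only [hsucc] at h1
  have hq' : 2 * (a : ℤ) * (q + 2 * K) ≤ n := by exact_mod_cast hq
  have hj0 : (0 : ℤ) ≤ a * j := by positivity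
  have hjK' : (a : ℤ) * j ≤ a * K := mul_le_mul_of_nonneg_left hjK (by positivity)
  have hb0 : 0 ≤ columnPoint a K (j, 0) := by
    constructor <;> simp only [columnPoint, Prod.fst_zero, Prod.snd_zero] <;> push_cast <;> linarith
  have hbq : columnPoint a K (j, q) ≤ dirPoint 0 n := by
    have e : ∀ x : ℤ, 2 * x ≤ n → x ≤ ⌊(n : ℝ) / 2⌋ := fun x hx => by
      refine Int.le_floor.2 ?_
      have : (2 : ℝ) * x ≤ n := by exact_mod_cast hx
      linarith
    constructor
    · simp only [dirPoint, zero_mul, add_zero]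
      refine e _ ?_
      simp only [columnPoint]
      linarith
    · simp only [dirPoint, zero_mul, sub_zero]
      refine e _ ?_
      simp only [columnPoint]
      linarith
  have hbm : columnPoint a K (j, 0) ≤ columnPoint a K (j, q) := hmono (Nat.zero_le q)
  exact h1.trans ((lpp_anti_left hW hb0 hbm).trans (lpp_mono_right hW (hb0.trans hbm) hbq))

/-! ### Diagonal lower tail, upper bound for the endpoint, point-to-line growth -/

namespace IsNonnegWeights

variable {Ω : Type*} [MeasurableSpace Ω] {P : Measure Ω} [IsProbabilityMeasure P]
  {X : Ω → ℤ × ℤ → ℝ}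

/-- The lower tail of the last-passage value in the diagonal direction decays faster than any
exponential. -/
theorem exists_lower_tail_superexponential (h : IsNonnegWeights P X) {m : ℝ} (hm0 : 0 ≤ m)
    (hm : m < shape P X 0) (C : ℝ) :
    ∃ n₀ : ℕ, ∀ n : ℕ, n₀ ≤ n →
      P.real {ω | lpp (X ω) 0 (dirPoint 0 n) ≤ m * n} ≤ Real.exp (-C * n) := by
  obtain ⟨m', hmm', hm's⟩ := exists_between hm
  have htwo : Tendsto (fun k : ℕ => 2 * k) atTop atTop := tendsto_id.const_mul_atTop' two_pos
  obtain ⟨a, ha0, ha⟩ := ((eventually_gt_atTop 0).and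
    (((h.tendsto_shape_aux zero_mem_Icc_half).1.comp htwo).eventually (lt_mem_nhds hm's))).exists
  have ha0' : (0 : ℝ) < a := by exact_mod_cast ha0
  simp only [Function.comp_apply] at ha
  rw [dirPoint_zero_two_mul, lt_div_iff₀ (by push_cast; linarith)] at ha
  set d : ℤ × ℤ := ((a : ℤ), (a : ℤ)) with hd
  obtain ⟨c, hc, hb⟩ := h.exists_block_lower_tail d ha
  -- A small diagonal value makes all K column sums small, hence the sum over Kq independent blocks,
  -- an event of probability at most e^{-cKq}. Since q ≥ n/(4a), this number of columns reaches the
  -- prescribed rate C.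
  obtain ⟨K, hK⟩ := exists_nat_ge (max 1 (4 * a * C / c))
  have hK1 : (1 : ℝ) ≤ K := (le_max_left _ _).trans hK
  have hKC : 4 * a * C ≤ K * c := (div_le_iff₀ hc).1 ((le_max_right _ _).trans hK)
  obtain ⟨n₁, hn₁⟩ := exists_nat_ge (max (m' * (2 * a + 4 * a * K) / (m' - m)) (4 * a * (1 + 2 * K)))
  refine ⟨n₁, fun n hn => ?_⟩
  have hnR : (n₁ : ℝ) ≤ n := by exact_mod_cast hn
  have hnA := ((le_max_left _ _).trans hn₁).trans hnR
  have hnB := ((le_max_right _ _).trans hn₁).trans hnR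
  rw [div_le_iff₀ (by linarith)] at hnA
  have hq0 : 2 * K ≤ n / (2 * a) := by
    rw [Nat.le_div_iff_mul_le (by omega)]
    have : ((2 * K * (2 * a) : ℕ) : ℝ) ≤ n := by push_cast; nlinarith
    exact_mod_cast this
  set q := n / (2 * a) - 2 * K with hq
  have hqe : q + 2 * K = n / (2 * a) := by omega
  have hqle : 2 * a * (q + 2 * K) ≤ n := by rw [hqe]; exact Nat.mul_div_le n (2 * a)
  have hqge : n ≤ 2 * a * (q + 2 * K) + 2 * a := by
    rw [hqe]
    have := Nat.div_add_mod n (2 * a)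
    have := Nat.mod_lt n (show 0 < 2 * a by omega)
    omega
  have hqge' : (n : ℝ) ≤ 2 * a * (q + 2 * K) + 2 * a := by exact_mod_cast hqge
  have key := hb (ℕ × ℕ) (Finset.range K ×ˢ Finset.range q) (columnPoint a K)
    (pairwise_disjoint_columnPoint ha0 K)
  rw [Finset.card_product, Finset.card_range, Finset.card_range] at key
  push_cast at key
  refine (measureReal_mono (fun ω hω => ?_) (measure_ne_top _ _)).trans (key.trans ?_)
  · have hω' : lpp (X ω) 0 (dirPoint 0 n) ≤ m * n := hω
    rw [Set.mem_ofPred_eq, Finset.sum_product]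
    have hcol : ∀ j ∈ Finset.range K, ∑ i ∈ Finset.range q,
        lpp (X ω) (columnPoint a K (j, i)) (columnPoint a K (j, i) + d) ≤ m * n := fun j hj =>
      (sum_column_le (h.nonneg ω) (Finset.mem_range.1 hj).le hqle).trans hω'
    refine (Finset.sum_le_card_nsmul _ _ _ hcol).trans ?_
    rw [Finset.card_range, nsmul_eq_mul, mul_assoc]
    refine mul_le_mul_of_nonneg_left ?_ (by linarith)
    have : m' * (n - 2 * a - 4 * a * K) ≤ m' * (2 * a * q) :=
      mul_le_mul_of_nonneg_left (by linarith) (by linarith)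
    nlinarith
  · refine Real.exp_le_exp.2 ?_
    have h1 : (n : ℝ) ≤ 4 * a * q := by nlinarith
    have h2 : c * K * (n / (4 * a)) ≤ c * K * q := by
      refine mul_le_mul_of_nonneg_left ?_ (by positivity)
      rw [div_le_iff₀ (by positivity)]; linarith
    have h3 : C * n ≤ c * K * (n / (4 * a)) := by
      rw [mul_div_assoc', le_div_iff₀ (by positivity)]
      nlinarith [n.cast_nonneg (α := ℝ)]
    nlinarith

/-- An endpoint to the right of direction t beats the diagonal point, so either the diagonal value
is below rn or one of at most n + 1 points has value at least rn. The levels r' < r < μ_0 leave room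
for both tail bounds, at a cost of ε/2 in the rate. -/
theorem exists_probEndGe_le (h : IsNonnegWeights P X) {t : ℝ} (ht0 : 0 < t) (ht : t ≤ 1 / 2)
    (hμ : shape P X t < shape P X 0) {ε : ℝ} (hε : 0 < ε) :
    ∃ n₀ : ℕ, ∀ n : ℕ, n₀ ≤ n → probEndGe P (fun z ω => X ω z) t n ≤
      Real.exp (-n * (rate P X t (shape P X 0) - ε)) := by
  have hts : t ∈ Set.Icc (-(1 / 2) : ℝ) (1 / 2) := ⟨by linarith, ht⟩
  -- The strict inequality between the shape values enters only here, to make the level μ_0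
  -- positive.
  have hμ0 : 0 < shape P X 0 := (h.shape_nonneg hts).trans_lt hμ
  set J := rate P X t (shape P X 0) with hJ
  obtain ⟨r', hr'0, hr', hJr⟩ := h.exists_rate_gt hts hμ0 (half_pos hε)
  obtain ⟨r, hr1, hr2⟩ := exists_between hr'
  obtain ⟨n₁, h1⟩ := h.exists_tail_le_exp_rate ht0 ht hr'0 hr1
  obtain ⟨n₂, h2⟩ := h.exists_lower_tail_superexponential (hr'0.trans hr1).le hr2 J
  -- The factor n + 2 counts the n + 1 possible endpoints and the lower-tail event.
  have hev : ∀ᶠ n : ℕ in atTop, (n : ℝ) + 2 ≤ Real.exp (n * (ε / 2)) := by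
    obtain ⟨k, hk⟩ := exists_nat_ge (max 2 (2 / (ε / 2) ^ 2 * 2))
    filter_upwards [eventually_ge_atTop k] with n hn
    have hnR : (k : ℝ) ≤ n := by exact_mod_cast hn
    have h3 := (le_max_left _ _).trans (hk.trans hnR)
    have h4 := (le_max_right _ _).trans (hk.trans hnR)
    have h5 := Real.quadratic_le_exp_of_nonneg (show 0 ≤ n * (ε / 2) by positivity)
    have h6 : 4 ≤ n * (ε / 2) ^ 2 := by
      rw [div_mul_eq_mul_div, div_le_iff₀ (by positivity)] at h4
      linarith
    nlinarith [mul_nonneg n.cast_nonneg (half_pos hε).le (α := ℝ)]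
  obtain ⟨n₃, h3⟩ := eventually_atTop.1 hev
  refine ⟨max n₁ (max n₂ n₃), fun n hn => ?_⟩
  have hn1 : n₁ ≤ n := (le_max_left _ _).trans hn
  have hn2 : n₂ ≤ n := (le_max_left _ _).trans ((le_max_right _ _).trans hn)
  have hn3 : n₃ ≤ n := (le_max_right _ _).trans ((le_max_right _ _).trans hn)
  set x := ⌊(n : ℝ) / 2 + t * n⌋ with hx
  set F := (Finset.range (n + 1)).filter fun k : ℕ => x ≤ (k : ℤ) with hF
  have hsub : {ω | x ≤ (pointToLineEnd (X ω) n).1} ⊆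
      {ω | lpp (X ω) 0 (dirPoint 0 n) ≤ r * n} ∪
        ⋃ k ∈ F, {ω | r * n ≤ lpp (X ω) 0 ((k : ℤ), (n : ℤ) - k)} := by
    intro ω hω
    obtain ⟨⟨v1, v2⟩, hv0, hvn, hvx, hle⟩ := exists_le_lpp_of_le_pointToLineEnd (h.nonneg ω) hω
    rcases le_total (lpp (X ω) 0 (dirPoint 0 n)) (r * n) with hlt | hlt
    · exact Or.inl hlt
    · right
      have hv1 : 0 ≤ v1 := hv0.1
      have hv2 : 0 ≤ v2 := hv0.2
      simp only at hvn hvx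
      obtain ⟨k, rfl⟩ := Int.eq_ofNat_of_zero_le hv1
      refine Set.mem_biUnion (x := k) (Finset.mem_coe.2 (Finset.mem_filter.2
        ⟨Finset.mem_range.2 (by omega), hvx⟩)) ?_
      rw [show v2 = (n : ℤ) - k by omega] at hle
      exact hlt.trans hle
  have hk : ∀ k ∈ F, P.real {ω | r * n ≤ lpp (X ω) 0 ((k : ℤ), (n : ℤ) - k)} ≤
      Real.exp (-n * rate P X t r') := by
    intro k hk
    obtain ⟨hk1, hk2⟩ := Finset.mem_filter.1 hk
    rw [Finset.mem_range] at hk1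
    refine h1 n hn1 _ ⟨?_, ?_⟩ (by simp) hk2
    · simp
    · simp; omega
  have hcard : (F.card : ℝ) ≤ n + 1 := by
    have := Finset.card_filter_le (Finset.range (n + 1)) fun k : ℕ => x ≤ (k : ℤ)
    rw [Finset.card_range] at this
    exact_mod_cast this
  have hexp : Real.exp (-n * rate P X t r') ≤ Real.exp (-n * (J - ε / 2)) :=
    Real.exp_le_exp.2 (by nlinarith [n.cast_nonneg (α := ℝ)])
  have hexp2 : Real.exp (-J * n) ≤ Real.exp (-n * (J - ε / 2)) :=
    Real.exp_le_exp.2 (by nlinarith [n.cast_nonneg (α := ℝ)])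
  calc probEndGe P (fun z ω => X ω z) t n
      ≤ P.real {ω | lpp (X ω) 0 (dirPoint 0 n) ≤ r * n} +
        ∑ k ∈ F, P.real {ω | r * n ≤ lpp (X ω) 0 ((k : ℤ), (n : ℤ) - k)} :=
        (measureReal_mono hsub (measure_ne_top _ _)).trans ((measureReal_union_le _ _).trans
          (add_le_add_right (measureReal_biUnion_finset_le _ _) _))
    _ ≤ Real.exp (-n * (J - ε / 2)) + F.card * Real.exp (-n * (J - ε / 2)) := by
        refine add_le_add ((h2 n hn2).trans hexp2) ?_
        rw [← nsmul_eq_mul]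
        exact Finset.sum_le_card_nsmul _ _ _ fun k hk' => (hk k hk').trans hexp
    _ ≤ (n + 2) * Real.exp (-n * (J - ε / 2)) := by
        nlinarith [Real.exp_pos (-n * (J - ε / 2))]
    _ ≤ Real.exp (n * (ε / 2)) * Real.exp (-n * (J - ε / 2)) :=
        mul_le_mul_of_nonneg_right (h3 n hn3) (Real.exp_pos _).le
    _ = Real.exp (-n * (J - ε)) := by rw [← Real.exp_add]; congr 1; ring

/-- The point-to-line passage value grows at most with the slope of the diagonal direction. -/
theorem tendsto_measureReal_pointToLine_ge (h : IsNonnegWeights P X) {δ : ℝ} (hδ : 0 < δ) :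
    Tendsto (fun L : ℕ => P.real {ω | ∃ v : ℤ × ℤ, 0 ≤ v ∧ v.1 + v.2 = L ∧
      (shape P X 0 + δ) * L ≤ lpp (X ω) 0 v}) atTop (𝓝 0) := by
  set μ := shape P X 0 with hμ
  have hμ0 : 0 ≤ μ := h.shape_nonneg zero_mem_Icc_half
  set c := μ + δ / 2 with hc
  obtain ⟨H, hH⟩ := exists_nat_gt (4 * c / δ)
  have hc0 : 0 < c := by linarith
  have hH0 : (0 : ℝ) < H := (div_pos (by linarith) hδ).trans hH
  rw [div_lt_iff₀ hδ] at hH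
  -- A finite grid of directions serves all endpoints: with k = ⌊xH/L⌋ the point (x, L − x) lies
  -- below the point of direction s k at the slightly larger size n' L, roughly L(1 + 1/H). All grid
  -- directions have shape value at most μ_0, and δ pays for the enlargement.
  set s : ℕ → ℝ := fun k => (k + 1) / (H + 1) - 1 / 2 with hs
  have hsI : ∀ k ∈ Finset.range (H + 1), s k ∈ Set.Icc (-(1 / 2) : ℝ) (1 / 2) := fun k hk => by
    have hk' : (k : ℝ) ≤ H := by exact_mod_cast Nat.lt_succ_iff.1 (Finset.mem_range.1 hk)
    have h1 : ((k : ℝ) + 1) / (H + 1) ≤ 1 := by rw [div_le_one (by linarith)]; linarith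
    have h2 : 0 ≤ ((k : ℝ) + 1) / (H + 1) := by positivity
    constructor <;> simp only [hs] <;> linarith
  set n' : ℕ → ℕ := fun L => L + (L / H + 1) with hn'
  have hn'top : Tendsto n' atTop atTop := tendsto_atTop_mono (fun L => Nat.le_add_right _ _) tendsto_id
  have hbad : ∀ k ∈ Finset.range (H + 1), Tendsto (fun L : ℕ =>
      P.real {ω | c * n' L < lpp (X ω) 0 (dirPoint (s k) (n' L))}) atTop (𝓝 0) := fun k hk => by
    have hae := h.ae_eventually_lpp_le (hsI k hk) (c := c)
      ((h.shape_le_shape_zero (hsI k hk)).trans_lt (by linarith))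
    have := tendsto_measure_of_ae_tendsto_indicator (L := atTop) (μ := P) (A := (∅ : Set Ω))
      (As := fun n : ℕ => {ω | c * n < lpp (X ω) 0 (dirPoint (s k) n)}) MeasurableSet.empty
      (fun n => measurableSet_lt measurable_const (h.measurable_lpp _ _))
      (B := Set.univ) MeasurableSet.univ (measure_ne_top _ _) (Eventually.of_forall fun _ => Set.subset_univ _)
      (by
        filter_upwards [hae] with ω hω
        filter_upwards [hω] with n hn
        simpa using hn)
    rw [measure_empty] at this
    have h2 := (ENNReal.tendsto_toReal ENNReal.zero_ne_top).comp (this.comp hn'top)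
    rwa [ENNReal.toReal_zero] at h2
  have hsum := tendsto_finsetSum (Finset.range (H + 1)) hbad
  rw [Finset.sum_const_zero] at hsum
  obtain ⟨L₀, hL₀⟩ := exists_nat_gt (4 * c / δ)
  rw [div_lt_iff₀ hδ] at hL₀
  refine tendsto_of_tendsto_of_tendsto_of_le_of_le' tendsto_const_nhds hsum
    (Eventually.of_forall fun _ => measureReal_nonneg) ?_
  filter_upwards [eventually_ge_atTop (L₀ + 1)] with L hL
  have hL0 : (0 : ℝ) < L := by exact_mod_cast (by omega : 0 < L)
  have hLR : (L₀ : ℝ) ≤ L := by exact_mod_cast (by omega : L₀ ≤ L)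
  refine (measureReal_mono (fun ω hω => ?_) (measure_ne_top _ _)).trans
    (measureReal_biUnion_finset_le (Finset.range (H + 1))
      fun k => {ω | c * n' L < lpp (X ω) 0 (dirPoint (s k) (n' L))})
  obtain ⟨⟨x, y⟩, hv0, hvL, hv⟩ := hω
  have hx : (0 : ℤ) ≤ x := hv0.1
  have hy : (0 : ℤ) ≤ y := hv0.2
  simp only at hvL
  obtain ⟨x, rfl⟩ := Int.eq_ofNat_of_zero_le hx
  have hHN : 0 < H := by exact_mod_cast hH0
  have hLN : 0 < L := by omega
  set k := x * H / L with hk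
  have hkm : k ∈ Finset.range (H + 1) := by
    refine Finset.mem_range.2 (Nat.lt_succ_iff.2 ?_)
    rw [hk]
    exact Nat.div_le_of_le_mul (Nat.mul_le_mul_right H (by omega))
  have hk1 : (k : ℝ) * L ≤ x * H := by exact_mod_cast Nat.div_mul_le_self (x * H) L
  have hk2 : (x : ℝ) * H ≤ (k + 1) * L := by
    have := Nat.lt_div_mul_add hLN (a := x * H)
    exact_mod_cast (by rw [← hk] at this; nlinarith : x * H ≤ (k + 1) * L)
  have hnge : (L : ℝ) * (H + 1) ≤ n' L * H := by
    have := Nat.lt_div_mul_add hHN (a := L)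
    have h2 : L * (H + 1) ≤ n' L * H := by simp only [hn']; nlinarith
    exact_mod_cast h2
  have hnle : (n' L : ℝ) * H ≤ L * (H + 1) + H := by
    have := Nat.div_mul_le_self L H
    have h2 : n' L * H ≤ L * (H + 1) + H := by simp only [hn']; nlinarith
    exact_mod_cast h2
  have hle : ((x : ℤ), y) ≤ dirPoint (s k) (n' L) := by
    have hyR : (y : ℝ) = L - x := by
      have : ((x : ℤ) : ℝ) + y = L := by exact_mod_cast hvL
      simp at this
      linarith
    have e1 : (n' L : ℝ) / 2 + s k * n' L = n' L * (k + 1) / (H + 1) := by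
      simp only [hs]; field_simp; ring
    have e2 : (n' L : ℝ) / 2 - s k * n' L = n' L * (H - k) / (H + 1) := by
      simp only [hs]; field_simp; ring
    have hkH : (k : ℝ) ≤ H := by exact_mod_cast Nat.lt_succ_iff.1 (Finset.mem_range.1 hkm)
    constructor
    · refine Int.le_floor.2 ?_
      rw [e1, le_div_iff₀ (by linarith)]
      push_cast
      refine le_of_mul_le_mul_right ?_ hH0
      nlinarith [k.cast_nonneg (α := ℝ)]
    · refine Int.le_floor.2 ?_
      rw [e2, le_div_iff₀ (by linarith)]
      simp only
      rw [hyR]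
      refine le_of_mul_le_mul_right ?_ hH0
      nlinarith
  refine Set.mem_biUnion (Finset.mem_coe.2 hkm) ?_
  refine lt_of_lt_of_le ?_ (hv.trans (lpp_mono_right (h.nonneg ω) hv0 hle))
  have h1 : c * n' L * H ≤ c * (L * (H + 1) + H) := by
    rw [mul_assoc]; exact mul_le_mul_of_nonneg_left hnle hc0.le
  refine lt_of_mul_lt_mul_right (h1.trans_lt ?_) hH0.le
  have h2 : c * L < δ / 4 * H * L := by nlinarith
  have h3 : c * H < δ / 4 * L * H := by nlinarith
  rw [hc] at *
  nlinarith

end IsNonnegWeights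

/-! ### The Harris inequality -/

/-- `F` is non-increasing in the weights on `T`. -/
def AntitoneOnSites (T : Set (ℤ × ℤ)) (F : (ℤ × ℤ → ℝ) → ℝ) : Prop :=
  ∀ W W' : ℤ × ℤ → ℝ, (∀ y, W' y ≤ W y) → (∀ y ∉ T, W' y = W y) → F W ≤ F W'

section Harris

variable {Ω : Type*} [MeasurableSpace Ω] {P : Measure Ω} [IsProbabilityMeasure P]

theorem integrable_of_mem_Icc {Ω' : Type*} [MeasurableSpace Ω'] {Q : Measure Ω'} [IsFiniteMeasure Q]
    {f : Ω' → ℝ} (hf : Measurable f)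
    (hb : ∀ ω, f ω ∈ Set.Icc (0 : ℝ) 1) : Integrable f Q :=
  (integrable_const (1 : ℝ)).mono' hf.aestronglyMeasurable
    (ae_of_all _ fun ω => by rw [Real.norm_of_nonneg (hb ω).1]; exact (hb ω).2)

theorem mul_mem_Icc_zero_one {x y : ℝ} (hx : x ∈ Set.Icc (0 : ℝ) 1) (hy : y ∈ Set.Icc (0 : ℝ) 1) :
    x * y ∈ Set.Icc (0 : ℝ) 1 :=
  ⟨mul_nonneg hx.1 hy.1, mul_le_one₀ hx.2 hy.1 hy.2⟩

theorem integral_mem_Icc_zero_one {f : Ω → ℝ} (hf : Measurable f)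
    (hb : ∀ ω, f ω ∈ Set.Icc (0 : ℝ) 1) : ∫ ω, f ω ∂P ∈ Set.Icc (0 : ℝ) 1 := by
  refine ⟨integral_nonneg fun ω => (hb ω).1, ?_⟩
  have := integral_mono (integrable_of_mem_Icc hf hb) (integrable_const (1 : ℝ))
    (μ := P) fun ω => (hb ω).2
  simpa using this

/-- **Chebyshev's association inequality** for two non-increasing functions of a real random
variable. -/
theorem integral_mul_integral_le_of_antitone {Y : Ω → ℝ} (hY : Measurable Y) {f g : ℝ → ℝ}
    (hfm : Measurable f) (hgm : Measurable g) (hf : Antitone f) (hg : Antitone g)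
    (hfb : ∀ x, f x ∈ Set.Icc (0 : ℝ) 1) (hgb : ∀ x, g x ∈ Set.Icc (0 : ℝ) 1) :
    (∫ ω, f (Y ω) ∂P) * ∫ ω, g (Y ω) ∂P ≤ ∫ ω, f (Y ω) * g (Y ω) ∂P := by
  have hF : Integrable (fun ω => f (Y ω)) P := integrable_of_mem_Icc (hfm.comp hY) fun ω => hfb _
  have hG : Integrable (fun ω => g (Y ω)) P := integrable_of_mem_Icc (hgm.comp hY) fun ω => hgb _
  have hFG : Integrable (fun ω => f (Y ω) * g (Y ω)) P :=
    integrable_of_mem_Icc ((hfm.comp hY).mul (hgm.comp hY)) fun ω =>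
      mul_mem_Icc_zero_one (hfb _) (hgb _)
  -- Independent-copy argument: both differences have the same sign, and expanding the product gives
  -- twice the covariance.
  have hpos : 0 ≤ ∫ ω, ∫ ω', (f (Y ω) - f (Y ω')) * (g (Y ω) - g (Y ω')) ∂P ∂P :=
    integral_nonneg fun ω => integral_nonneg fun ω' => by
      rcases le_total (Y ω) (Y ω') with h | h
      · exact mul_nonneg (sub_nonneg.2 (hf h)) (sub_nonneg.2 (hg h))
      · exact mul_nonneg_of_nonpos_of_nonpos (sub_nonpos.2 (hf h)) (sub_nonpos.2 (hg h))
  have hin : ∀ ω, ∫ ω', (f (Y ω) - f (Y ω')) * (g (Y ω) - g (Y ω')) ∂P =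
      f (Y ω) * g (Y ω) - f (Y ω) * (∫ ω', g (Y ω') ∂P) - (∫ ω', f (Y ω') ∂P) * g (Y ω) +
        ∫ ω', f (Y ω') * g (Y ω') ∂P := fun ω => by
    have e : ∀ ω', (f (Y ω) - f (Y ω')) * (g (Y ω) - g (Y ω')) =
        f (Y ω) * g (Y ω) - f (Y ω) * g (Y ω') - f (Y ω') * g (Y ω) + f (Y ω') * g (Y ω') :=
      fun ω' => by ring
    simp only [e]
    have i1 : Integrable (fun ω' => f (Y ω) * g (Y ω) - f (Y ω) * g (Y ω')) P :=
      (integrable_const _).sub (hG.const_mul _)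
    have i2 : Integrable (fun ω' => f (Y ω') * g (Y ω)) P := hF.mul_const _
    have i3 : Integrable
        (fun ω' => f (Y ω) * g (Y ω) - f (Y ω) * g (Y ω') - f (Y ω') * g (Y ω)) P := i1.sub i2
    rw [integral_add i3 hFG, integral_sub i1 i2, integral_sub (integrable_const _) (hG.const_mul _)]
    simp [integral_const_mul, integral_mul_const]
  simp only [hin] at hpos
  have j1 : Integrable (fun ω => f (Y ω) * g (Y ω) - f (Y ω) * (∫ ω', g (Y ω') ∂P)) P :=
    hFG.sub (hF.mul_const _)
  have j2 : Integrable (fun ω => (∫ ω', f (Y ω') ∂P) * g (Y ω)) P := hG.const_mul _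
  have j3 : Integrable (fun ω => f (Y ω) * g (Y ω) - f (Y ω) * (∫ ω', g (Y ω') ∂P) -
      (∫ ω', f (Y ω') ∂P) * g (Y ω)) P := j1.sub j2
  rw [integral_add j3 (integrable_const _), integral_sub j1 j2, integral_sub hFG (hF.mul_const _),
    integral_const_mul, integral_mul_const] at hpos
  simp only [integral_const, probReal_univ, one_smul] at hpos
  linarith

namespace IsNonnegWeights

variable {X : Ω → ℤ × ℤ → ℝ}

theorem measurable_update_pair (h : IsNonnegWeights P X) (z : ℤ × ℤ) :
    Measurable fun q : (ℤ × ℤ → ℝ) × Ω => Function.update q.1 z (X q.2 z) := by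
  refine measurable_pi_lambda _ fun y => ?_
  by_cases hy : y = z
  · subst hy
    simpa [Function.comp_def] using (h.measurable_apply y).comp measurable_snd
  · simpa [hy, Function.comp_def] using (measurable_pi_apply y).comp measurable_fst

/-- Resampling one weight does not change the expectation. -/
theorem integral_eq_integral_update (h : IsNonnegWeights P X) {F : (ℤ × ℤ → ℝ) → ℝ}
    (hF : Measurable F) (hb : ∀ W, F W ∈ Set.Icc (0 : ℝ) 1) {R : Finset (ℤ × ℤ)}
    (hR : DependsOn F R) (z : ℤ × ℤ) :
    ∫ ω, F (X ω) ∂P = ∫ ω, ∫ ω', F (Function.update (X ω) z (X ω' z)) ∂P ∂P := by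
  classical
  -- F factors through the weights on T and the weight at z, which are independent; Fubini for the
  -- product of their laws then gives the claim.
  set T := R.erase z with hT
  set Φ : (ℤ × ℤ → ℝ) → (T → ℝ) := fun W y => W y with hΦ
  set Ψ : (T → ℝ) × ℝ → ℝ := fun q => F (Function.update (extendZero T q.1) z q.2) with hΨ
  have hΨm : Measurable Ψ := by
    refine hF.comp (measurable_pi_lambda _ fun y => ?_)
    by_cases hy : y = z
    · subst hy; simpa using measurable_snd
    · simpa [hy, Function.comp_def] using (measurable_pi_apply y).comp ((measurable_extendZero T).comp measurable_fst)
  have hΨF : ∀ W x, Ψ (Φ W, x) = F (Function.update W z x) := fun W x => hR fun y hy => by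
    by_cases hyz : y = z
    · simp [hyz]
    · have : y ∈ T := Finset.mem_erase.2 ⟨hyz, hy⟩
      simp [hyz, extendZero, this, hΦ]
  have hΦm : Measurable Φ := measurable_pi_lambda _ fun y => measurable_pi_apply _
  have hind : IndepFun (fun ω => Φ (X ω)) (fun ω => X ω z) P :=
    h.indepFun_of_dependsOn (F := Φ) (G := fun W => W z) hΦm (measurable_pi_apply z)
      (S := T) (T := {z}) (fun W W' e => funext fun y => e y y.2) (fun W W' e => e z (by simp))
      (by simp [hT])
  have hm1 : Measurable fun ω => Φ (X ω) := hΦm.comp h.measurable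
  have hm2 := h.measurable_apply z
  have hprod := hind.map_prod_eq_prod_map_map hm1.aemeasurable hm2.aemeasurable
  have := Measure.isProbabilityMeasure_map (μ := P) hm1.aemeasurable
  have := Measure.isProbabilityMeasure_map (μ := P) hm2.aemeasurable
  calc ∫ ω, F (X ω) ∂P = ∫ ω, Ψ (Φ (X ω), X ω z) ∂P := by simp [hΨF]
    _ = ∫ q, Ψ q ∂((P.map fun ω => Φ (X ω)).prod (P.map fun ω => X ω z)) := by
        rw [← hprod, integral_map (hm1.prodMk hm2).aemeasurable hΨm.aestronglyMeasurable]
    _ = ∫ a, ∫ x, Ψ (a, x) ∂(P.map fun ω => X ω z) ∂(P.map fun ω => Φ (X ω)) :=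
        integral_prod _ (integrable_of_mem_Icc hΨm fun q => hb _)
    _ = ∫ ω, ∫ x, Ψ (Φ (X ω), x) ∂(P.map fun ω => X ω z) ∂P :=
        integral_map hm1.aemeasurable
          (hΨm.stronglyMeasurable.integral_prod_right).aestronglyMeasurable
    _ = ∫ ω, ∫ ω', F (Function.update (X ω) z (X ω' z)) ∂P ∂P := by
        congr 1
        funext ω
        have hs : Measurable fun x => Ψ (Φ (X ω), x) :=
          hΨm.comp (measurable_const.prodMk measurable_id)
        rw [integral_map hm2.aemeasurable hs.aestronglyMeasurable]
        simp only [hΨF]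

/-- **Harris inequality**, conditionally on the weights on `S`: if `F` and `G` are non-increasing
in the weights on `T`, and `G` depends only on them, then `F` and `G` are positively correlated. -/
theorem integral_mul_integral_le_of_antitoneOnSites (h : IsNonnegWeights P X)
    (S T : Finset (ℤ × ℤ)) {F G : (ℤ × ℤ → ℝ) → ℝ} (hFm : Measurable F) (hGm : Measurable G)
    (hFb : ∀ W, F W ∈ Set.Icc (0 : ℝ) 1) (hGb : ∀ W, G W ∈ Set.Icc (0 : ℝ) 1)
    (hFS : DependsOn F ((S ∪ T : Finset (ℤ × ℤ)) : Set (ℤ × ℤ))) (hGT : DependsOn G T)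
    (hF : AntitoneOnSites T F) (hG : AntitoneOnSites T G) :
    (∫ ω, F (X ω) ∂P) * ∫ ω, G (X ω) ∂P ≤ ∫ ω, F (X ω) * G (X ω) ∂P := by
  classical
  induction T using Finset.induction_on generalizing F G with
  | empty =>
    have hc : ∀ W, G W = G 0 := fun W => hGT (by simp)
    simp [hc, integral_mul_const]
  | insert z T hz ih =>
    have hFGm : Measurable fun W => F W * G W := hFm.mul hGm
    have hFGb : ∀ W, F W * G W ∈ Set.Icc (0 : ℝ) 1 := fun W => mul_mem_Icc_zero_one (hFb W) (hGb W)
    have hup := h.measurable_update_pair z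
    have hslice : ∀ W : ℤ × ℤ → ℝ, Measurable fun x : ℝ => Function.update W z x := fun W =>
      measurable_update W
    have havg : ∀ H : (ℤ × ℤ → ℝ) → ℝ, Measurable H →
        Measurable fun W => ∫ ω', H (Function.update W z (X ω' z)) ∂P := fun H hH =>
      ((hH.comp hup).stronglyMeasurable.integral_prod_right').measurable
    have hdep : ∀ (H : (ℤ × ℤ → ℝ) → ℝ) (R R' : Finset (ℤ × ℤ)), DependsOn H R → R ⊆ insert z R' →
        DependsOn (fun W => ∫ ω', H (Function.update W z (X ω' z)) ∂P) R' := by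
      intro H R R' hH hRR W W' e
      refine integral_congr_ae (ae_of_all _ fun ω' => hH fun y hy => ?_)
      by_cases hyz : y = z
      · simp [hyz]
      · have := (Finset.mem_insert.1 (hRR hy)).resolve_left hyz
        simpa [hyz] using e y this
    have hint : ∀ H : (ℤ × ℤ → ℝ) → ℝ, Measurable H → (∀ W, H W ∈ Set.Icc (0 : ℝ) 1) → ∀ W,
        Integrable (fun ω' => H (Function.update W z (X ω' z))) P := fun H hH hHb W =>
      integrable_of_mem_Icc (hH.comp ((hslice W).comp (h.measurable_apply z))) fun _ => hHb _
    have hanti : ∀ H : (ℤ × ℤ → ℝ) → ℝ, Measurable H → (∀ W, H W ∈ Set.Icc (0 : ℝ) 1) →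
        AntitoneOnSites ((insert z T : Finset (ℤ × ℤ)) : Set (ℤ × ℤ)) H →
        AntitoneOnSites T fun W => ∫ ω', H (Function.update W z (X ω' z)) ∂P := by
      intro H hHm hHb hH W W' h1 h2
      refine integral_mono (hint H hHm hHb W) (hint H hHm hHb W') fun ω' => hH _ _ ?_ ?_
      · intro y
        by_cases hyz : y = z
        · simp [hyz]
        · simpa [hyz] using h1 y
      · intro y hy
        have hyz : y ≠ z := fun e => hy (by simp [e])
        simpa [hyz] using h2 y fun hyT => hy (by simp [Finset.mem_coe.1 hyT])
    have hone : ∀ H : (ℤ × ℤ → ℝ) → ℝ,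
        AntitoneOnSites ((insert z T : Finset (ℤ × ℤ)) : Set (ℤ × ℤ)) H →
        ∀ W, Antitone fun x : ℝ => H (Function.update W z x) := by
      intro H hH W x x' hx
      refine hH _ _ ?_ ?_
      · intro y
        by_cases hyz : y = z
        · subst hyz; simpa using hx
        · simp [hyz]
      · intro y hy
        have hyz : y ≠ z := fun e => hy (by simp [e])
        simp [hyz]
    have hsub1 : S ∪ insert z T ⊆ insert z (S ∪ T) := by
      intro y hy
      simp only [Finset.mem_union, Finset.mem_insert] at hy ⊢
      tauto
    -- Averaging over the weight at z preserves monotonicity in the rest of T and removes z from the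
    -- dependence sets, so the induction hypothesis applies to the averages. The one-variable
    -- inequality then treats z with all other weights frozen.
    have key := ih (havg F hFm) (havg G hGm)
      (fun W => integral_mem_Icc_zero_one (hFm.comp ((hslice W).comp (h.measurable_apply z)))
        fun _ => hFb _)
      (fun W => integral_mem_Icc_zero_one (hGm.comp ((hslice W).comp (h.measurable_apply z)))
        fun _ => hGb _)
      (hdep F _ _ hFS hsub1) (hdep G _ _ hGT subset_rfl)
      (hanti F hFm hFb hF) (hanti G hGm hGb hG)
    have hFGdep : DependsOn (fun W => F W * G W)
        ((S ∪ insert z T : Finset (ℤ × ℤ)) : Set (ℤ × ℤ)) := fun W W' e => by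
      have h1 := hFS e
      have h2 : G W = G W' := hGT fun y hy => e y (by
        simp only [Finset.coe_union]; exact Or.inr hy)
      simp only [h1, h2]
    rw [h.integral_eq_integral_update hFm hFb hFS z, h.integral_eq_integral_update hGm hGb hGT z,
      h.integral_eq_integral_update hFGm hFGb hFGdep z]
    refine key.trans (integral_mono ?_ ?_ fun ω => ?_)
    · refine integrable_of_mem_Icc (((havg F hFm).comp h.measurable).mul
        ((havg G hGm).comp h.measurable)) fun ω => mul_mem_Icc_zero_one ?_ ?_
      · exact integral_mem_Icc_zero_one (hFm.comp ((hslice _).comp (h.measurable_apply z)))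
          fun _ => hFb _
      · exact integral_mem_Icc_zero_one (hGm.comp ((hslice _).comp (h.measurable_apply z)))
          fun _ => hGb _
    · exact integrable_of_mem_Icc ((havg _ hFGm).comp h.measurable) fun ω =>
        integral_mem_Icc_zero_one (hFGm.comp ((hslice _).comp (h.measurable_apply z)))
          fun _ => hFGb _
    · exact integral_mul_integral_le_of_antitone (h.measurable_apply z)
        (hFm.comp (hslice (X ω))) (hGm.comp (hslice (X ω))) (hone F hF _) (hone G hG _)
        (fun _ => hFb _) fun _ => hGb _

/-- If each event `E i` is increasing and determined by the weights on `S i`, and each `D i` is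
decreasing, determined by the weights off `S i`, and has probability at least `c`, then some
`E i ∩ D i` occurs with probability at least `c` times that of some `E i`. -/
theorem mul_measureReal_biUnion_le (h : IsNonnegWeights P X) {ι : Type*} (I : Finset ι)
    (E D : ι → Set (ℤ × ℤ → ℝ)) (S : ι → Finset (ℤ × ℤ)) (B : Finset (ℤ × ℤ))
    (hEm : ∀ i ∈ I, MeasurableSet (E i)) (hDm : ∀ i ∈ I, MeasurableSet (D i))
    (hSB : ∀ i ∈ I, S i ⊆ B)
    (hES : ∀ i ∈ I, ∀ W W', (∀ z ∈ S i, W z = W' z) → W ∈ E i → W' ∈ E i)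
    (hE : ∀ i ∈ I, ∀ W W' : ℤ × ℤ → ℝ, (∀ z, W z ≤ W' z) → W ∈ E i → W' ∈ E i)
    (hDS : ∀ i ∈ I, ∀ W W', (∀ z ∈ B \ S i, W z = W' z) → W ∈ D i → W' ∈ D i)
    (hD : ∀ i ∈ I, ∀ W W' : ℤ × ℤ → ℝ, (∀ z, W' z ≤ W z) → W ∈ D i → W' ∈ D i)
    {c : ℝ} (hc : ∀ i ∈ I, c ≤ P.real (X ⁻¹' D i)) :
    c * P.real (X ⁻¹' ⋃ i ∈ I, E i) ≤ P.real (X ⁻¹' ⋃ i ∈ I, E i ∩ D i) := by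
  classical
  induction I using Finset.induction_on with
  | empty => simp
  | insert i I hi ih =>
    have hIm := fun j (hj : j ∈ I) => (Finset.mem_insert_of_mem hj : j ∈ insert i I)
    have him : i ∈ insert i I := Finset.mem_insert_self i I
    have ih' := ih (fun j hj => hEm j (hIm j hj)) (fun j hj => hDm j (hIm j hj))
      (fun j hj => hSB j (hIm j hj)) (fun j hj => hES j (hIm j hj)) (fun j hj => hE j (hIm j hj))
      (fun j hj => hDS j (hIm j hj)) (fun j hj => hD j (hIm j hj)) (fun j hj => hc j (hIm j hj))
    set U := ⋃ j ∈ I, E j with hU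
    have hUm : MeasurableSet U :=
      Finset.measurableSet_biUnion _ fun j hj => hEm j (hIm j hj)
    have hVm : MeasurableSet (⋃ j ∈ I, E j ∩ D j) :=
      Finset.measurableSet_biUnion _ fun j hj => (hEm j (hIm j hj)).inter (hDm j (hIm j hj))
    have hAm : MeasurableSet (E i \ U) := (hEm i him).diff hUm
    have hDim := hDm i him
    have hUdep : ∀ W W', (∀ z ∈ B, W z = W' z) → W ∈ U → W' ∈ U := by
      intro W W' e hW
      obtain ⟨j, hj, hWj⟩ := Set.mem_iUnion₂.1 hW
      exact Set.mem_biUnion hj (hES j (hIm j hj) W W' (fun z hz => e z (hSB j (hIm j hj) hz)) hWj)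
    have hUmono : ∀ W W' : ℤ × ℤ → ℝ, (∀ z, W z ≤ W' z) → W ∈ U → W' ∈ U := by
      intro W W' e hW
      obtain ⟨j, hj, hWj⟩ := Set.mem_iUnion₂.1 hW
      exact Set.mem_biUnion hj (hE j (hIm j hj) W W' e hWj)
    have hind01 : ∀ (s : Set (ℤ × ℤ → ℝ)) (W : ℤ × ℤ → ℝ),
        s.indicator (fun _ => (1 : ℝ)) W ∈ Set.Icc (0 : ℝ) 1 := fun s W => by
      by_cases hW : W ∈ s <;> simp [hW]
    have hindle : ∀ (s : Set (ℤ × ℤ → ℝ)) (W W' : ℤ × ℤ → ℝ), (W ∈ s → W' ∈ s) →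
        s.indicator (fun _ => (1 : ℝ)) W ≤ s.indicator (fun _ => (1 : ℝ)) W' := fun s W W' hs => by
      by_cases hW : W ∈ s
      · simp [hW, hs hW]
      · rw [Set.indicator_of_notMem hW]; exact (hind01 s W').1
    have hBeq : S i ∪ B \ S i = B := Finset.union_sdiff_of_subset (hSB i him)
    -- With the weights on S i frozen, `E i` is decided, and lowering the others can only destroy
    -- the increasing event U. Hence `E i \ U` is decreasing off S i, although `E i` itself is
    -- increasing.
    have harris := h.integral_mul_integral_le_of_antitoneOnSites (S i) (B \ S i)
      (F := (E i \ U).indicator fun _ => 1) (G := (D i).indicator fun _ => 1)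
      (measurable_const.indicator hAm) (measurable_const.indicator hDim) (hind01 _) (hind01 _)
      (by
        rw [hBeq]
        intro W W' e
        refine le_antisymm (hindle _ _ _ fun hW => ?_) (hindle _ _ _ fun hW => ?_)
        · exact ⟨hES i him W W' (fun z hz => e z (hSB i him hz)) hW.1, fun hW' => hW.2
            (hUdep W' W (fun z hz => (e z hz).symm) hW')⟩
        · exact ⟨hES i him W' W (fun z hz => (e z (hSB i him hz)).symm) hW.1, fun hW' => hW.2
            (hUdep W W' (fun z hz => e z hz) hW')⟩)
      (by
        intro W W' e
        refine le_antisymm (hindle _ _ _ fun hW => ?_) (hindle _ _ _ fun hW => ?_)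
        · exact hDS i him W W' (fun z hz => e z hz) hW
        · exact hDS i him W' W (fun z hz => (e z hz).symm) hW)
      (by
        intro W W' h1 h2
        refine hindle _ _ _ fun hW => ⟨hES i him W W' (fun z hz => (h2 z ?_).symm) hW.1,
          fun hW' => hW.2 (hUmono W' W h1 hW')⟩
        simp [hz])
      (by
        intro W W' h1 _
        exact hindle _ _ _ fun hW => hD i him W W' h1 hW)
    have e1 : ∀ s : Set (ℤ × ℤ → ℝ), MeasurableSet s →
        ∫ ω, s.indicator (fun _ => (1 : ℝ)) (X ω) ∂P = P.real (X ⁻¹' s) := fun s hs => by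
      have : (fun ω => s.indicator (fun _ => (1 : ℝ)) (X ω)) =
          (X ⁻¹' s).indicator fun _ => (1 : ℝ) := by
        funext ω; by_cases hω : X ω ∈ s <;> simp [hω]
      rw [this, integral_indicator_const _ (h.measurable hs)]
      simp
    have e2 : ∀ ω, (E i \ U).indicator (fun _ => (1 : ℝ)) (X ω) *
        (D i).indicator (fun _ => (1 : ℝ)) (X ω) =
        ((E i \ U) ∩ D i).indicator (fun _ => (1 : ℝ)) (X ω) := fun ω => by
      rw [← Set.inter_indicator_mul]; simp only [mul_one]
    simp only [e2] at harris
    rw [e1 _ hAm, e1 _ hDim, e1 _ (hAm.inter hDim)] at harris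
    have hsplit : P.real (X ⁻¹' ⋃ j ∈ insert i I, E j) ≤
        P.real (X ⁻¹' U) + P.real (X ⁻¹' (E i \ U)) := by
      refine (measureReal_mono (fun ω hω => ?_) (measure_ne_top _ _)).trans
        (measureReal_union_le _ _)
      rw [Finset.set_biUnion_insert] at hω
      by_cases hU' : X ω ∈ U
      · exact Or.inl hU'
      · exact Or.inr ⟨hω.resolve_right hU', hU'⟩
    have hjoin : P.real (X ⁻¹' ⋃ j ∈ I, E j ∩ D j) + P.real (X ⁻¹' ((E i \ U) ∩ D i)) ≤
        P.real (X ⁻¹' ⋃ j ∈ insert i I, E j ∩ D j) := by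
      rw [← measureReal_union _ (h.measurable (hAm.inter hDim))]
      · refine measureReal_mono (fun ω hω => ?_) (measure_ne_top _ _)
        rw [Finset.set_biUnion_insert]
        rcases hω with hω | hω
        · exact Or.inr hω
        · exact Or.inl ⟨hω.1.1, hω.2⟩
      · rw [Set.disjoint_left]
        intro ω h1 h2
        obtain ⟨j, hj, hWj⟩ := Set.mem_iUnion₂.1 (show X ω ∈ _ from h1)
        exact h2.1.2 (Set.mem_biUnion hj hWj.1)
    have h3 := hc i him
    have h4 : (0 : ℝ) ≤ P.real (X ⁻¹' (E i \ U)) := measureReal_nonneg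
    rcases le_total 0 c with hc0 | hc0
    · nlinarith
    · exact (mul_nonpos_of_nonpos_of_nonneg hc0 measureReal_nonneg).trans measureReal_nonneg

end IsNonnegWeights

end Harris

/-! ### Last exit from a path -/

/-- The sites visited by a path after its start. -/
noncomputable def pathSites (n : ℕ) (γ : ℕ → ℤ × ℤ) : Finset (ℤ × ℤ) :=
  (Finset.range n).image fun k => γ (k + 1)

theorem pathWeight_drop (W : ℤ × ℤ → ℝ) (γ : ℕ → ℤ × ℤ) (m n : ℕ) :
    pathWeight W (n - m) (fun i => γ (m + i)) = ∑ k ∈ Finset.Ico m n, W (γ (k + 1)) := by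
  rw [Finset.sum_Ico_eq_sum_range]
  rfl

/-- If from every point of `γ` the best way to reach the line off `γ` is worse than following `γ`,
then the endpoint of `γ` has the strictly largest passage value on the line. -/
theorem lpp_lt_of_off_path {W : ℤ × ℤ → ℝ} {v : ℤ × ℤ} {n : ℕ} {γ : ℕ → ℤ × ℤ}
    (hγ : IsUpRightPath 0 v n γ)
    (hoff : ∀ m < n, ∀ u, γ m ≤ u → u.1 + u.2 = n →
      lpp (zeroOn (pathSites n γ) W) (γ m) u < ∑ k ∈ Finset.Ico m n, W (γ (k + 1)))
    {u : ℤ × ℤ} (hu0 : 0 ≤ u) (hun : u.1 + u.2 = n) (huv : u ≠ v) : lpp W 0 u < lpp W 0 v := by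
  classical
  obtain ⟨N, π, hπ, e⟩ := exists_path_lpp W hu0
  obtain rfl : N = n := by
    have := hπ.length_eq
    simp only [Prod.fst_zero, Prod.snd_zero] at this
    omega
  -- The last common point. Two paths from the origin can meet only at equal indices, since the
  -- index is the level. After m the competitor therefore avoids every site of γ, and zeroing these
  -- does not change its weight.
  set m := Nat.findGreatest (fun k => π k = γ k) N with hm
  have hmN : m ≤ N := Nat.findGreatest_le N
  have hπm : π m = γ m := Nat.findGreatest_spec (P := fun k => π k = γ k) (Nat.zero_le N)
    (by rw [hπ.start, hγ.start])
  have hmlt : m < N := by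
    refine lt_of_le_of_ne hmN fun hmN' => huv ?_
    rw [hmN', hπ.finish, hγ.finish] at hπm
    exact hπm
  have hnot : ∀ i < N - m, π (m + (i + 1)) ∉ pathSites N γ := by
    intro i hi hmem
    obtain ⟨k, hk, hk'⟩ := Finset.mem_image.1 hmem
    have hk := Finset.mem_range.1 hk
    have h1 := hγ.level (i := k + 1) (by omega)
    have h2 := hπ.level (i := m + (i + 1)) (by omega)
    rw [hk', h2] at h1
    have h3 : k + 1 = m + (i + 1) := by push_cast at h1; omega
    refine Nat.findGreatest_is_greatest (P := fun k => π k = γ k) (n := N) (k := m + (i + 1))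
      (by omega) (by omega) ?_
    rw [← hk', h3]
  have h1 : pathWeight W (N - m) (fun i => π (m + i)) =
      pathWeight (zeroOn (pathSites N γ) W) (N - m) (fun i => π (m + i)) := by
    refine Finset.sum_congr rfl fun i hi => ?_
    have := hnot i (Finset.mem_range.1 hi)
    simp [zeroOn, this]
  have hdrop := hπ.drop hmN
  rw [hπm] at hdrop
  have h2 := hdrop.weight_le_lpp (zeroOn (pathSites N γ) W)
  have h3 := hoff m hmlt u hdrop.le hun
  have htake := hπ.take hmN
  rw [hπm] at htake
  have happ := (htake.append (hγ.drop hmN)).weight_le_lpp W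
  rw [pathWeight_append W (by simpa using hπm), pathWeight_drop] at happ
  have h4 : pathWeight W N π = pathWeight W m π + pathWeight W (N - m) (fun i => π (m + i)) := by
    rw [← pathWeight_add, Nat.add_sub_cancel' hmN]
  linarith

theorem measurable_zeroOn (S : Set (ℤ × ℤ)) : Measurable (zeroOn S) := by
  classical
  refine measurable_pi_lambda _ fun z => ?_
  by_cases hz : z ∈ S
  · simp only [zeroOn, hz, if_true]; exact measurable_const
  · simp only [zeroOn, hz, if_false]; exact measurable_pi_apply z

/-! ### Paths through prescribed corners -/

/-- `γ` visits the first `N` multiples of `d`, spaced by `ℓ` steps, and then follows `φ`. -/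
structure IsSkeletonPath (d : ℤ × ℤ) (ℓ N j₀ : ℕ) (φ γ : ℕ → ℤ × ℤ) : Prop where
  corner : ∀ i ≤ N, γ (i * ℓ) = i • d
  tail : ∀ i ≤ j₀, γ (N * ℓ + i) = φ i

/-- Every block of the path has weight at least `x`, and the weights on the final segment exceed
`K`. -/
def heavyEvent (ℓ N j₀ : ℕ) (x K : ℝ) (γ : ℕ → ℤ × ℤ) : Set (ℤ × ℤ → ℝ) :=
  {W | (∀ i < N, x ≤ ∑ k ∈ Finset.Ico (i * ℓ) ((i + 1) * ℓ), W (γ (k + 1))) ∧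
    ∀ i < j₀, K < W (γ (N * ℓ + i + 1))}

/-- The passage values to the line `x + y = n` from the corners and from the points of the final
segment `φ` are bounded. -/
def lightEvent (d : ℤ × ℤ) (N j₀ n : ℕ) (φ : ℕ → ℤ × ℤ) (β : ℕ → ℝ) (C : ℝ) :
    Set (ℤ × ℤ → ℝ) :=
  {W | (∀ i < N, ∀ u : ℤ × ℤ, i • d ≤ u → u.1 + u.2 = n → lpp W (i • d) u ≤ β i) ∧
    ∀ i < j₀, ∀ u : ℤ × ℤ, φ i ≤ u → u.1 + u.2 = n → lpp W (φ i) u ≤ C * (j₀ - i)}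

/-- A competitor leaving γ inside block i is charged as if it started at corner i, while γ is
credited only with the N − 1 − i blocks after that one and with the final segment; hence the form of
`hβ`. On the final segment each step of γ earns more than K ≥ C. -/
theorem lpp_lt_of_heavy_of_light {d : ℤ × ℤ} {ℓ N j₀ n : ℕ} (hn : n = N * ℓ + j₀)
    (hj₀ : 0 < j₀) {φ γ : ℕ → ℤ × ℤ} {v : ℤ × ℤ} (hγ : IsUpRightPath 0 v n γ)
    (hs : IsSkeletonPath d ℓ N j₀ φ γ) {x K C : ℝ} {β : ℕ → ℝ} (hCK : C ≤ K)
    (hβ : ∀ i < N, β i ≤ (N - 1 - i) * x + K * j₀) {W : ℤ × ℤ → ℝ} (hW : ∀ z, 0 ≤ W z)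
    (hheavy : W ∈ heavyEvent ℓ N j₀ x K γ)
    (hlight : zeroOn (pathSites n γ) W ∈ lightEvent d N j₀ n φ β C)
    {u : ℤ × ℤ} (hu0 : 0 ≤ u) (hun : u.1 + u.2 = n) (huv : u ≠ v) : lpp W 0 u < lpp W 0 v := by
  refine lpp_lt_of_off_path hγ (fun m hm u hmu hun => ?_) hu0 hun huv
  obtain ⟨h1, h2⟩ := hheavy
  obtain ⟨h3, h4⟩ := hlight
  have hforced : ∀ i < j₀, K * (j₀ - i) < ∑ k ∈ Finset.Ico (N * ℓ + i) n, W (γ (k + 1)) := by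
    intro i hi
    rw [Finset.sum_Ico_eq_sum_range, show n - (N * ℓ + i) = j₀ - i by omega]
    have : ∑ _k ∈ Finset.range (j₀ - i), K <
        ∑ k ∈ Finset.range (j₀ - i), W (γ (N * ℓ + i + k + 1)) := by
      refine Finset.sum_lt_sum_of_nonempty ⟨0, Finset.mem_range.2 (by omega)⟩ fun k hk => ?_
      have := Finset.mem_range.1 hk
      have := h2 (i + k) (by omega)
      rwa [← add_assoc] at this
    rw [Finset.sum_const, Finset.card_range, nsmul_eq_mul, Nat.cast_sub hi.le] at this
    linarith
  rcases lt_or_ge m (N * ℓ) with hmN | hmN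
  · have hℓ : 0 < ℓ := Nat.pos_of_ne_zero fun h0 => by simp [h0] at hmN
    obtain ⟨i, hiN, him, hmi⟩ : ∃ i < N, i * ℓ ≤ m ∧ m < (i + 1) * ℓ :=
      ⟨m / ℓ, Nat.div_lt_of_lt_mul (by rwa [mul_comm] at hmN), Nat.div_mul_le_self m ℓ, by
        rw [Nat.succ_mul]; exact Nat.lt_div_mul_add hℓ⟩
    have hblocks : ∀ k ≤ N, k * x + K * j₀ < ∑ k ∈ Finset.Ico ((N - k) * ℓ) n, W (γ (k + 1)) := by
      intro k
      induction k with
      | zero =>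
        intro _
        have := hforced 0 hj₀
        simpa using this
      | succ k ih =>
        intro hk
        have h5 := ih (by omega)
        have h6 := h1 (N - (k + 1)) (by omega)
        rw [show N - (k + 1) + 1 = N - k by omega] at h6
        rw [← Finset.sum_Ico_consecutive _
          (Nat.mul_le_mul_right ℓ (show N - (k + 1) ≤ N - k by omega))
          (show (N - k) * ℓ ≤ n by
            have := Nat.mul_le_mul_right ℓ (show N - k ≤ N by omega)
            omega)]
        push_cast
        linarith
    have h5 := hblocks (N - 1 - i) (by omega)
    rw [show N - (N - 1 - i) = i + 1 by omega] at h5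
    have h6 : ∑ k ∈ Finset.Ico ((i + 1) * ℓ) n, W (γ (k + 1)) ≤
        ∑ k ∈ Finset.Ico m n, W (γ (k + 1)) :=
      Finset.sum_le_sum_of_subset_of_nonneg (Finset.Ico_subset_Ico hmi.le le_rfl)
        fun k _ _ => hW _
    have hcm : i • d ≤ γ m := by
      rw [← hs.corner i hiN.le]
      exact hγ.monotone him hm.le
    have h7 := h3 i hiN u (hcm.trans hmu) hun
    have h8 := lpp_anti_left (zeroOn_nonneg hW (pathSites n γ)) hcm hmu
    have h9 := hβ i hiN
    rw [Nat.cast_sub (by omega), Nat.cast_sub (by omega)] at h5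
    push_cast at h5
    linarith
  · obtain ⟨i, rfl⟩ := Nat.exists_eq_add_of_le hmN
    have hi : i < j₀ := by omega
    rw [hs.tail i hi.le] at hmu ⊢
    refine (h4 i hi u hmu hun).trans_lt (lt_of_le_of_lt ?_ (hforced i hi))
    have : (i : ℝ) ≤ j₀ := by exact_mod_cast hi.le
    exact mul_le_mul_of_nonneg_right hCK (by linarith)

theorem measurableSet_heavyEvent (ℓ N j₀ : ℕ) (x K : ℝ) (γ : ℕ → ℤ × ℤ) :
    MeasurableSet (heavyEvent ℓ N j₀ x K γ) := by
  have : heavyEvent ℓ N j₀ x K γ =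
      (⋂ (i : ℕ) (_ : i < N), {W | x ≤ ∑ k ∈ Finset.Ico (i * ℓ) ((i + 1) * ℓ), W (γ (k + 1))}) ∩
        ⋂ (i : ℕ) (_ : i < j₀), {W | K < W (γ (N * ℓ + i + 1))} := by
    ext W; simp [heavyEvent]
  rw [this]
  have h1 : ∀ i, Measurable fun W : ℤ × ℤ → ℝ =>
      ∑ k ∈ Finset.Ico (i * ℓ) ((i + 1) * ℓ), W (γ (k + 1)) := fun i =>
    Finset.measurable_sum _ fun k _ => measurable_pi_apply _
  have h2 : ∀ i, Measurable fun W : ℤ × ℤ → ℝ => W (γ (N * ℓ + i + 1)) := fun i =>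
    measurable_pi_apply _
  refine MeasurableSet.inter ?_ ?_
  · exact MeasurableSet.iInter fun i => MeasurableSet.iInter fun _ =>
      measurableSet_le measurable_const (h1 i)
  · exact MeasurableSet.iInter fun i => MeasurableSet.iInter fun _ =>
      measurableSet_lt measurable_const (h2 i)

theorem measurableSet_lightEvent (d : ℤ × ℤ) (N j₀ n : ℕ) (φ : ℕ → ℤ × ℤ) (β : ℕ → ℝ) (C : ℝ) :
    MeasurableSet (lightEvent d N j₀ n φ β C) := by
  have : lightEvent d N j₀ n φ β C =
      (⋂ (i : ℕ) (_ : i < N) (u : ℤ × ℤ) (_ : i • d ≤ u) (_ : u.1 + u.2 = n),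
        {W | lpp W (i • d) u ≤ β i}) ∩
      ⋂ (i : ℕ) (_ : i < j₀) (u : ℤ × ℤ) (_ : φ i ≤ u) (_ : u.1 + u.2 = n),
        {W | lpp W (φ i) u ≤ C * (j₀ - i)} := by
    ext W; simp [lightEvent]
  rw [this]
  refine (MeasurableSet.iInter fun i => MeasurableSet.iInter fun _ => MeasurableSet.iInter fun u =>
    MeasurableSet.iInter fun _ => MeasurableSet.iInter fun _ =>
      measurableSet_le (measurable_lpp _ _) measurable_const).inter
    (MeasurableSet.iInter fun i => MeasurableSet.iInter fun _ => MeasurableSet.iInter fun u =>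
    MeasurableSet.iInter fun _ => MeasurableSet.iInter fun _ =>
      measurableSet_le (measurable_lpp _ _) measurable_const)

theorem lightEvent_anti {d : ℤ × ℤ} {N j₀ n : ℕ} {φ : ℕ → ℤ × ℤ} {β : ℕ → ℝ} {C : ℝ}
    {W W' : ℤ × ℤ → ℝ} (hle : ∀ z, W' z ≤ W z) (h : W ∈ lightEvent d N j₀ n φ β C) :
    W' ∈ lightEvent d N j₀ n φ β C :=
  ⟨fun i hi u h1 h2 => (lpp_mono_weights hle _ _).trans (h.1 i hi u h1 h2),
    fun i hi u h1 h2 => (lpp_mono_weights hle _ _).trans (h.2 i hi u h1 h2)⟩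

theorem heavyEvent_mono {ℓ N j₀ : ℕ} {x K : ℝ} {γ : ℕ → ℤ × ℤ} {W W' : ℤ × ℤ → ℝ}
    (hle : ∀ z, W z ≤ W' z) (h : W ∈ heavyEvent ℓ N j₀ x K γ) : W' ∈ heavyEvent ℓ N j₀ x K γ :=
  ⟨fun i hi => (h.1 i hi).trans (Finset.sum_le_sum fun _ _ => hle _),
    fun i hi => (h.2 i hi).trans_le (hle _)⟩

theorem heavyEvent_congr {ℓ N j₀ n : ℕ} (hn : n = N * ℓ + j₀) {x K : ℝ} {γ : ℕ → ℤ × ℤ}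
    {W W' : ℤ × ℤ → ℝ} (e : ∀ z ∈ pathSites n γ, W z = W' z) (h : W ∈ heavyEvent ℓ N j₀ x K γ) :
    W' ∈ heavyEvent ℓ N j₀ x K γ := by
  have e' : ∀ k < n, W (γ (k + 1)) = W' (γ (k + 1)) := fun k hk =>
    e _ (Finset.mem_image.2 ⟨k, Finset.mem_range.2 hk, rfl⟩)
  refine ⟨fun i hi => ?_, fun i hi => ?_⟩
  · refine (h.1 i hi).trans (le_of_eq (Finset.sum_congr rfl fun k hk => e' k ?_))
    have h1 := (Finset.mem_Ico.1 hk).2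
    have h2 := Nat.mul_le_mul_right ℓ (show i + 1 ≤ N from hi)
    omega
  · rw [← e' _ (by omega)]; exact h.2 i hi

theorem heavyEvent_congr_path {ℓ N j₀ n : ℕ} (hn : n = N * ℓ + j₀) {x K : ℝ} {γ γ' : ℕ → ℤ × ℤ}
    (e : ∀ k ≤ n, γ k = γ' k) {W : ℤ × ℤ → ℝ} (h : W ∈ heavyEvent ℓ N j₀ x K γ) :
    W ∈ heavyEvent ℓ N j₀ x K γ' := by
  refine ⟨fun i hi => ?_, fun i hi => ?_⟩
  · refine (h.1 i hi).trans (le_of_eq (Finset.sum_congr rfl fun k hk => ?_))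
    have h1 := (Finset.mem_Ico.1 hk).2
    have h2 := Nat.mul_le_mul_right ℓ (show i + 1 ≤ N from hi)
    rw [e (k + 1) (by omega)]
  · rw [← e _ (by omega)]; exact h.2 i hi

/-- The passage values involved only see the box [0, n]², and the sites of S in it are zeroed. -/
theorem zeroOn_mem_lightEvent_congr {d : ℤ × ℤ} {N j₀ n : ℕ} {φ : ℕ → ℤ × ℤ} {β : ℕ → ℝ} {C : ℝ}
    (hd : 0 ≤ d) (hφ : ∀ i, 0 ≤ φ i) {S : Finset (ℤ × ℤ)} {W W' : ℤ × ℤ → ℝ}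
    (e : ∀ z ∈ Finset.Icc (0 : ℤ × ℤ) (n, n) \ S, W z = W' z)
    (h : zeroOn S W ∈ lightEvent d N j₀ n φ β C) : zeroOn S W' ∈ lightEvent d N j₀ n φ β C := by
  have key : ∀ c u : ℤ × ℤ, 0 ≤ c → c ≤ u → u.1 + u.2 = n →
      lpp (zeroOn S W') c u = lpp (zeroOn S W) c u := fun c u hc hcu hu => lpp_congr fun z hz => by
    by_cases hzS : z ∈ S
    · simp [zeroOn, hzS]
    · obtain ⟨h1, h2⟩ := Finset.mem_Icc.1 (Finset.mem_erase.1 hz).2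
      have h3 := (hc.trans hcu).1
      have h4 := (hc.trans hcu).2
      simp only [Prod.fst_zero, Prod.snd_zero] at h3 h4
      have hun : u ≤ ((n : ℤ), (n : ℤ)) := ⟨by simp only; omega, by simp only; omega⟩
      have := e z (Finset.mem_sdiff.2 ⟨Finset.mem_Icc.2 ⟨hc.trans h1, h2.trans hun⟩, hzS⟩)
      simp [zeroOn, hzS, this]
  exact ⟨fun i hi u h1 h2 => by
      rw [key _ _ (nsmul_nonneg hd i) h1 h2]; exact h.1 i hi u h1 h2,
    fun i hi u h1 h2 => by rw [key _ _ (hφ i) h1 h2]; exact h.2 i hi u h1 h2⟩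

/-- Concatenating maximal paths between consecutive multiples of `d`. -/
theorem exists_corner_path {W : ℤ × ℤ → ℝ} {d : ℤ × ℤ} {ℓ : ℕ} (hd : 0 ≤ d)
    (hℓ : (ℓ : ℤ) = d.1 + d.2) {x : ℝ} (N : ℕ) (hx : ∀ i < N, x ≤ lpp W (i • d) (i • d + d)) :
    ∃ γ, IsUpRightPath 0 (N • d) (N * ℓ) γ ∧ (∀ i ≤ N, γ (i * ℓ) = i • d) ∧
      ∀ i < N, x ≤ ∑ k ∈ Finset.Ico (i * ℓ) ((i + 1) * ℓ), W (γ (k + 1)) := by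
  induction N with
  | zero =>
    refine ⟨fun _ => 0, ⟨rfl, by simp, by simp⟩, fun i hi => ?_, by simp⟩
    simp [Nat.le_zero.1 hi]
  | succ N ih =>
    obtain ⟨γ, hγ, hc, hw⟩ := ih fun i hi => hx i (by omega)
    obtain ⟨M, γ', hγ', e⟩ := exists_path_lpp W (le_add_of_nonneg_right hd : N • d ≤ N • d + d)
    obtain rfl : M = ℓ := by
      have := hγ'.length_eq
      simp only [Prod.fst_add, Prod.snd_add] at this
      omega
    have happ := hγ.append hγ'
    have hjoin : γ (N * M) = γ' 0 := by rw [hγ.finish, hγ'.start]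
    refine ⟨pathAppend (N * M) γ γ', ?_, fun i hi => ?_, fun i hi => ?_⟩
    · rw [succ_nsmul, Nat.succ_mul]; exact happ
    · rcases Nat.lt_succ_iff_lt_or_eq.1 (Nat.lt_succ_of_le hi) with hi' | rfl
      · rw [pathAppend_of_le (Nat.mul_le_mul_right M (by omega)), hc i (by omega)]
      · rw [Nat.succ_mul, pathAppend_add hjoin, hγ'.finish, succ_nsmul]
    · rcases Nat.lt_succ_iff_lt_or_eq.1 hi with hi' | rfl
      · refine (hw i hi').trans (le_of_eq (Finset.sum_congr rfl fun k hk => ?_))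
        have h1 := (Finset.mem_Ico.1 hk).2
        have h2 := Nat.mul_le_mul_right M (show i + 1 ≤ N from hi')
        rw [pathAppend_of_le (by omega)]
      · refine (hx i (by omega)).trans (le_of_eq ?_)
        rw [← e, Finset.sum_Ico_eq_sum_range, Nat.succ_mul, Nat.add_sub_cancel_left]
        refine Finset.sum_congr rfl fun k _ => ?_
        rw [add_assoc, pathAppend_add hjoin]

/-- The witness is a step path so that the heavy paths range over a finite family, as the union over
candidates requires. -/
theorem exists_skeleton_path {W : ℤ × ℤ → ℝ} {d v : ℤ × ℤ} {ℓ N j₀ n : ℕ} (hd : 0 ≤ d)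
    (hℓ : (ℓ : ℤ) = d.1 + d.2) (hn : n = N * ℓ + j₀) {φ : ℕ → ℤ × ℤ}
    (hφ : IsUpRightPath (N • d) v j₀ φ) {x K : ℝ}
    (hx : ∀ i < N, x ≤ lpp W (i • d) (i • d + d)) (hK : ∀ i < j₀, K < W (φ (i + 1))) :
    ∃ S ∈ (Finset.range n).powerset, IsUpRightPath 0 v n (stepPath 0 S) ∧
      IsSkeletonPath d ℓ N j₀ φ (stepPath 0 S) ∧ W ∈ heavyEvent ℓ N j₀ x K (stepPath 0 S) := by
  obtain ⟨γ, hγ, hc, hw⟩ := exists_corner_path hd hℓ N hx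
  have hjoin : γ (N * ℓ) = φ 0 := by rw [hγ.finish, hφ.start]
  have happ := hγ.append hφ
  rw [← hn] at happ
  obtain ⟨S, hS, e⟩ := happ.exists_stepPath
  refine ⟨S, hS, happ.congr e, ⟨fun i hi => ?_, fun i hi => ?_⟩, heavyEvent_congr_path hn e ⟨?_, ?_⟩⟩
  · have h2 := Nat.mul_le_mul_right ℓ hi
    rw [← e _ (by omega), pathAppend_of_le h2, hc i hi]
  · rw [← e _ (by omega), pathAppend_add hjoin]
  · intro i hi
    refine (hw i hi).trans (le_of_eq (Finset.sum_congr rfl fun k hk => ?_))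
    have h1 := (Finset.mem_Ico.1 hk).2
    have h2 := Nat.mul_le_mul_right ℓ (show i + 1 ≤ N from hi)
    rw [pathAppend_of_le (by omega)]
  · intro i hi
    rw [add_assoc, pathAppend_add hjoin]
    exact hK i hi

/-! ### Probability of a heavy skeleton in a light environment -/

theorem nsmul_fst_add_snd (k : ℕ) (d : ℤ × ℤ) :
    (k • d).1 + (k • d).2 = k * (d.1 + d.2) := by
  rw [Prod.smul_fst, Prod.smul_snd, nsmul_eq_mul, nsmul_eq_mul, mul_add]

namespace IsNonnegWeights

variable {Ω : Type*} [MeasurableSpace Ω] {P : Measure Ω} [IsProbabilityMeasure P]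
  {X : Ω → ℤ × ℤ → ℝ}

/-- The blocks use disjoint rectangles below N • d, and the sites of φ after its start lie on
strictly higher, distinct levels, so all N + j₀ conditions are independent. -/
theorem pow_mul_pow_le_measureReal_blocks (h : IsNonnegWeights P X) {d v : ℤ × ℤ} (hd : 0 ≤ d)
    {N j₀ : ℕ} {φ : ℕ → ℤ × ℤ} (hφ : IsUpRightPath (N • d) v j₀ φ) (x K : ℝ) :
    P.real {ω | x ≤ lpp (X ω) 0 d} ^ N * P.real {ω | K < X ω 0} ^ j₀ ≤
      P.real {ω | (∀ i < N, x ≤ lpp (X ω) (i • d) (i • d + d)) ∧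
        ∀ i < j₀, K < X ω (φ (i + 1))} := by
  classical
  let F : Fin N ⊕ Fin j₀ → (ℤ × ℤ → ℝ) → ℝ :=
    Sum.elim (fun i W => lpp W ((i : ℕ) • d) ((i : ℕ) • d + d)) fun i W => W (φ (i + 1))
  let S : Fin N ⊕ Fin j₀ → Finset (ℤ × ℤ) :=
    Sum.elim (fun i => lppSites ((i : ℕ) • d) ((i : ℕ) • d + d)) fun i => {φ (i + 1)}
  let A : Fin N ⊕ Fin j₀ → Set ℝ := Sum.elim (fun _ => Set.Ici x) fun _ => Set.Ioi K
  have hF : ∀ i, Measurable (F i) := by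
    rintro (i | i)
    · exact _root_.measurable_lpp _ _
    · exact measurable_pi_apply _
  have hFS : ∀ i, DependsOn (F i) (S i) := by
    rintro (i | i)
    · exact dependsOn_lpp _ _
    · exact fun W W' e => e _ (by simp [S])
  have hmix : ∀ (i : Fin N) (j : Fin j₀),
      Disjoint (lppSites ((i : ℕ) • d) ((i : ℕ) • d + d)) {φ (j + 1)} := fun i j => by
    rw [Finset.disjoint_singleton_right]
    intro hmem
    have h1 := (Finset.mem_Icc.1 (Finset.mem_erase.1 hmem).2).2
    rw [← succ_nsmul] at h1
    have h2 := h1.trans (nsmul_le_nsmul_left hd (show (i : ℕ) + 1 ≤ N from i.2))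
    have h3 := hφ.level (i := j + 1) (by omega)
    have h4 := h2.1
    have h5 := h2.2
    push_cast at h3
    omega
  have hS : Pairwise fun i j => Disjoint (S i) (S j) := by
    rintro (i | i) (j | j) hij
    · exact pairwise_disjoint_lppSites_nsmul hd fun e => hij (by rw [Fin.ext e])
    · exact hmix i j
    · exact (hmix j i).symm
    · refine Finset.disjoint_singleton.2 fun e => hij ?_
      have h1 := hφ.level (i := i + 1) (by omega)
      have h2 := hφ.level (i := j + 1) (by omega)
      rw [e, h2] at h1
      congr 1
      refine Fin.ext ?_
      push_cast at h1
      omega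
  have key := (h.iIndepFun_of_dependsOn hF hFS hS).measure_inter_preimage_eq_mul Finset.univ
    (sets := A) (by
      rintro (i | i) -
      · exact measurableSet_Ici
      · exact measurableSet_Ioi)
  rw [Fintype.prod_sum_type] at key
  have e1 : ∀ i : Fin N, P ((fun ω => F (Sum.inl i) (X ω)) ⁻¹' A (Sum.inl i)) =
      P {ω | x ≤ lpp (X ω) 0 d} := fun i => by
    have := (h.identDistrib_lpp_translate 0 d ((i : ℕ) • d)).measure_mem_eq
      (measurableSet_Ici (a := x))
    rw [zero_add, add_comm d] at this
    exact this
  have e2 : ∀ i : Fin j₀, P ((fun ω => F (Sum.inr i) (X ω)) ⁻¹' A (Sum.inr i)) =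
      P {ω | K < X ω 0} := fun i =>
    (h.identDistrib (φ (i + 1))).measure_mem_eq (measurableSet_Ioi (a := K))
  simp only [e1, e2, Finset.prod_const, Finset.card_univ, Fintype.card_fin] at key
  have key' := congrArg ENNReal.toReal key
  rw [ENNReal.toReal_mul, ENNReal.toReal_pow, ENNReal.toReal_pow] at key'
  refine le_of_eq_of_le key'.symm (measureReal_mono (fun ω hω => ?_) (measure_ne_top _ _))
  simp only [Set.mem_iInter] at hω
  exact ⟨fun i hi => hω (Sum.inl ⟨i, hi⟩) (Finset.mem_univ _),
    fun i hi => hω (Sum.inr ⟨i, hi⟩) (Finset.mem_univ _)⟩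

theorem measureReal_exists_lpp_translate_gt_le (h : IsNonnegWeights P X) (c : ℤ × ℤ) {n L : ℕ}
    (hL : c.1 + c.2 + L = n) (a : ℝ) :
    P.real {ω | ∃ u : ℤ × ℤ, c ≤ u ∧ u.1 + u.2 = n ∧ a < lpp (X ω) c u} ≤
      P.real {ω | ∃ v : ℤ × ℤ, 0 ≤ v ∧ v.1 + v.2 = L ∧ a ≤ lpp (X ω) 0 v} := by
  have hm : MeasurableSet {W : ℤ × ℤ → ℝ | ∃ v : ℤ × ℤ, 0 ≤ v ∧ v.1 + v.2 = L ∧ a ≤ lpp W 0 v} := by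
    have : {W : ℤ × ℤ → ℝ | ∃ v : ℤ × ℤ, 0 ≤ v ∧ v.1 + v.2 = L ∧ a ≤ lpp W 0 v} =
        ⋃ (v : ℤ × ℤ) (_ : 0 ≤ v) (_ : v.1 + v.2 = L), {W | a ≤ lpp W 0 v} := by
      ext W; simp only [Set.mem_iUnion, exists_prop]; rfl
    rw [this]
    exact MeasurableSet.iUnion fun v => MeasurableSet.iUnion fun _ => MeasurableSet.iUnion fun _ =>
      measurableSet_le measurable_const (_root_.measurable_lpp _ _)
  have hid := (h.identDistrib_comp (add_left_injective c)).measure_mem_eq hm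
  have hid' := congrArg ENNReal.toReal hid
  refine le_trans (measureReal_mono (fun ω hω => ?_) (measure_ne_top _ _)) (le_of_eq hid')
  obtain ⟨u, h1, h2, h3⟩ := hω
  refine ⟨u - c, sub_nonneg.2 h1, by simp only [Prod.fst_sub, Prod.snd_sub]; omega, ?_⟩
  rw [← lpp_translate, zero_add, sub_add_cancel]
  exact h3.le

/-- The N corners fail with probability at most 1/(4N) each. From the point of φ at distance k from
the line the failure probability is at most r^k with r ≤ 1/5, and these sum to at most 1/4 as well.
-/
theorem half_le_measureReal_lightEvent (h : IsNonnegWeights P X) {d : ℤ × ℤ} {ℓ N j₀ n : ℕ}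
    (hℓ : (ℓ : ℤ) = d.1 + d.2) (hn : n = N * ℓ + j₀) {φ : ℕ → ℤ × ℤ}
    (hφ : ∀ i < j₀, (φ i).1 + (φ i).2 = N * ℓ + i) {α : ℝ} (hα0 : 0 < α)
    (hα : Integrable (fun ω => Real.exp (α * X ω 0)) P) {C : ℝ}
    (hC : 2 * (∫ ω, Real.exp (α * X ω 0) ∂P) * Real.exp (-α * C) ≤ 1 / 5) {β : ℕ → ℝ}
    (hβ : ∀ i < N, P.real {ω | ∃ v : ℤ × ℤ, 0 ≤ v ∧ v.1 + v.2 = (n - i * ℓ : ℕ) ∧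
      β i ≤ lpp (X ω) 0 v} ≤ 1 / (4 * N)) :
    1 / 2 ≤ P.real (X ⁻¹' lightEvent d N j₀ n φ β C) := by
  set r := 2 * (∫ ω, Real.exp (α * X ω 0) ∂P) * Real.exp (-α * C) with hr
  have hr0 : 0 ≤ r := by
    have := h.one_le_expMoment hα0 hα
    positivity
  have hm : MeasurableSet (X ⁻¹' lightEvent d N j₀ n φ β C) :=
    h.measurable (measurableSet_lightEvent d N j₀ n φ β C)
  let A : ℕ → Set Ω := fun i =>
    {ω | ∃ u : ℤ × ℤ, i • d ≤ u ∧ u.1 + u.2 = n ∧ β i < lpp (X ω) (i • d) u}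
  let B : ℕ → Set Ω := fun i =>
    {ω | ∃ v γ, IsUpRightPath (φ i) v (j₀ - i) γ ∧ C * (j₀ - i) ≤ pathWeight (X ω) (j₀ - i) γ}
  have hsub : (X ⁻¹' lightEvent d N j₀ n φ β C)ᶜ ⊆
      (⋃ i ∈ Finset.range N, A i) ∪ ⋃ i ∈ Finset.range j₀, B i := by
    intro ω hω
    by_contra hnot
    rw [Set.mem_union, not_or] at hnot
    obtain ⟨hA, hB⟩ := hnot
    refine hω ⟨fun i hi u h1 h2 => ?_, fun i hi u h1 h2 => ?_⟩
    · by_contra hlt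
      exact hA (Set.mem_biUnion (Finset.mem_coe.2 (Finset.mem_range.2 hi))
        ⟨u, h1, h2, not_le.1 hlt⟩)
    · by_contra hlt
      refine hB (Set.mem_biUnion (Finset.mem_coe.2 (Finset.mem_range.2 hi)) ?_)
      obtain ⟨M, γ, hγ, e⟩ := exists_path_lpp (X ω) h1
      obtain rfl : M = j₀ - i := by
        have h3 := hγ.length_eq
        have h4 := hφ i hi
        have h5 : (n : ℤ) = N * ℓ + j₀ := by exact_mod_cast hn
        omega
      exact ⟨u, γ, hγ, by rw [e]; exact (not_le.1 hlt).le⟩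
  have hA : ∀ i ∈ Finset.range N, P.real (A i) ≤ 1 / (4 * N) := fun i hi => by
    have hi := Finset.mem_range.1 hi
    refine (h.measureReal_exists_lpp_translate_gt_le (i • d) (L := n - i * ℓ) ?_ _).trans (hβ i hi)
    have h1 := Nat.mul_le_mul_right ℓ hi.le
    rw [Nat.cast_sub (by omega), nsmul_fst_add_snd, ← hℓ]
    push_cast
    ring
  have hB : ∀ i ∈ Finset.range j₀, P.real (B i) ≤ r ^ (j₀ - i) := fun i hi => by
    have hi := Finset.mem_range.1 hi
    refine (h.measureReal_exists_path_ge hα0 hα (φ i) (j₀ - i) _).trans (le_of_eq ?_)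
    rw [hr, mul_pow _ (Real.exp _), ← Real.exp_nat_mul, Nat.cast_sub hi.le]
    congr 2
    ring
  have hgeom : ∀ k : ℕ, ∑ i ∈ Finset.range k, r ^ (k - i) ≤ 1 / 4 := by
    intro k
    induction k with
    | zero => simp
    | succ k ih =>
      have : ∑ i ∈ Finset.range (k + 1), r ^ (k + 1 - i) =
          r * (∑ i ∈ Finset.range k, r ^ (k - i)) + r := by
        rw [Finset.sum_range_succ, Finset.mul_sum, Nat.add_sub_cancel_left, pow_one]
        congr 1
        refine Finset.sum_congr rfl fun i hi => ?_
        rw [← pow_succ', Nat.succ_sub (Finset.mem_range.1 hi).le]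
      rw [this]
      nlinarith
  have h1 : P.real (⋃ i ∈ Finset.range N, A i) ≤ 1 / 4 := by
    refine (measureReal_biUnion_finset_le _ _).trans ((Finset.sum_le_sum hA).trans ?_)
    rw [Finset.sum_const, Finset.card_range, nsmul_eq_mul]
    rcases Nat.eq_zero_or_pos N with h0 | h0
    · simp [h0]
    · have : (0 : ℝ) < N := by exact_mod_cast h0
      exact le_of_eq (by field_simp)
  have h2 : P.real (⋃ i ∈ Finset.range j₀, B i) ≤ 1 / 4 :=
    (measureReal_biUnion_finset_le _ _).trans ((Finset.sum_le_sum hB).trans (hgeom j₀))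
  have h3 := (measureReal_mono hsub (measure_ne_top P _)).trans (measureReal_union_le _ _)
  rw [probReal_compl_eq_one_sub hm] at h3
  linarith

/-- The Harris argument is applied with E the heaviness of a candidate path and D the lightness of
the environment with that path zeroed. When both hold for one candidate, v is the strict maximiser
on the line, so the tie convention plays no role. -/
theorem half_mul_le_measureReal_pointToLineEnd (h : IsNonnegWeights P X) {d v : ℤ × ℤ}
    (hd : 0 ≤ d) {ℓ N j₀ n : ℕ} (hℓ : (ℓ : ℤ) = d.1 + d.2) (hn : n = N * ℓ + j₀) (hj₀ : 0 < j₀)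
    (hdv : N • d ≤ v) (hvn : v.1 + v.2 = n) {α : ℝ} (hα0 : 0 < α)
    (hα : Integrable (fun ω => Real.exp (α * X ω 0)) P) {x K C : ℝ} (hCK : C ≤ K)
    (hC : 2 * (∫ ω, Real.exp (α * X ω 0) ∂P) * Real.exp (-α * C) ≤ 1 / 5) {β : ℕ → ℝ}
    (hβK : ∀ i < N, β i ≤ (N - 1 - i) * x + K * j₀)
    (hβ : ∀ i < N, P.real {ω | ∃ v : ℤ × ℤ, 0 ≤ v ∧ v.1 + v.2 = (n - i * ℓ : ℕ) ∧
      β i ≤ lpp (X ω) 0 v} ≤ 1 / (4 * N)) :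
    1 / 2 * (P.real {ω | x ≤ lpp (X ω) 0 d} ^ N * P.real {ω | K < X ω 0} ^ j₀) ≤
      P.real {ω | (pointToLineEnd (X ω) n).1 = v.1} := by
  classical
  obtain ⟨j, φ₀, hφ₀⟩ := exists_isUpRightPath hdv
  have hn' : (n : ℤ) = N * ℓ + j₀ := by exact_mod_cast hn
  obtain rfl : j = j₀ := by
    have h1 := hφ₀.length_eq
    have h2 := nsmul_fst_add_snd N d
    rw [← hℓ] at h2
    omega
  -- A step path continues beyond index j, so all its points, also those past the end, lie in the
  -- positive quadrant.
  obtain ⟨T, -, hT⟩ := hφ₀.exists_stepPath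
  set φ := stepPath (N • d) T with hφdef
  have hφ : IsUpRightPath (N • d) v j φ := hφ₀.congr hT
  have hlev : ∀ i, (φ i).1 + (φ i).2 = N * ℓ + i := fun i => by
    have h1 := (stepPath_isUpRightPath (N • d) T i).level (le_refl i)
    rwa [nsmul_fst_add_snd, ← hℓ] at h1
  have hφ0 : ∀ i, 0 ≤ φ i := fun i =>
    (nsmul_nonneg hd N).trans (stepPath_isUpRightPath (N • d) T i).le
  let I := (Finset.range n).powerset.filter fun S =>
    IsUpRightPath 0 v n (stepPath 0 S) ∧ IsSkeletonPath d ℓ N j φ (stepPath 0 S)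
  let E : Finset ℕ → Set (ℤ × ℤ → ℝ) := fun S => heavyEvent ℓ N j x K (stepPath 0 S)
  let D : Finset ℕ → Set (ℤ × ℤ → ℝ) := fun S =>
    zeroOn (pathSites n (stepPath 0 S)) ⁻¹' lightEvent d N j n φ β C
  have key := h.mul_measureReal_biUnion_le I E D (fun S => pathSites n (stepPath 0 S))
    (Finset.Icc (0 : ℤ × ℤ) (n, n)) (c := 1 / 2)
    (fun S _ => measurableSet_heavyEvent _ _ _ _ _ _)
    (fun S _ => measurable_zeroOn _ (measurableSet_lightEvent _ _ _ _ _ _ _))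
    (fun S hS z hz => by
      obtain ⟨k, hk, rfl⟩ := Finset.mem_image.1 hz
      have hk := Finset.mem_range.1 hk
      have hp := (Finset.mem_filter.1 hS).2.1
      have h1 := hp.start_le (i := k + 1) (by omega)
      have h2 := hp.le_finish (i := k + 1) (by omega)
      have h3 := h1.trans h2
      have h4 := h3.1
      have h5 := h3.2
      simp only [Prod.fst_zero, Prod.snd_zero] at h4 h5
      refine Finset.mem_Icc.2 ⟨h1, h2.trans ⟨?_, ?_⟩⟩ <;> simp only <;> omega)
    (fun S _ W W' e hW => heavyEvent_congr hn e hW)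
    (fun S _ W W' e hW => heavyEvent_mono e hW)
    (fun S _ W W' e hW => zeroOn_mem_lightEvent_congr hd hφ0 e hW)
    (fun S _ W W' e hW => lightEvent_anti (fun z => by
      by_cases hz : z ∈ (pathSites n (stepPath 0 S) : Set (ℤ × ℤ))
      · simp only [zeroOn, hz, if_true]; exact le_rfl
      · simp only [zeroOn, hz, if_false]; exact e z) hW)
    (fun S _ => (h.half_le_measureReal_lightEvent hℓ hn (fun i _ => hlev i) hα0 hα hC hβ).trans
      (measureReal_mono (fun ω hω => lightEvent_anti (zeroOn_le (h.nonneg ω) _) hω)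
        (measure_ne_top _ _)))
  refine le_trans (mul_le_mul_of_nonneg_left ((h.pow_mul_pow_le_measureReal_blocks hd hφ x K).trans
    (measureReal_mono (fun ω hω => ?_) (measure_ne_top _ _))) (by norm_num))
    (key.trans (measureReal_mono (fun ω hω => ?_) (measure_ne_top _ _)))
  · obtain ⟨S, hS, h1, h2, h3⟩ := exists_skeleton_path hd hℓ hn hφ hω.1 hω.2
    exact Set.mem_biUnion (Finset.mem_coe.2 (Finset.mem_filter.2 ⟨hS, h1, h2⟩)) h3
  · obtain ⟨S, hS, hE, hD⟩ := Set.mem_iUnion₂.1 (show X ω ∈ _ from hω)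
    obtain ⟨-, hp, hsk⟩ := Finset.mem_filter.1 hS
    exact pointToLineEnd_eq_of_forall_lt ((nsmul_nonneg hd N).trans hdv) hvn fun u hu0 hun huv =>
      lpp_lt_of_heavy_of_light hn hj₀ hp hsk hCK hβK (h.nonneg ω) hE hD hu0 hun huv

end IsNonnegWeights

/-! ### Choice of scales and lower bound for the endpoint -/

theorem nsmul_dirPoint_le_endpoint {t : ℝ} (ht : t ∈ Set.Icc (-(1 / 2) : ℝ) (1 / 2)) {N M n : ℕ}
    (hn : N * M ≤ n) :
    N • dirPoint t M ≤ (⌊(n : ℝ) / 2 + t * n⌋, (n : ℤ) - ⌊(n : ℝ) / 2 + t * n⌋) := by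
  refine (nsmul_dirPoint_le t N M).trans ((dirPoint_mono ht hn).trans ⟨le_rfl, ?_⟩)
  have := dirPoint_sum_le t n
  simp only [dirPoint] at this ⊢
  linarith

/-- Taking M = ⌊(1 − κ)n/N⌋ leaves at least κn for the final segment. Rounding M costs at most N,
and ℓ being M or M − 1 costs at most another N; both fit into κn > 2N. -/
theorem exists_block_decomposition {t κ : ℝ} (ht : t ∈ Set.Icc (-(1 / 2) : ℝ) (1 / 2))
    (hκ0 : 0 < κ) (hκ : κ ≤ 1 / 2) {N M₀ n : ℕ} (hN : 0 < N) (hn : 2 * N < κ * n)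
    (hM₀ : 2 * (N : ℝ) * M₀ < n) :
    ∃ M ℓ j : ℕ, (ℓ : ℤ) = (dirPoint t M).1 + (dirPoint t M).2 ∧ n = N * ℓ + j ∧ ℓ ≤ M ∧
      M₀ ≤ M ∧ N * M ≤ n ∧ κ * n ≤ j ∧ (j : ℝ) ≤ 2 * κ * n := by
  have hN0 : (0 : ℝ) < N := by exact_mod_cast hN
  have hn0 : (0 : ℝ) ≤ n := Nat.cast_nonneg n
  have hκn : κ * n ≤ 1 / 2 * n := mul_le_mul_of_nonneg_right hκ hn0
  obtain ⟨M, hM⟩ : ∃ M, M = ⌊(1 - κ) * n / N⌋₊ := ⟨_, rfl⟩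
  have hMle : (N : ℝ) * M ≤ (1 - κ) * n := by
    have := Nat.floor_le (show 0 ≤ (1 - κ) * n / N from
      div_nonneg (mul_nonneg (by linarith) hn0) hN0.le)
    rwa [← hM, le_div_iff₀ hN0, mul_comm] at this
  have hMge : (1 - κ) * n < N * M + N := by
    have := Nat.lt_floor_add_one ((1 - κ) * n / N)
    rw [← hM, div_lt_iff₀ hN0] at this
    linarith
  have hMM₀ : M₀ ≤ M := by
    rw [hM]
    refine Nat.le_floor ?_
    rw [le_div_iff₀ hN0]
    linarith
  have hNMn : N * M ≤ n := by
    have : (N : ℝ) * M ≤ n := by linarith [mul_nonneg hκ0.le hn0]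
    exact_mod_cast this
  have hd0 : 0 ≤ dirPoint t M := dirPoint_nonneg ht M
  obtain ⟨ℓ, hℓ⟩ := Int.eq_ofNat_of_zero_le (add_nonneg hd0.1 hd0.2)
  have hℓ' : (dirPoint t M).1 + (dirPoint t M).2 = ℓ := hℓ
  have hsum_le := dirPoint_sum_le t M
  have hle_sum := le_dirPoint_sum t M
  have hℓM : ℓ ≤ M := by omega
  have hMℓ : M ≤ ℓ + 1 := by omega
  obtain ⟨j, hj⟩ := Nat.exists_eq_add_of_le ((Nat.mul_le_mul_left N hℓM).trans hNMn)
  have hjR : (n : ℝ) = N * ℓ + j := by exact_mod_cast hj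
  have h1 : (N : ℝ) * ℓ ≤ N * M := by exact_mod_cast Nat.mul_le_mul_left N hℓM
  have h2 : (N : ℝ) * M ≤ N * ℓ + N := by exact_mod_cast Nat.mul_le_mul_left N hMℓ
  exact ⟨M, ℓ, j, hℓ'.symm, hj, hℓM, hMM₀, hNMn, by linarith, by linarith⟩

namespace IsNonnegWeights

variable {Ω : Type*} [MeasurableSpace Ω] {P : Measure Ω} [IsProbabilityMeasure P]
  {X : Ω → ℤ × ℤ → ℝ}

theorem exists_exp_le_tail (h : IsNonnegWeights P X) {s : ℝ}
    (hs : s ∈ Set.Icc (-(1 / 2) : ℝ) (1 / 2)) (r : ℝ) {ε : ℝ} (hε : 0 < ε) :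
    ∃ M₀ : ℕ, ∀ M ≥ M₀, Real.exp (-M * (rate P X s r + ε)) ≤
      P.real {ω | r * M ≤ lpp (X ω) 0 (dirPoint s M)} := by
  obtain ⟨M₁, hM₁⟩ := eventually_atTop.1 ((h.tendsto_rate hs r).eventually_lt_const
    (show rate P X s r < rate P X s r + ε by linarith))
  refine ⟨max M₁ 2, fun M hM => ?_⟩
  have h2 : 2 ≤ M := le_of_max_le_right hM
  have hM0 : (0 : ℝ) < M := by exact_mod_cast (by omega : 0 < M)
  have h1 := hM₁ M (le_of_max_le_left hM)
  rw [div_lt_iff₀ hM0] at h1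
  rw [← Real.le_log_iff_exp_le (h.tail_pos (dirPoint_nonneg hs M) (dirPoint_ne_zero s h2) _)]
  linarith

/-- Constants are fixed in the order C, K, κ, N, n: C for the geometric series on the final segment,
K above C and μ_0 + 1, κ so that forcing the segment costs at most e^{-εn/4}, and N so that a single
block is worth at most κn/2. -/
theorem exists_le_probEndEq (h : IsNonnegWeights P X) {t : ℝ} (ht0 : 0 < t) (ht : t ≤ 1 / 2)
    {ε : ℝ} (hε : 0 < ε) :
    ∃ n₀ : ℕ, ∀ n ≥ n₀, Real.exp (-n * (rate P X t (shape P X 0) + ε)) ≤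
      probEndEq P (fun z ω => X ω z) t n := by
  have hts : t ∈ Set.Icc (-(1 / 2) : ℝ) (1 / 2) := ⟨by linarith, ht⟩
  set μ := shape P X 0 with hμ
  have hμ0 : 0 ≤ μ := h.shape_nonneg zero_mem_Icc_half
  set J := rate P X t μ with hJ
  have hJ0 : 0 ≤ J := h.rate_nonneg hts μ
  obtain ⟨α, hα0, hα⟩ := h.expMoment
  obtain ⟨C, hC⟩ : ∃ C : ℝ, 2 * (∫ ω, Real.exp (α * X ω 0) ∂P) * Real.exp (-α * C) ≤ 1 / 5 := by
    have hm := h.one_le_expMoment hα0 hα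
    set m := ∫ ω, Real.exp (α * X ω 0) ∂P
    refine ⟨Real.log (10 * m) / α, ?_⟩
    rw [show -α * (Real.log (10 * m) / α) = -Real.log (10 * m) by field_simp, Real.exp_neg,
      Real.exp_log (by linarith)]
    exact le_of_eq (by field_simp; norm_num)
  set K := max C (μ + 1) with hK
  have hKμ : 1 ≤ K - μ := by linarith [le_max_right C (μ + 1)]
  set q := P.real {ω | K < X ω 0} with hq
  have hq0 : 0 < q := h.measureReal_lt_apply_pos 0 K
  have hq1 : q ≤ 1 := measureReal_le_one
  have hlq : Real.log q ≤ 0 := Real.log_nonpos hq0.le hq1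
  set κ := min (1 / 2) (ε / (8 * (-Real.log q + 1))) with hκ
  have hκ0 : 0 < κ := lt_min (by norm_num) (div_pos hε (by linarith))
  have hκ2 : κ ≤ 1 / 2 := min_le_left _ _
  have hκq : 2 * κ * -Real.log q ≤ ε / 4 := by
    have h1 : κ ≤ ε / (8 * (-Real.log q + 1)) := min_le_right _ _
    rw [le_div_iff₀ (by linarith)] at h1
    nlinarith
  obtain ⟨N, hN⟩ := exists_nat_gt (2 * μ / κ)
  have hN0 : (0 : ℝ) < N := lt_of_le_of_lt (by positivity) hN
  rw [div_lt_iff₀ hκ0] at hN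
  obtain ⟨M₀, hM₀⟩ := h.exists_exp_le_tail hts μ (show 0 < ε / 4 by linarith)
  obtain ⟨L₀, hL₀⟩ := eventually_atTop.1 ((h.tendsto_measureReal_pointToLine_ge
    (show 0 < κ / 2 by linarith)).eventually_lt_const (show (0 : ℝ) < 1 / (4 * N) by positivity))
  obtain ⟨n₀, hn₀⟩ := exists_nat_gt (2 * N / κ + L₀ / κ + 2 * N * M₀ + 4 / ε)
  refine ⟨n₀, fun n hn => ?_⟩
  have hnbig : 2 * N / κ + L₀ / κ + 2 * N * M₀ + 4 / ε < n :=
    hn₀.trans_le (by exact_mod_cast hn)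
  have hp1 : 0 ≤ 2 * N / κ := by positivity
  have hp2 : 0 ≤ L₀ / κ := by positivity
  have hp3 : 0 ≤ 2 * (N : ℝ) * M₀ := by positivity
  have hp4 : 0 ≤ 4 / ε := by positivity
  have hn1 : 2 * N < κ * n := by
    have : 2 * N / κ < n := by linarith
    rwa [div_lt_iff₀ hκ0, mul_comm (n : ℝ)] at this
  have hn2 : L₀ < κ * n := by
    have : L₀ / κ < n := by linarith
    rwa [div_lt_iff₀ hκ0, mul_comm (n : ℝ)] at this
  have hn4 : 4 < ε * n := by
    have : 4 / ε < n := by linarith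
    rwa [div_lt_iff₀ hε, mul_comm (n : ℝ)] at this
  have hn3 : 2 * (N : ℝ) * M₀ < n := by linarith
  have hnpos : (0 : ℝ) < n := lt_of_le_of_lt hp3 hn3
  obtain ⟨M, ℓ, j, hℓ, hj, hℓM, hMM₀, hNMn, hjge, hjle⟩ :=
    exists_block_decomposition hts hκ0 hκ2 (by exact_mod_cast hN0) hn1 hn3
  set d := dirPoint t M with hd
  have hd0 : 0 ≤ d := dirPoint_nonneg hts M
  have hNℓ : N * ℓ ≤ n := hj ▸ Nat.le_add_right _ _
  have hjR : (n : ℝ) = N * ℓ + j := by exact_mod_cast hj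
  have hℓR : (ℓ : ℝ) ≤ M := by exact_mod_cast hℓM
  have hj0 : 0 < j := by
    have : (0 : ℝ) < j := lt_of_lt_of_le (by positivity) hjge
    exact_mod_cast this
  have hμM : μ * M ≤ κ / 2 * n := by
    have h1 : 2 * (μ * M) ≤ κ * (N * M) := by
      have := mul_le_mul_of_nonneg_right hN.le (Nat.cast_nonneg (α := ℝ) M)
      linarith
    have h2 : (N : ℝ) * M ≤ n := by exact_mod_cast hNMn
    have := mul_le_mul_of_nonneg_left h2 hκ0.le
    linarith
  have hsub : ∀ i < N, ((n - i * ℓ : ℕ) : ℝ) = (N - i) * ℓ + j := fun i hi => by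
    rw [Nat.cast_sub ((Nat.mul_le_mul_right ℓ hi.le).trans hNℓ), hjR]
    push_cast
    ring
  have main := h.half_mul_le_measureReal_pointToLineEnd hd0 hℓ hj hj0
    (nsmul_dirPoint_le_endpoint hts hNMn) (by simp) hα0 hα (le_max_left C (μ + 1)) hC
    (x := μ * M) (β := fun i => (μ + κ / 2) * (n - i * ℓ : ℕ))
    -- Since ℓ ≤ M, the bound β i exceeds (N − 1 − i)μM + μj by at most one block, μM ≤ κn/2, plus
    -- the slope error κn/2. The forced segment pays with (K − μ)j ≥ j ≥ κn.
    (fun i hi => by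
      have hiN : (i : ℝ) ≤ N := by exact_mod_cast hi.le
      have h1 : κ / 2 * ((n - i * ℓ : ℕ) : ℝ) ≤ κ / 2 * n :=
        mul_le_mul_of_nonneg_left (by exact_mod_cast Nat.sub_le _ _) (by linarith)
      have h2 : μ * (((N : ℝ) - i) * ℓ) ≤ μ * ((N - i) * M) :=
        mul_le_mul_of_nonneg_left (mul_le_mul_of_nonneg_left hℓR (by linarith)) hμ0
      have h3 : (j : ℝ) ≤ (K - μ) * j := le_mul_of_one_le_left (Nat.cast_nonneg j) hKμ
      have h4 := hsub i hi
      have h5 : μ * ((n - i * ℓ : ℕ) : ℝ) = μ * (((N : ℝ) - i) * ℓ) + μ * j := by rw [h4]; ring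
      rw [add_mul, h5]
      linarith)
    (fun i hi => by
      refine (hL₀ (n - i * ℓ) ?_).le
      have h1 := Nat.mul_le_mul_right ℓ hi.le
      have h2 : j ≤ n - i * ℓ := by omega
      have h3 : (L₀ : ℝ) ≤ j := hn2.le.trans hjge
      exact le_trans (by exact_mod_cast h3) h2)
  refine le_trans ?_ main
  have htail := hM₀ M hMM₀
  -- Three losses of εn/4 each: the rate at finite M, the forced segment, and the factor 1/2 ≥
  -- e^{-1}, for which εn > 4.
  calc Real.exp (-n * (J + ε))
      ≤ Real.exp (-1) * (Real.exp (-M * (J + ε / 4)) ^ N * Real.exp (Real.log q) ^ j) := by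
        rw [← Real.exp_nat_mul, ← Real.exp_nat_mul, ← Real.exp_add, ← Real.exp_add,
          Real.exp_le_exp]
        have h1 : (N : ℝ) * M * (J + ε / 4) ≤ n * (J + ε / 4) :=
          mul_le_mul_of_nonneg_right (by exact_mod_cast hNMn) (by linarith)
        have h2 : (j : ℝ) * -Real.log q ≤ 2 * κ * n * -Real.log q :=
          mul_le_mul_of_nonneg_right hjle (by linarith)
        have h3 : 2 * κ * -Real.log q * n ≤ ε / 4 * n := mul_le_mul_of_nonneg_right hκq hnpos.le
        linarith
    _ ≤ 1 / 2 * (P.real {ω | μ * M ≤ lpp (X ω) 0 d} ^ N * q ^ j) := by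
        rw [Real.exp_log hq0]
        have h1 : Real.exp (-1) ≤ 1 / 2 := by
          rw [Real.exp_neg, one_div]
          exact inv_anti₀ (by norm_num) (by linarith [Real.add_one_le_exp (1 : ℝ)])
        gcongr

end IsNonnegWeights

/-! ### The main theorem -/

theorem tendsto_neg_log_div_of_exp_bounds {p : ℕ → ℝ} {J : ℝ}
    (hlow : ∀ ε : ℝ, 0 < ε → ∃ n₀ : ℕ, ∀ n ≥ n₀, Real.exp (-(n : ℝ) * (J + ε)) ≤ p n)
    (hup : ∀ ε : ℝ, 0 < ε → ∃ n₀ : ℕ, ∀ n ≥ n₀, p n ≤ Real.exp (-(n : ℝ) * (J - ε))) :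
    Tendsto (fun n : ℕ => -(1 / (n : ℝ)) * Real.log (p n)) atTop (𝓝 J) := by
  rw [Metric.tendsto_atTop]
  intro ε hε
  obtain ⟨n₁, h₁⟩ := hlow (ε / 2) (by linarith)
  obtain ⟨n₂, h₂⟩ := hup (ε / 2) (by linarith)
  refine ⟨max (max n₁ n₂) 1, fun n hn => ?_⟩
  have h1 := h₁ n ((le_max_left _ _).trans ((le_max_left _ _).trans hn))
  have h2 := h₂ n ((le_max_right _ _).trans ((le_max_left _ _).trans hn))
  have hn0 : (0 : ℝ) < n := by
    have : 0 < n := (le_max_right _ _).trans hn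
    exact_mod_cast this
  have hp : 0 < p n := (Real.exp_pos _).trans_le h1
  rw [← Real.le_log_iff_exp_le hp] at h1
  rw [← Real.log_le_iff_le_exp hp] at h2
  have e : -(1 / (n : ℝ)) * Real.log (p n) = -Real.log (p n) / n := by ring
  rw [Real.dist_eq, e]
  have h3 : -Real.log (p n) / n ≤ J + ε / 2 := by rw [div_le_iff₀ hn0]; linarith
  have h4 : J - ε / 2 ≤ -Real.log (p n) / n := by rw [le_div_iff₀ hn0]; linarith
  rw [abs_lt]
  constructor <;> linarith

/-! ### Reduction to weights that are non-negative everywhere -/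

section Reduction

variable {Ω : Type*} [MeasurableSpace Ω] {P : Measure Ω} [IsProbabilityMeasure P]
  {w : ℤ × ℤ → Ω → ℝ}

/-- The weights truncated below at zero, as a random field. -/
noncomputable def posField (w : ℤ × ℤ → Ω → ℝ) (ω : Ω) (z : ℤ × ℤ) : ℝ := max (w z ω) 0

theorem IsLPPWeights.ae_posField_eq (hw : IsLPPWeights P w) :
    ∀ᵐ ω ∂P, posField w ω = fun z => w z ω := by
  filter_upwards [ae_all_iff.2 hw.nonneg] with ω hω
  funext z
  exact max_eq_left (hω z)

theorem IsLPPWeights.isNonnegWeights (hw : IsLPPWeights P w) : IsNonnegWeights P (posField w) where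
  measurable_apply z := (hw.measurable z).max measurable_const
  indep := hw.indep.comp (fun _ x => max x 0) fun _ => measurable_id.max measurable_const
  identDistrib z := (hw.identDistrib z).comp (u := fun x => max x 0)
    (measurable_id.max measurable_const)
  nonneg _ _ := le_max_right _ _
  expMoment := by
    obtain ⟨α, hα0, hα⟩ := hw.expMoment
    refine ⟨α, hα0, hα.congr ?_⟩
    filter_upwards [hw.ae_posField_eq] with ω hω
    rw [hω]
  unbounded β := (hw.unbounded β).trans_le
    (measure_mono fun ω hω => (show β < w 0 ω from hω).trans_le (le_max_left _ _))

/-- The two events differ by a null set, so no measurability of p is needed; in particular it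
applies to events about `pointToLineEnd`. -/
theorem IsLPPWeights.measureReal_posField (hw : IsLPPWeights P w) (p : (ℤ × ℤ → ℝ) → Prop) :
    P.real {ω | p (posField w ω)} = P.real {ω | p fun z => w z ω} := by
  refine measureReal_congr ?_
  filter_upwards [hw.ae_posField_eq] with ω hω
  exact congrArg p hω

theorem IsLPPWeights.isShapeValue (hw : IsLPPWeights P w) {s : ℝ}
    (hs : s ∈ Set.Icc (-(1 / 2) : ℝ) (1 / 2)) :
    IsShapeValue P w s (shape P (posField w) s) := by
  filter_upwards [hw.ae_posField_eq, hw.isNonnegWeights.ae_tendsto_shape hs] with ω hω h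
  rw [← hω]
  exact h

theorem IsLPPWeights.isRateValue (hw : IsLPPWeights P w) {s : ℝ}
    (hs : s ∈ Set.Icc (-(1 / 2) : ℝ) (1 / 2)) (r : ℝ) :
    IsRateValue P w s r (rate P (posField w) s r) := by
  refine (hw.isNonnegWeights.tendsto_rate hs r).congr fun n => ?_
  rw [← hw.measureReal_posField fun W => ((r * n : ℝ) : EReal) ≤ lastPassage W 0 (dirPoint s n)]
  simp only [lastPassage_eq_coe _ (dirPoint_nonneg hs n), EReal.coe_le_coe_iff]
  ring

end Reduction

theorem mainTheorem2 {Ω : Type*} [MeasurableSpace Ω] (P : Measure Ω) [IsProbabilityMeasure P]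
    (w : ℤ × ℤ → Ω → ℝ) (hw : IsLPPWeights P w) :
    ∃ (μ : ℝ → ℝ) (J : ℝ → ℝ → ℝ),
      (∀ s ∈ Set.Icc (-(1 / 2) : ℝ) (1 / 2), IsShapeValue P w s (μ s)) ∧
      (∀ s ∈ Set.Icc (-(1 / 2) : ℝ) (1 / 2), ∀ r : ℝ, 0 < r → IsRateValue P w s r (J s r)) ∧
      ∀ t : ℝ, 0 < t → t ≤ 1 / 2 → μ t < μ 0 →
        (∀ ε : ℝ, 0 < ε → ∃ n₀ : ℕ, ∀ n : ℕ, n₀ ≤ n →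
          Real.exp (-(n : ℝ) * (J t (μ 0) + ε)) ≤ probEndEq P w t n ∧
          probEndEq P w t n ≤ probEndGe P w t n ∧
          probEndGe P w t n ≤ Real.exp (-(n : ℝ) * (J t (μ 0) - ε))) ∧
        Tendsto (fun n : ℕ => -(1 / (n : ℝ)) * Real.log (probEndEq P w t n))
          atTop (𝓝 (J t (μ 0))) ∧
        Tendsto (fun n : ℕ => -(1 / (n : ℝ)) * Real.log (probEndGe P w t n))
          atTop (𝓝 (J t (μ 0))) := by
  have h := hw.isNonnegWeights
  refine ⟨shape P (posField w), rate P (posField w), fun s hs => hw.isShapeValue hs,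
    fun s hs r _ => hw.isRateValue hs r, fun t ht0 ht hμ => ?_⟩
  have heq : ∀ n, probEndEq P (fun z ω => posField w ω z) t n = probEndEq P w t n := fun n =>
    hw.measureReal_posField fun W => (pointToLineEnd W n).1 = ⌊(n : ℝ) / 2 + t * n⌋
  have hge : ∀ n, probEndGe P (fun z ω => posField w ω z) t n = probEndGe P w t n := fun n =>
    hw.measureReal_posField fun W => ⌊(n : ℝ) / 2 + t * n⌋ ≤ (pointToLineEnd W n).1
  have hle : ∀ n, probEndEq P w t n ≤ probEndGe P w t n := fun n =>
    measureReal_mono (fun ω hω => (Eq.ge hω :)) (measure_ne_top _ _)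
  have hlow := fun (ε : ℝ) (hε : 0 < ε) => h.exists_le_probEndEq ht0 ht hε
  have hup := fun (ε : ℝ) (hε : 0 < ε) => h.exists_probEndGe_le ht0 ht hμ hε
  simp only [heq] at hlow
  simp only [hge] at hup
  refine ⟨fun ε hε => ?_, tendsto_neg_log_div_of_exp_bounds hlow fun ε hε => ?_,
    tendsto_neg_log_div_of_exp_bounds (fun ε hε => ?_) hup⟩
  · obtain ⟨n₁, h₁⟩ := hlow ε hε
    obtain ⟨n₂, h₂⟩ := hup ε hε
    exact ⟨max n₁ n₂, fun n hn => ⟨h₁ n ((le_max_left _ _).trans hn), hle n,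
      h₂ n ((le_max_right _ _).trans hn)⟩⟩
  · obtain ⟨n₂, h₂⟩ := hup ε hε
    exact ⟨n₂, fun n hn => (hle n).trans (h₂ n hn)⟩
  · obtain ⟨n₁, h₁⟩ := hlow ε hε
    exact ⟨n₁, fun n hn => (h₁ n hn).trans (hle n)⟩
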